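/- Let $K\subset\mathbb{C}$ be an imaginary quadratic field with ring of integers $\mathcal{O}_K$, $p$ a rational prime, and $\mathfrak{n}=(p)\mathfrak{m}$ with $\mathfrak{m}$ an ideal of $\mathcal{O}_K$ coprime to $(p)$. Write $\mathbb{A}_K=\mathbb{C}\times\mathbb{A}_K^f$. Fix uniformizers $\pi_{\mathfrak q}$ of all completions $K_{\mathfrak q}$, viewed as ideles that are trivial outside $\mathfrak q$. Fix representatives $I_1=\mathcal{O}_K, I_2,\dots,I_h$ of the class group, with $I_i$ for $i\ge 2$ a prime ideal coprime to $\mathfrak{n}$ and to the different, and put $g_i=\begin{pmatrix}1&0\\0&t_i\end{pmatrix}$ with $t_1=1$ and $t_i=\pi_{I_i}$ for $i\ge2$. Let $k,\ell\ge 0$ and let $V_N$ be the space of homogeneous polynomials of degree $N$ in $X,Y$ over $\mathbb{C}$, with the right action $\rho_N$ given by $P\mapsto P(aX+bY,cX+dY)$. For a nonzero ideal $\mathfrak a$ let $K_0(\mathfrak{a})\subset \mathrm{GL}_2(\mathcal{O}_K\otimes\widehat{\mathbb{Z}})$ be the subgroup of matrices that are upper triangular modulo $\mathfrak{a}$. Let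 $\varphi$ be a Hecke character of $K$ of conductor dividing $\mathfrak{n}$ with $\varphi_\infty(z)=z^{-k}\bar z^{-\ell}$, and for $u=\begin{pmatrix}a&b\\c&d\end{pmatrix}\in K_0(\mathfrak n)$ put $\varphi_\mathfrak{n}(u)=\prod_{\mathfrak q\mid\mathfrak n}\varphi_{\mathfrak q}(d_{\mathfrak q})$. A Bianchi modular form of weight $(k,\ell)$, level $K_0(\mathfrak{n})$ and central action $\varphi$ is a function $\mathcal{F}:\mathrm{GL}_2(\mathbb{A}_K)\to V_{k+\ell+2}$, smooth in the archimedean variable, such that (i) $\mathcal{F}(\gamma g)=\mathcal{F}(g)$ for $\gamma\in\mathrm{GL}_2(K)$; (ii) $\mathcal{F}(zg)=\varphi(z)\mathcal{F}(g)$ for $z\in\mathbb{A}_K^\times$; (iii) $\mathcal{F}(gu)=\varphi_\mathfrak{n}(u_f)\,\mathcal{F}(g)\rho_{k+\ell+2}(u_\infty)$ for $u=u_fu_\infty\in K_0(\mathfrak{n})\times\mathrm{SU}_2(\mathbb{C})$; (iv) $D_{id}\mathcal{F}=(\tfrac{k^2}{2}+k)\mathcal{F}$ and $D_c\mathcal{F}=(\tfrac{\ell^2}{2}+\ell)\mathcal{F}$,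 where $D_{id}/4$ and $D_c/4$ are the two components of the Casimir operator of $\mathfrak{sl}_2(\mathbb{C})\otimes_{\mathbb R}\mathbb{C}$. Its descents to $\mathcal{H}_3=\mathbb{C}\times\mathbb{R}_{>0}$ are $f^i(z,t)=t^{-1}\mathcal{F}\left(g_i\begin{pmatrix}t&z\\0&1\end{pmatrix}\right)$. For $\gamma\in\mathrm{GL}_2(\mathbb{C})$ put $$(f^i|_\gamma)(z,t)=\det(\gamma)^{-k/2}\,\overline{\det(\gamma)}^{-\ell/2}f^i(\gamma\cdot(z,t))\,\rho_{k+\ell+2}^{-1}\left(J\left(\tfrac{\gamma}{\sqrt{\det\gamma}};(z,t)\right)\right),\qquad J\left(\begin{pmatrix}a&b\\c&d\end{pmatrix};(z,t)\right)=\begin{pmatrix}cz+d&\overline{ct}\\-ct&\overline{cz+d}\end{pmatrix},$$ with the usual action of $\mathrm{GL}_2(\mathbb C)$ on $\mathcal H_3$ and one and the same square root of $\det\gamma$ throughout, and write $f^i|_\gamma=\sum_n (f^i|_\gamma)_nX^{k+\ell+2-n}Y^n$. Say that $f^i$ quasi-vanishes at a cusp $s\in\mathbb{P}^1(K)$ if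 for $\sigma\in\mathrm{GL}_2(K)$ with $\sigma\infty=s$ the constant term of the Fourier expansion in $z$ of $(f^i|_\sigma)_n$ is trivial for all $1\le n\le k+\ell+1$. Let $\Gamma_i(\mathfrak{m})=\mathrm{SL}_2(K)\cap g_iK_0(\mathfrak{m})g_i^{-1}\mathrm{GL}_2(\mathbb{C})$ and $C_i=\Gamma_i(\mathfrak{m})\infty\cup\Gamma_i(\mathfrak{m})0$. A Bianchi modular form $\mathcal{F}$ is $C$-cuspidal if $f^i$ quasi-vanishes at all cusps in $C_i$, for every $i=1,\dots,h$. For a prime $\mathfrak{q}$ of $\mathcal{O}_K$ let the operator of the double coset $K_0(\mathfrak{n})\begin{pmatrix}\pi_\mathfrak{q}&0\\0&1\end{pmatrix}K_0(\mathfrak{n})$ be $$\mathcal{F}\longmapsto \Big(g\mapsto\sum_u\varphi_\mathfrak{n}(u)^{-1}\mathcal{F}\Big(gu\begin{pmatrix}\pi_\mathfrak{q}&0\\0&1\end{pmatrix}\Big)\Big),$$ where $u$ runs over representatives in $K_0(\mathfrak{n})$ of the left cosets $u\begin{pmatrix}\pi_\mathfrak{q}&0\\0&1\end{pmatrix}K_0(\mathfrak{n})$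 contained in the double coset; it is called $T_\mathfrak{q}$ if $\mathfrak{q}\nmid\mathfrak{n}$ and $U_\mathfrak{q}$ if $\mathfrak{q}\mid\mathfrak{n}$. Let $\mathcal{H}_{\mathfrak{n},p}$ be the $\mathbb{Q}$-algebra generated by the $T_\mathfrak{q}$ with $(\mathfrak{q},\mathfrak{n})=1$ and the $U_\mathfrak{p}$ with $\mathfrak{p}\mid p$. Then $\mathcal{H}_{\mathfrak{n},p}$ acts on $C$-cuspidal forms: for every $A\in\mathcal{H}_{\mathfrak{n},p}$ and every $C$-cuspidal Bianchi modular form $\mathcal{F}$ of weight $(k,\ell)$, level $K_0(\mathfrak{n})$ and central action $\varphi$, the function $A\mathcal{F}$ is again a $C$-cuspidal Bianchi modular form of the same weight, level and central action. -/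

import Mathlib

open scoped NumberField ContDiff Classical MatrixGroups
open IsDedekindDomain

noncomputable section

universe u

namespace Bianchi

/-! ### Adeles, ideles and level groups

For an imaginary quadratic field `K`, with a fixed embedding `ι : K → ℂ`, the adele ring is
`ℂ × 𝔸_K^f`.  Accordingly `𝔸_K^×` is `ℂˣ × (𝔸_K^f)ˣ` and `GL₂(𝔸_K)` is `GL₂(ℂ) × GL₂(𝔸_K^f)`. -/

variable {K : Type u} [Field K] [NumberField K]

/-- The finite adeles of `K`. -/
abbrev FinAdele (K : Type u) [Field K] [NumberField K] : Type u := FiniteAdeleRing (𝓞 K) K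

/-- `GL₂(𝔸_K) = GL₂(ℂ) × GL₂(𝔸_K^f)`. -/
abbrev GL2Adele (K : Type u) [Field K] [NumberField K] : Type u :=
  GL (Fin 2) ℂ × GL (Fin 2) (FinAdele K)

/-- `𝔸_K^× = ℂˣ × (𝔸_K^f)ˣ`. -/
abbrev Idele (K : Type u) [Field K] [NumberField K] : Type u := ℂˣ × (FinAdele K)ˣ

/-- The diagonal embedding `GL₂(K) → GL₂(𝔸_K)`. -/
def diagEmb (ι : K →+* ℂ) (γ : GL (Fin 2) K) : GL2Adele K :=
  (Matrix.GeneralLinearGroup.map ι γ,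
    Matrix.GeneralLinearGroup.map (algebraMap K (FinAdele K)) γ)

/-- The central embedding `𝔸_K^× → GL₂(𝔸_K)`. -/
def central (z : Idele K) : GL2Adele K :=
  (Matrix.GeneralLinearGroup.scalar (Fin 2) z.1, Matrix.GeneralLinearGroup.scalar (Fin 2) z.2)

/-- The diagonal matrix `diag(a, b)` with `a, b` units. -/
def diagGL {R : Type u} [CommRing R] (a b : Rˣ) : GL (Fin 2) R where
  val := !![(a : R), 0; 0, (b : R)]
  inv := !![((a⁻¹ : Rˣ) : R), 0; 0, ((b⁻¹ : Rˣ) : R)]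
  val_inv := by simp [Matrix.one_fin_two]
  inv_val := by simp [Matrix.one_fin_two]

/-- The finite adele with component `x` at `v` and `1` elsewhere. -/
def localAdele (v : HeightOneSpectrum (𝓞 K)) (x : v.adicCompletion K) : FinAdele K :=
  RestrictedProduct.mulSingle
    (fun w : HeightOneSpectrum (𝓞 K) => w.adicCompletionIntegers K) v x

theorem localAdele_mul (v : HeightOneSpectrum (𝓞 K)) (x y : v.adicCompletion K) :
    localAdele v (x * y) = localAdele v x * localAdele v y :=
  RestrictedProduct.mulSingle_mul
    (fun w : HeightOneSpectrum (𝓞 K) => w.adicCompletionIntegers K) v x y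

theorem localAdele_one (v : HeightOneSpectrum (𝓞 K)) :
    localAdele v (1 : v.adicCompletion K) = 1 :=
  RestrictedProduct.mulSingle_one
    (fun w : HeightOneSpectrum (𝓞 K) => w.adicCompletionIntegers K) v

/-- The finite idele with component `x` at `v` and `1` elsewhere. -/
def localIdele (v : HeightOneSpectrum (𝓞 K)) (x : (v.adicCompletion K)ˣ) : (FinAdele K)ˣ where
  val := localAdele v x
  inv := localAdele v (x⁻¹ : (v.adicCompletion K)ˣ)
  val_inv := by rw [← localAdele_mul, Units.mul_inv, localAdele_one]
  inv_val := by rw [← localAdele_mul, Units.inv_mul, localAdele_one]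

/-- `𝔫 𝒪_v`, as a subset of `K_v`. -/
def localIdeal (𝔫 : Ideal (𝓞 K)) (v : HeightOneSpectrum (𝓞 K)) : Set (v.adicCompletion K) :=
  {x | ∃ y ∈ Ideal.map (algebraMap (𝓞 K) (v.adicCompletionIntegers K)) 𝔫,
    (y : v.adicCompletion K) = x}

/-- The matrices over `𝔸_K^f` with entries integral at every finite place, and lower left entry
in `𝔫 𝒪_v` for every `v`. -/
def integralMatrices (𝔫 : Ideal (𝓞 K)) : Submonoid (Matrix (Fin 2) (Fin 2) (FinAdele K)) where
  carrier := {u | ∀ v : HeightOneSpectrum (𝓞 K),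
    (∀ i j, (u i j) v ∈ v.adicCompletionIntegers K) ∧ (u 1 0) v ∈ localIdeal 𝔫 v}
  one_mem' := by
    intro v
    refine ⟨fun i j => ?_, 0, Ideal.zero_mem _, ?_⟩
    · fin_cases i <;> fin_cases j
      · exact one_mem (v.adicCompletionIntegers K)
      · exact zero_mem (v.adicCompletionIntegers K)
      · exact zero_mem (v.adicCompletionIntegers K)
      · exact one_mem (v.adicCompletionIntegers K)
    · rfl
  mul_mem' := by
    intro a b ha hb v
    have key : ∀ i j, ((a * b) i j) v = (a i 0) v * (b 0 j) v + (a i 1) v * (b 1 j) v := by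
      intro i j
      rw [Matrix.mul_apply, Fin.sum_univ_two]
      rfl
    refine ⟨fun i j => ?_, ?_⟩
    · rw [key]
      exact add_mem (mul_mem ((ha v).1 i 0) ((hb v).1 0 j)) (mul_mem ((ha v).1 i 1) ((hb v).1 1 j))
    · obtain ⟨x, hx, hx'⟩ := (ha v).2
      obtain ⟨y, hy, hy'⟩ := (hb v).2
      refine ⟨x * ⟨(b 0 0) v, (hb v).1 0 0⟩ + ⟨(a 1 1) v, (ha v).1 1 1⟩ * y,
        Ideal.add_mem _ (Ideal.mul_mem_right _ _ hx) (Ideal.mul_mem_left _ _ hy), ?_⟩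
      have e : ((x * ⟨(b 0 0) v, (hb v).1 0 0⟩ + ⟨(a 1 1) v, (ha v).1 1 1⟩ * y :
          v.adicCompletionIntegers K) : v.adicCompletion K)
          = x * (b 0 0) v + (a 1 1) v * y := rfl
      exact e.trans ((congrArg₂ (fun r s => r * (b 0 0) v + (a 1 1) v * s) hx' hy').trans
        (key 1 0).symm)

/-- The open compact subgroup `K₀(𝔫)` of `GL₂(𝒪_K ⊗ ℤ^)`: the invertible matrices `u` such that
`u` and `u⁻¹` are integral and upper triangular modulo `𝔫`. -/
def K0 (𝔫 : Ideal (𝓞 K)) : Subgroup (GL (Fin 2) (FinAdele K)) :=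
  (integralMatrices 𝔫).units

/-! ### Hecke characters -/

/-- `φ` is a Hecke character of infinity type `(-k, -ℓ)` and conductor dividing `𝔫`. -/
structure IsHeckeCharacter (ι : K →+* ℂ) (𝔫 : Ideal (𝓞 K)) (k ℓ : ℕ)
    (φ : Idele K →* ℂˣ) : Prop where
  continuous : Continuous φ
  principal : ∀ x : Kˣ,
    φ (Units.map (ι : K →* ℂ) x, FiniteAdeleRing.unitEmbedding (𝓞 K) K x) = 1
  infinityType : ∀ z : ℂˣ,
    (φ (z, 1) : ℂ) = (z : ℂ) ^ (-(k : ℤ)) * (starRingEnd ℂ z) ^ (-(ℓ : ℤ))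
  conductor : ∀ u : (FinAdele K)ˣ,
    (∀ v : HeightOneSpectrum (𝓞 K), Valued.v ((u : FinAdele K) v) = 1 ∧
      (u : FinAdele K) v - 1 ∈ localIdeal 𝔫 v) → φ (1, u) = 1

/-- The local component `φ_v` of `φ` (with value `1` at `0`). -/
def localChar (φ : Idele K →* ℂˣ) (v : HeightOneSpectrum (𝓞 K)) (x : v.adicCompletion K) : ℂˣ :=
  if h : x = 0 then 1 else φ (1, localIdele v (Units.mk0 x h))

/-- `φ_𝔫(u) = ∏_{𝔮 ∣ 𝔫} φ_𝔮(d_𝔮)` for `u = (a b; c d)`. -/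
def nebentypus (𝔫 : Ideal (𝓞 K)) (φ : Idele K →* ℂˣ) (u : GL (Fin 2) (FinAdele K)) : ℂˣ :=
  ∏ᶠ (v : HeightOneSpectrum (𝓞 K)) (_ : v.asIdeal ∣ 𝔫),
    localChar φ v ((u : Matrix (Fin 2) (Fin 2) (FinAdele K)) 1 1 v)

/-! ### The representation `V_N` and the Casimir operators -/

/-- `V_N(ℂ)`: homogeneous polynomials of degree `N` in `X = X 0` and `Y = X 1`. -/
abbrev V (N : ℕ) : Type := MvPolynomial.homogeneousSubmodule (Fin 2) ℂ N

/-- The right action `P ↦ P(aX + bY, cX + dY)` of the matrix `u = (a b; c d)` on `V_N(ℂ)`. -/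
def rho (N : ℕ) (u : Matrix (Fin 2) (Fin 2) ℂ) : V N →ₗ[ℂ] V N :=
  (MvPolynomial.aeval (R := ℂ) (fun i : Fin 2 =>
    ∑ j : Fin 2, MvPolynomial.C (u i j) * (MvPolynomial.X j : MvPolynomial (Fin 2) ℂ))
    ).toLinearMap.restrict (by
      intro P hP
      have hP' : P.IsHomogeneous N := hP
      have h : ∀ i : Fin 2, (∑ j : Fin 2, MvPolynomial.C (u i j) *
          (MvPolynomial.X j : MvPolynomial (Fin 2) ℂ)).IsHomogeneous 1 := fun i =>
        MvPolynomial.IsHomogeneous.sum _ _ _ fun j _ => MvPolynomial.isHomogeneous_C_mul_X _ _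
      have := hP'.aeval _ h
      rw [one_mul] at this
      exact this)

/-- `P_n`, where `P = ∑ P_n X^(N-n) Y^n`. -/
def coeffV {N : ℕ} (n : ℕ) (P : V N) : ℂ :=
  MvPolynomial.coeff (Finsupp.single (0 : Fin 2) (N - n) + Finsupp.single (1 : Fin 2) n)
    (P : MvPolynomial (Fin 2) ℂ)

/-- Smoothness (over `ℝ`) of a function on the open subset `GL₂(ℂ)` of `ℂ⁴`. -/
def SmoothGL (f : GL (Fin 2) ℂ → ℂ) : Prop :=
  ContDiffOn ℝ ∞ (fun A : Fin 2 → Fin 2 → ℂ =>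
      if h : (Matrix.of A).det ≠ 0 then
        f (Matrix.GeneralLinearGroup.mkOfDetNeZero (Matrix.of A) h) else 0)
    {A | (Matrix.of A).det ≠ 0}

/-- The matrix exponential, with values in `GL₂(ℂ)`. -/
def expGL (X : Matrix (Fin 2) (Fin 2) ℂ) : GL (Fin 2) ℂ := (Matrix.isUnit_exp X).unit

/-- The left-invariant derivation `(X f)(g) = d/ds f(g exp(sX))` at `s = 0`. -/
def lieDeriv (X : Matrix (Fin 2) (Fin 2) ℂ) (f : GL (Fin 2) ℂ → ℂ) (g : GL (Fin 2) ℂ) : ℂ :=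
  deriv (fun s : ℝ => f (g * expGL (s • X))) 0

/-- For a matrix `X` with real entries and `ε = 1` (resp. `ε = -1`): the action of the element of
`𝔰𝔩₂(ℂ) ⊗_ℝ ℂ ≅ 𝔰𝔩₂(ℂ) × 𝔰𝔩₂(ℂ)` corresponding to `(X, 0)` (resp. `(0, X)`), that is, of
`(X ⊗ 1 - ε (iX ⊗ i)) / 2`. -/
def compDeriv (ε : ℂ) (X : Matrix (Fin 2) (Fin 2) ℂ) (f : GL (Fin 2) ℂ → ℂ)
    (g : GL (Fin 2) ℂ) : ℂ :=
  (lieDeriv X f g - ε * Complex.I * lieDeriv (Complex.I • X) f g) / 2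

/-- The operator `D_σ = H²/2 + EF + FE` in the `σ`-component of `𝔰𝔩₂(ℂ) ⊗_ℝ ℂ`, for `σ = id`
(`ε = 1`) and `σ = c` (`ε = -1`).  `D_σ / 4 = (H² + 2EF + 2FE) / 8` is the component of the
Casimir operator (for the Killing form). -/
def casimirD (ε : ℂ) (f : GL (Fin 2) ℂ → ℂ) (g : GL (Fin 2) ℂ) : ℂ :=
  compDeriv ε !![1, 0; 0, -1] (compDeriv ε !![1, 0; 0, -1] f) g / 2
    + compDeriv ε !![0, 1; 0, 0] (compDeriv ε !![0, 0; 1, 0] f) g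
    + compDeriv ε !![0, 0; 1, 0] (compDeriv ε !![0, 1; 0, 0] f) g

/-! ### Bianchi modular forms -/

/-- Functions `GL₂(𝔸_K) → V_{k+ℓ+2}(ℂ)`. -/
abbrev AdelicFun (K : Type u) [Field K] [NumberField K] (k ℓ : ℕ) : Type u :=
  GL2Adele K → V (k + ℓ + 2)

/-- `F` belongs to `M_{(k,ℓ)}(K₀(𝔫), φ)`. -/
structure IsBianchiModularForm (ι : K →+* ℂ) (𝔫 : Ideal (𝓞 K)) (k ℓ : ℕ)
    (φ : Idele K →* ℂˣ) (F : AdelicFun K k ℓ) : Prop where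
  left_invariant : ∀ (γ : GL (Fin 2) K) (g : GL2Adele K), F (diagEmb ι γ * g) = F g
  central_action : ∀ (z : Idele K) (g : GL2Adele K), F (central z * g) = (φ z : ℂ) • F g
  right_equivariant : ∀ (g : GL2Adele K) (u : GL2Adele K),
    u.2 ∈ K0 𝔫 →
    (u.1 : Matrix (Fin 2) (Fin 2) ℂ) ∈ Matrix.specialUnitaryGroup (Fin 2) ℂ →
    F (g * u) = (nebentypus 𝔫 φ u.2 : ℂ) • rho (k + ℓ + 2) (u.1 : Matrix (Fin 2) (Fin 2) ℂ) (F g)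
  smooth : ∀ (gf : GL (Fin 2) (FinAdele K)) (n : ℕ), n ≤ k + ℓ + 2 →
    SmoothGL (fun g => coeffV n (F (g, gf)))
  casimir_id : ∀ (gf : GL (Fin 2) (FinAdele K)) (n : ℕ), n ≤ k + ℓ + 2 →
    ∀ g : GL (Fin 2) ℂ, casimirD 1 (fun g => coeffV n (F (g, gf))) g =
      ((k : ℂ) ^ 2 / 2 + k) * coeffV n (F (g, gf))
  casimir_conj : ∀ (gf : GL (Fin 2) (FinAdele K)) (n : ℕ), n ≤ k + ℓ + 2 →
    ∀ g : GL (Fin 2) ℂ, casimirD (-1) (fun g => coeffV n (F (g, gf))) g =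
      ((ℓ : ℂ) ^ 2 / 2 + ℓ) * coeffV n (F (g, gf))

/-! ### Representatives of the class group, descent to hyperbolic 3-space -/

/-- Representatives of the class group: the trivial class is represented by `𝒪_K`, and each
nontrivial class `c` by the prime ideal `𝔭 c`, which is coprime to `𝔫` and to the different. -/
def IsClassReps (𝔫 : Ideal (𝓞 K))
    (𝔭 : {c : ClassGroup (𝓞 K) // c ≠ 1} → HeightOneSpectrum (𝓞 K)) : Prop :=
  ∀ c, ClassGroup.mk0 ⟨(𝔭 c).asIdeal, mem_nonZeroDivisors_of_ne_zero (𝔭 c).ne_bot⟩ = c.1 ∧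
    IsCoprime (𝔭 c).asIdeal 𝔫 ∧ IsCoprime (𝔭 c).asIdeal (differentIdeal ℤ (𝓞 K))

/-- A choice of uniformizer `ϖ v` of `K_v` for every finite place `v`. -/
def IsUniformizers (ϖ : ∀ v : HeightOneSpectrum (𝓞 K), (v.adicCompletion K)ˣ) : Prop :=
  ∀ v, Valued.v (ϖ v : v.adicCompletion K) = WithZero.exp (-1 : ℤ)

/-- The idele `t_c`: trivial for the trivial class, and otherwise equal to the uniformizer at
`𝔭 c` and to `1` elsewhere. -/
def classIdele (ϖ : ∀ v : HeightOneSpectrum (𝓞 K), (v.adicCompletion K)ˣ)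
    (𝔭 : {c : ClassGroup (𝓞 K) // c ≠ 1} → HeightOneSpectrum (𝓞 K))
    (c : ClassGroup (𝓞 K)) : (FinAdele K)ˣ :=
  if h : c = 1 then 1 else localIdele (𝔭 ⟨c, h⟩) (ϖ (𝔭 ⟨c, h⟩))

/-- `g_c = diag(1, t_c)`. -/
def classMatrix (ϖ : ∀ v : HeightOneSpectrum (𝓞 K), (v.adicCompletion K)ˣ)
    (𝔭 : {c : ClassGroup (𝓞 K) // c ≠ 1} → HeightOneSpectrum (𝓞 K))
    (c : ClassGroup (𝓞 K)) : GL (Fin 2) (FinAdele K) :=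
  diagGL 1 (classIdele ϖ 𝔭 c)

/-- Hyperbolic 3-space `ℂ × ℝ_{>0}`. -/
abbrev H3 : Type := ℂ × {t : ℝ // 0 < t}

/-- The matrix `(t z; 0 1)` attached to `(z, t)`. -/
def H3.toGL (x : H3) : GL (Fin 2) ℂ :=
  Matrix.GeneralLinearGroup.mkOfDetNeZero !![((x.2 : ℝ) : ℂ), x.1; 0, 1]
    (by simpa [Matrix.det_fin_two] using x.2.2.ne')

/-- The descent `f^c : ℋ₃ → V_{k+ℓ+2}(ℂ)`, `f^c(z,t) = t⁻¹ F(g_c (t z; 0 1))`. -/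
def descent {k ℓ : ℕ} (ϖ : ∀ v : HeightOneSpectrum (𝓞 K), (v.adicCompletion K)ˣ)
    (𝔭 : {c : ClassGroup (𝓞 K) // c ≠ 1} → HeightOneSpectrum (𝓞 K))
    (F : AdelicFun K k ℓ) (c : ClassGroup (𝓞 K)) (x : H3) : V (k + ℓ + 2) :=
  (((x.2 : ℝ) : ℂ)⁻¹) • F (H3.toGL x, classMatrix ϖ 𝔭 c)

/-- The denominator `|cz + d|² + |ct|²` of the action of `(a b; c d)` on `ℋ₃`. -/
def denomH3 (γ : GL (Fin 2) ℂ) (x : H3) : ℝ :=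
  ‖γ 1 0 * x.1 + γ 1 1‖ ^ 2 + ‖γ 1 0 * ((x.2 : ℝ) : ℂ)‖ ^ 2

theorem denomH3_pos (γ : GL (Fin 2) ℂ) (x : H3) : 0 < denomH3 γ x := by
  unfold denomH3
  by_cases h : γ 1 0 = 0
  · have hd : γ 1 1 ≠ 0 := by
      intro h'
      have hdet : (γ : Matrix (Fin 2) (Fin 2) ℂ).det ≠ 0 := γ.det_ne_zero
      rw [Matrix.det_fin_two] at hdet
      exact hdet (by rw [h, h']; ring)
    have : 0 < ‖γ 1 0 * x.1 + γ 1 1‖ := by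
      rw [h]
      simpa using hd
    positivity
  · have : 0 < ‖γ 1 0 * ((x.2 : ℝ) : ℂ)‖ := by
      have := x.2.2.ne'
      simp [h, this]
    positivity

/-- The action of `GL₂(ℂ)` on `ℋ₃`. -/
def actH3 (γ : GL (Fin 2) ℂ) (x : H3) : H3 :=
  (((γ 0 0 * x.1 + γ 0 1) * starRingEnd ℂ (γ 1 0 * x.1 + γ 1 1)
      + γ 0 0 * starRingEnd ℂ (γ 1 0) * (((x.2 : ℝ) : ℂ)) ^ 2) / ((denomH3 γ x : ℝ) : ℂ),
    ⟨‖(γ : Matrix (Fin 2) (Fin 2) ℂ).det‖ * x.2 / denomH3 γ x,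
      div_pos (mul_pos (norm_pos_iff.2 γ.det_ne_zero) x.2.2) (denomH3_pos γ x)⟩)

/-- `J(γ; (z,t))`, for an arbitrary matrix `γ = (a b; c d)`. -/
def autJ (γ : Matrix (Fin 2) (Fin 2) ℂ) (x : H3) : Matrix (Fin 2) (Fin 2) ℂ :=
  !![γ 1 0 * x.1 + γ 1 1, starRingEnd ℂ (γ 1 0 * ((x.2 : ℝ) : ℂ));
     -(γ 1 0 * ((x.2 : ℝ) : ℂ)), starRingEnd ℂ (γ 1 0 * x.1 + γ 1 1)]

/-- The (principal) square root of `det γ`. -/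
def sqrtDet (γ : GL (Fin 2) ℂ) : ℂ :=
  (γ : Matrix (Fin 2) (Fin 2) ℂ).det ^ (1 / 2 : ℂ)

/-- The function `f|_γ`, where `det(γ)^{-k/2}` and its conjugate analogue are computed
with the same square root of `det γ` that appears in `J(γ / √det γ)`. -/
def slash {k ℓ : ℕ} (f : H3 → V (k + ℓ + 2)) (γ : GL (Fin 2) ℂ) (x : H3) : V (k + ℓ + 2) :=
  (sqrtDet γ ^ (-(k : ℤ)) * (starRingEnd ℂ (sqrtDet γ)) ^ (-(ℓ : ℤ))) •
    rho (k + ℓ + 2)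
      (autJ ((sqrtDet γ)⁻¹ • (γ : Matrix (Fin 2) (Fin 2) ℂ)) x)⁻¹ (f (actH3 γ x))

/-! ### Constant terms and `C`-cuspidality -/

/-- The Fourier expansion of `g` in the variable `z` has trivial constant term: `g` is periodic in
`z` with respect to a lattice `ℤ w₀ + ℤ w₁` of `K ⊂ ℂ`, and for every `t` its Fourier coefficient
at frequency `0`, that is, its mean over a period parallelogram, is zero.  (For a function that is
continuous in `z` this mean does not depend on the choice of the lattice of periods in `K`.) -/
def TrivialConstantTerm (ι : K →+* ℂ) (g : H3 → ℂ) : Prop :=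
  ∃ w : Module.Basis (Fin 2) ℚ K,
    (∀ (i : Fin 2) (z : ℂ) (t : {t : ℝ // 0 < t}), g (z + ι (w i), t) = g (z, t)) ∧
    ∀ t : {t : ℝ // 0 < t},
      ∫ x in (0 : ℝ)..1, ∫ y in (0 : ℝ)..1, g ((x : ℂ) * ι (w 0) + (y : ℂ) * ι (w 1), t) = 0

/-- `f` quasi-vanishes at the cusp `s ∈ ℙ¹(K) = K ∪ {∞}`: for `σ ∈ GL₂(K)` with `σ ∞ = s`, the
components `(f|_σ)_n` have trivial constant term for `1 ≤ n ≤ k + ℓ + 1`. -/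
def QuasiVanishesAt {k ℓ : ℕ} (ι : K →+* ℂ) (f : H3 → V (k + ℓ + 2)) (s : OnePoint K) : Prop :=
  ∀ σ : GL (Fin 2) K, σ • (OnePoint.infty : OnePoint K) = s →
    ∀ n : ℕ, 1 ≤ n → n ≤ k + ℓ + 1 →
      TrivialConstantTerm ι
        (fun x => coeffV n (slash f (Matrix.GeneralLinearGroup.map ι σ) x))

/-- `Γ_c(𝔫) = SL₂(K) ∩ g_c K₀(𝔫) g_c⁻¹ GL₂(ℂ)`. -/
def Gam (ϖ : ∀ v : HeightOneSpectrum (𝓞 K), (v.adicCompletion K)ˣ)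
    (𝔭 : {c : ClassGroup (𝓞 K) // c ≠ 1} → HeightOneSpectrum (𝓞 K))
    (𝔫 : Ideal (𝓞 K)) (c : ClassGroup (𝓞 K)) : Set (SL(2, K)) :=
  {γ | (classMatrix ϖ 𝔭 c)⁻¹ *
      Matrix.GeneralLinearGroup.map (algebraMap K (FinAdele K)) (γ : GL (Fin 2) K) *
        classMatrix ϖ 𝔭 c ∈ K0 𝔫}

/-- The set of cusps `C_c = Γ_c(𝔪) ∞ ∪ Γ_c(𝔪) 0`. -/
def cuspSet (ϖ : ∀ v : HeightOneSpectrum (𝓞 K), (v.adicCompletion K)ˣ)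
    (𝔭 : {c : ClassGroup (𝓞 K) // c ≠ 1} → HeightOneSpectrum (𝓞 K))
    (𝔪 : Ideal (𝓞 K)) (c : ClassGroup (𝓞 K)) : Set (OnePoint K) :=
  {s | ∃ γ ∈ Gam ϖ 𝔭 𝔪 c, s = (γ : GL (Fin 2) K) • (OnePoint.infty : OnePoint K) ∨
    s = (γ : GL (Fin 2) K) • ((0 : K) : OnePoint K)}

/-- `F` is a `C`-cuspidal Bianchi modular form of level `K₀(𝔫)`: for every class `c`, the
descent `f^c` quasi-vanishes at every cusp in `C_c`. -/
structure IsCCuspidal (ι : K →+* ℂ) (𝔪 𝔫 : Ideal (𝓞 K)) (k ℓ : ℕ) (φ : Idele K →* ℂˣ)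
    (ϖ : ∀ v : HeightOneSpectrum (𝓞 K), (v.adicCompletion K)ˣ)
    (𝔭 : {c : ClassGroup (𝓞 K) // c ≠ 1} → HeightOneSpectrum (𝓞 K))
    (F : AdelicFun K k ℓ) : Prop where
  isBianchiModularForm : IsBianchiModularForm ι 𝔫 k ℓ φ F
  quasiVanishes : ∀ (c : ClassGroup (𝓞 K)), ∀ s ∈ cuspSet ϖ 𝔭 𝔪 c,
    QuasiVanishesAt ι (descent ϖ 𝔭 F c) s

/-! ### Hecke operators -/

/-- Right translation `F ↦ F(· y)` by `y ∈ GL₂(𝔸_K^f)`. -/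
def rightTranslate (k ℓ : ℕ) (y : GL (Fin 2) (FinAdele K)) :
    Module.End ℂ (AdelicFun K k ℓ) :=
  LinearMap.funLeft ℂ (V (k + ℓ + 2)) (fun g : GL2Adele K => (g.1, g.2 * y))

/-- `K₀(𝔫) ∩ x K₀(𝔫) x⁻¹`, as a subgroup of `K₀(𝔫)`. -/
def conjStab (𝔫 : Ideal (𝓞 K)) (x : GL (Fin 2) (FinAdele K)) : Subgroup (K0 𝔫) :=
  ((K0 𝔫).map (MulAut.conj x).toMonoidHom).subgroupOf (K0 𝔫)

/-- The operator of the double coset `[K₀(𝔫) x K₀(𝔫)]`: as `u` runs over representatives of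
`K₀(𝔫) / (K₀(𝔫) ∩ x K₀(𝔫) x⁻¹)`, `K₀(𝔫) x K₀(𝔫)` is the disjoint union of the `u x K₀(𝔫)`, and
`F` is sent to `g ↦ ∑_u φ_𝔫(u)⁻¹ F(g u x)`.  The factor `φ_𝔫(u)⁻¹` makes the sum independent
of the representatives for `x = diag(π_𝔮, 1)` and `F` in `M_{(k,ℓ)}(K₀(𝔫), φ)`; the index set is
finite for every `x`. -/
def doubleCosetOp (𝔫 : Ideal (𝓞 K)) (k ℓ : ℕ) (φ : Idele K →* ℂˣ)
    (x : GL (Fin 2) (FinAdele K)) : Module.End ℂ (AdelicFun K k ℓ) :=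
  ∑ᶠ q : K0 𝔫 ⧸ conjStab 𝔫 x,
    (((nebentypus 𝔫 φ (q.out : GL (Fin 2) (FinAdele K)))⁻¹ : ℂˣ) : ℂ) •
      rightTranslate k ℓ ((q.out : GL (Fin 2) (FinAdele K)) * x)

/-- The Hecke operator `[K₀(𝔫) diag(π_𝔮, 1) K₀(𝔫)]`, called `T_𝔮` if `𝔮 ∤ 𝔫` and `U_𝔮` if
`𝔮 ∣ 𝔫`. -/
def heckeOp (𝔫 : Ideal (𝓞 K)) (k ℓ : ℕ) (φ : Idele K →* ℂˣ)
    (ϖ : ∀ v : HeightOneSpectrum (𝓞 K), (v.adicCompletion K)ˣ)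
    (𝔮 : HeightOneSpectrum (𝓞 K)) : Module.End ℂ (AdelicFun K k ℓ) :=
  doubleCosetOp 𝔫 k ℓ φ (diagGL (localIdele 𝔮 (ϖ 𝔮)) 1)

/-- The Hecke algebra `ℋ_{𝔫,p}`: the `ℚ`-algebra of operators generated by the `T_𝔮` with
`(𝔮, 𝔫) = 1` and the `U_𝔮` with `𝔮 ∣ p`. -/
def heckeAlgebra (𝔫 : Ideal (𝓞 K)) (p : ℕ) (k ℓ : ℕ) (φ : Idele K →* ℂˣ)
    (ϖ : ∀ v : HeightOneSpectrum (𝓞 K), (v.adicCompletion K)ˣ) :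
    Subalgebra ℚ (Module.End ℂ (AdelicFun K k ℓ)) :=
  Algebra.adjoin ℚ
    ({T | ∃ 𝔮 : HeightOneSpectrum (𝓞 K), IsCoprime 𝔮.asIdeal 𝔫 ∧ T = heckeOp 𝔫 k ℓ φ ϖ 𝔮} ∪
     {U | ∃ 𝔮 : HeightOneSpectrum (𝓞 K), 𝔮.asIdeal ∣ Ideal.span {(p : 𝓞 K)} ∧
        U = heckeOp 𝔫 k ℓ φ ϖ 𝔮})

end Bianchi

end

noncomputable section

universe u

namespace Bianchi

/-! The point is that C-cuspidality is an adelic condition. By `slash_descent`, `f^c|_σ` at `(z, t)`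
is `t⁻¹ F((t z; 0 1), σ⁻¹ g_c)`: left invariance moves `σ` to the finite places, and the automorphy
factor is exactly what the central character and the `SU₂`-equivariance produce. Quasi-vanishing at
a cusp is therefore the vanishing of the middle constant terms of `F` along certain `y ∈ GL₂(𝔸_K^f)`
(`MiddleTermsVanish`).

The relevant `y` are governed by the two cells `B(𝔸_K^f) K₀(𝔪)` and `B(𝔸_K^f) w K₀(𝔪)`, with `B`
upper triangular and `w` the Weyl element; they correspond to the orbits of `∞` and of `0`. If `σ∞ ∈
C_c`, then `σ⁻¹ g_c` lies in one of the cells (`mem_bruhatCell_of_cusp`). Conversely every element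
of a cell is `z σ⁻¹ g_c k` with `z` central, `σ∞ ∈ C_c` and `k ∈ K₀(𝔫)`
(`exists_cusp_of_mem_bruhatCell_one`, `exists_cusp_of_mem_bruhatCell_weyl`), and the factors `z` and
`k` only scale `F`. The converse rests on `𝔸_K^f = K + s 𝒪^` for ideles `s`, on the finiteness-free
form of the idele class decomposition, and on an approximation by products of two unipotents that
trades `K₀(𝔪)` for `K₀(𝔫)` at the cost of `Γ_c(𝔪)`. Hence `F` is C-cuspidal exactly when it is a
Bianchi form whose middle terms vanish on both cells.

A Hecke operator evaluates `F` at `y u x` with `u ∈ K₀(𝔫)` and `x = diag(π_𝔮, 1)`. The cells are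
stable under `K₀(𝔫) ⊆ K₀(𝔪)`, and, when `𝔮 ∤ 𝔪`, under `x`, by the Iwasawa decomposition at `𝔮`
(`mul_diagGL_mem_bruhatCell`). Both kinds of generators satisfy `𝔮 ∤ 𝔪`.

Two linear matters remain. The sum must again be a Bianchi form: its terms depend only on cosets
because the nebentypus is multiplicative on `K₀(𝔫)`, and smoothness together with the Casimir
equations is a linear condition. Constant terms must add although each function has its own lattice
of periods: continuity makes the mean independent of the lattice (`latticeMean_basis`), so a common
sublattice can be used. -/

variable {K : Type u} [Field K] [NumberField K]

/-! ### Components of finite adeles -/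

section Adeles

variable (a b : FinAdele K) (v : HeightOneSpectrum (𝓞 K))

@[simp] theorem finAdele_mul_apply : (a * b) v = a v * b v := rfl
@[simp] theorem finAdele_add_apply : (a + b) v = a v + b v := rfl
@[simp] theorem finAdele_sub_apply : (a - b) v = a v - b v := rfl
@[simp] theorem finAdele_neg_apply : (-a) v = -a v := rfl
@[simp] theorem finAdele_one_apply : (1 : FinAdele K) v = 1 := rfl

theorem finAdele_unit_mul_inv (s : (FinAdele K)ˣ) :
    (s : FinAdele K) v * ((s⁻¹ : (FinAdele K)ˣ) : FinAdele K) v = 1 := by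
  rw [← finAdele_mul_apply, Units.mul_inv, finAdele_one_apply]

theorem finAdele_unit_ne_zero (s : (FinAdele K)ˣ) : (s : FinAdele K) v ≠ 0 :=
  left_ne_zero_of_mul_eq_one (finAdele_unit_mul_inv v s)

theorem finAdele_inv_apply (s : (FinAdele K)ˣ) :
    ((s⁻¹ : (FinAdele K)ˣ) : FinAdele K) v = ((s : FinAdele K) v)⁻¹ :=
  eq_inv_of_mul_eq_one_right (finAdele_unit_mul_inv v s)

theorem localAdele_same (x : v.adicCompletion K) : localAdele v x v = x :=
  RestrictedProduct.mulSingle_eq_same _ _ _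

theorem localAdele_of_ne {v w : HeightOneSpectrum (𝓞 K)} (h : w ≠ v) (x : v.adicCompletion K) :
    localAdele v x w = 1 :=
  RestrictedProduct.mulSingle_eq_of_ne _ _ h

/-- The finite adele with given components, all but finitely many of which are integral. -/
def mkAdele (f : ∀ v : HeightOneSpectrum (𝓞 K), v.adicCompletion K)
    (hf : ∀ᶠ v in Filter.cofinite, f v ∈ v.adicCompletionIntegers K) : FinAdele K := ⟨f, hf⟩

@[simp] theorem mkAdele_apply (f : ∀ v : HeightOneSpectrum (𝓞 K), v.adicCompletion K) (hf) :
    mkAdele f hf v = f v := rfl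

theorem eventually_valued_unit_eq_one (s : (FinAdele K)ˣ) :
    ∀ᶠ v in Filter.cofinite, Valued.v ((s : FinAdele K) v) = 1 :=
  (FiniteAdeleRing.isUnit_iff.1 s.isUnit).2

end Adeles

/-! ### The local ideals `𝔞 𝒪_v` -/

section LocalIdeal

variable {𝔞 𝔟 : Ideal (𝓞 K)} {v : HeightOneSpectrum (𝓞 K)} {x y : v.adicCompletion K}

theorem localIdeal_add (hx : x ∈ localIdeal 𝔞 v) (hy : y ∈ localIdeal 𝔞 v) :
    x + y ∈ localIdeal 𝔞 v := by
  obtain ⟨a, ha, rfl⟩ := hx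
  obtain ⟨b, hb, rfl⟩ := hy
  exact ⟨a + b, add_mem ha hb, rfl⟩

theorem localIdeal_mul_left (hx : x ∈ v.adicCompletionIntegers K) (hy : y ∈ localIdeal 𝔞 v) :
    x * y ∈ localIdeal 𝔞 v := by
  obtain ⟨b, hb, rfl⟩ := hy
  exact ⟨⟨x, hx⟩ * b, Ideal.mul_mem_left _ _ hb, rfl⟩

theorem localIdeal_mul_right (hx : x ∈ localIdeal 𝔞 v) (hy : y ∈ v.adicCompletionIntegers K) :
    x * y ∈ localIdeal 𝔞 v := mul_comm x y ▸ localIdeal_mul_left hy hx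

theorem localIdeal_neg (hx : x ∈ localIdeal 𝔞 v) : -x ∈ localIdeal 𝔞 v := by
  simpa using localIdeal_mul_left (neg_mem (one_mem (v.adicCompletionIntegers K))) hx

theorem zero_mem_localIdeal : (0 : v.adicCompletion K) ∈ localIdeal 𝔞 v := ⟨0, zero_mem _, rfl⟩

theorem localIdeal_mono (h : 𝔞 ≤ 𝔟) (hx : x ∈ localIdeal 𝔞 v) : x ∈ localIdeal 𝔟 v := by
  obtain ⟨a, ha, rfl⟩ := hx
  exact ⟨a, Ideal.map_mono h ha, rfl⟩

theorem mem_integers_of_mem_localIdeal (hx : x ∈ localIdeal 𝔞 v) :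
    x ∈ v.adicCompletionIntegers K := by
  obtain ⟨a, -, rfl⟩ := hx
  exact a.2

theorem algebraMap_mem_localIdeal {r : 𝓞 K} (hr : r ∈ 𝔞) :
    ((algebraMap (𝓞 K) K r : K) : v.adicCompletion K) ∈ localIdeal 𝔞 v :=
  ⟨algebraMap _ _ r, Ideal.mem_map_of_mem _ hr, rfl⟩

theorem valued_algebraMap (r : 𝓞 K) :
    Valued.v ((algebraMap (𝓞 K) K r : K) : v.adicCompletion K) = v.intValuation r := by
  rw [HeightOneSpectrum.valuedAdicCompletion_eq_valuation', HeightOneSpectrum.valuation_of_algebraMap]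

theorem inv_mem_integers (h : Valued.v x = 1) : x⁻¹ ∈ v.adicCompletionIntegers K := by
  rw [HeightOneSpectrum.mem_adicCompletionIntegers, map_inv₀, h, inv_one]

theorem mem_integers_of_valued_eq_one (h : Valued.v x = 1) : x ∈ v.adicCompletionIntegers K := by
  rw [HeightOneSpectrum.mem_adicCompletionIntegers, h]

/-- Away from `𝔟` the two local ideals coincide: some `r ∈ 𝔟` is a unit at `v`, so multiply by `r`
and divide again. -/
theorem mem_localIdeal_of_mem_mul (h : ¬ v.asIdeal ∣ 𝔟) (hx : x ∈ localIdeal 𝔞 v) :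
    x ∈ localIdeal (𝔟 * 𝔞) v := by
  obtain ⟨r, hr, hrv⟩ : ∃ r ∈ 𝔟, r ∉ v.asIdeal := by
    rw [Ideal.dvd_iff_le] at h
    exact Set.not_subset.1 h
  have hr1 : Valued.v ((algebraMap (𝓞 K) K r : K) : v.adicCompletion K) = 1 := by
    rw [valued_algebraMap, HeightOneSpectrum.intValuation_eq_one_iff]
    exact hrv
  have hr0 : ((algebraMap (𝓞 K) K r : K) : v.adicCompletion K) ≠ 0 := by
    intro h0
    rw [h0, map_zero] at hr1
    exact zero_ne_one hr1
  have : ((algebraMap (𝓞 K) K r : K) : v.adicCompletion K) * x ∈ localIdeal (𝔟 * 𝔞) v := by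
    obtain ⟨a, ha, rfl⟩ := hx
    refine ⟨algebraMap _ _ r * a, ?_, rfl⟩
    rw [Ideal.map_mul]
    exact Ideal.mul_mem_mul (Ideal.mem_map_of_mem _ hr) ha
  have h2 := localIdeal_mul_left (inv_mem_integers hr1) this
  rwa [← mul_assoc, inv_mul_cancel₀ hr0, one_mul] at h2

theorem mem_localIdeal_of_not_dvd (h : ¬ v.asIdeal ∣ 𝔟) (hx : x ∈ v.adicCompletionIntegers K) :
    x ∈ localIdeal 𝔟 v := by
  have : x ∈ localIdeal (⊤ : Ideal (𝓞 K)) v := by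
    refine ⟨⟨x, hx⟩, ?_, rfl⟩
    rw [Ideal.map_top]
    trivial
  simpa using mem_localIdeal_of_mem_mul h this

theorem valued_lt_one_of_mem_localIdeal (h : v.asIdeal ∣ 𝔟) (hx : x ∈ localIdeal 𝔟 v) :
    Valued.v x < 1 := by
  obtain ⟨a, ha, rfl⟩ := hx
  have hle : Ideal.map (algebraMap (𝓞 K) (v.adicCompletionIntegers K)) 𝔟 ≤
      IsLocalRing.maximalIdeal (v.adicCompletionIntegers K) := by
    rw [Ideal.map_le_iff_le_comap]
    intro r hr
    have hr' : r ∈ v.asIdeal := Ideal.dvd_iff_le.1 h hr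
    rw [Ideal.mem_comap, IsLocalRing.mem_maximalIdeal, mem_nonunits_iff,
      HeightOneSpectrum.adicCompletionIntegers.isUnit_iff_valued_eq_one]
    have := valued_algebraMap (v := v) r
    refine ne_of_lt (this.trans_lt ?_)
    rwa [HeightOneSpectrum.intValuation_lt_one_iff_mem]
  have := hle ha
  rw [IsLocalRing.mem_maximalIdeal, mem_nonunits_iff,
      HeightOneSpectrum.adicCompletionIntegers.isUnit_iff_valued_eq_one] at this
  exact lt_of_le_of_ne a.2 this

end LocalIdeal

/-! ### Additive approximation in the finite adeles -/

section Approximation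

theorem exists_intValuation_le (v : HeightOneSpectrum (𝓞 K)) {c : WithZero (Multiplicative ℤ)}
    (hc : c ≠ 0) : ∃ d : 𝓞 K, d ≠ 0 ∧ v.intValuation d ≤ c := by
  obtain ⟨π, hπ⟩ := v.intValuation_exists_uniformizer
  obtain ⟨n, hn, -⟩ := WithZero.exists_exp_neg_natCast_lt_and_lt hc hc
  refine ⟨π ^ n, pow_ne_zero _ fun h => ?_, ?_⟩
  · rw [h, map_zero] at hπ
    exact WithZero.exp_ne_zero hπ.symm
  rw [map_pow, hπ, ← WithZero.exp_nsmul]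
  simpa using hn.le

/-- Only finitely many places impose a condition beyond integrality; the product of the local
solutions there works, since extra integral factors only decrease valuations. -/
theorem exists_forall_intValuation_le (f : HeightOneSpectrum (𝓞 K) → WithZero (Multiplicative ℤ))
    (hf0 : ∀ v, f v ≠ 0) (hf : ∀ᶠ v in Filter.cofinite, 1 ≤ f v) :
    ∃ D : 𝓞 K, D ≠ 0 ∧ ∀ v : HeightOneSpectrum (𝓞 K), v.intValuation D ≤ f v := by
  choose d hd0 hd using fun v => exists_intValuation_le v (hf0 v)
  have hfin : {v | ¬ 1 ≤ f v}.Finite := hf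
  refine ⟨∏ v ∈ hfin.toFinset, d v, Finset.prod_ne_zero_iff.2 fun v _ => hd0 v, fun v => ?_⟩
  by_cases h : 1 ≤ f v
  · exact (v.intValuation_le_one _).trans h
  · rw [← Finset.mul_prod_erase _ _ (hfin.mem_toFinset.2 h), map_mul]
    exact (mul_le_of_le_one_right' (v.intValuation_le_one _)).trans (hd v)

/-- Density of `𝓞 K` in `𝒪_v`, in two stages: `K` is dense in `K_v`, and an element of `K` close to
the integral `b` is itself `v`-integral, hence close to a global integer. -/
theorem exists_valued_sub_le (v : HeightOneSpectrum (𝓞 K)) {b : v.adicCompletion K}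
    (hb : b ∈ v.adicCompletionIntegers K) {c : WithZero (Multiplicative ℤ)} (hc : c ≠ 0) :
    ∃ x : 𝓞 K, Valued.v (((algebraMap (𝓞 K) K x : K) : v.adicCompletion K) - b) ≤ c := by
  obtain ⟨d, hd0, hd⟩ := exists_intValuation_le v hc
  have hdv : Valued.v ((algebraMap (𝓞 K) K d : K) : v.adicCompletion K) ≠ 0 := by
    rw [valued_algebraMap]
    exact v.intValuation_ne_zero d hd0
  obtain ⟨k, hk⟩ : ∃ k : K, Valued.v ((k : v.adicCompletion K) - b) ≤ v.intValuation d := by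
    have hdr := HeightOneSpectrum.denseRange_algebraMap (R := 𝓞 K) (K := K) (v := v)
    have hcont : Continuous fun y : v.adicCompletion K =>
        (y - b) * ((algebraMap (𝓞 K) K d : K) : v.adicCompletion K)⁻¹ :=
      (continuous_id.sub continuous_const).mul continuous_const
    have hopen := (Valued.isOpen_valuationSubring (v.adicCompletion K)).preimage hcont
    obtain ⟨k, hk⟩ := hdr.exists_mem_open hopen ⟨b, by
      rw [Set.mem_preimage, sub_self, zero_mul]
      exact zero_mem (v.adicCompletionIntegers K)⟩
    refine ⟨k, ?_⟩
    have hk' : Valued.v (((k : v.adicCompletion K) - b) *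
        ((algebraMap (𝓞 K) K d : K) : v.adicCompletion K)⁻¹) ≤ 1 := hk
    rwa [map_mul, map_inv₀, mul_inv_le_iff₀ (zero_lt_iff.2 hdv), one_mul, valued_algebraMap] at hk'
  have hk1 : v.valuation K k ≤ 1 := by
    rw [← HeightOneSpectrum.valuedAdicCompletion_eq_valuation', ← sub_add_cancel
      (k : v.adicCompletion K) b]
    exact (Valuation.map_add _ _ _).trans (max_le (hk.trans (v.intValuation_le_one d)) hb)
  obtain ⟨x, hx⟩ := v.exists_valuation_sub_lt_of_integer hk1 (Units.mk0 c hc)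
  refine ⟨x, ?_⟩
  rw [← sub_add_sub_cancel _ (k : v.adicCompletion K) b]
  refine (Valuation.map_add _ _ _).trans (max_le ?_ (hk.trans hd))
  have := HeightOneSpectrum.valuedAdicCompletion_eq_valuation' v (algebraMap (𝓞 K) K x - k)
  rw [sub_eq_add_neg, HeightOneSpectrum.adicCompletion.coe_add] at this
  have e : ((-k : K) : v.adicCompletion K) = - (k : v.adicCompletion K) :=
    map_neg (algebraMap K (v.adicCompletion K)) k
  rw [e, ← sub_eq_add_neg] at this
  rw [this, ← sub_eq_add_neg]
  exact hx.le

/-- Chinese remainder theorem at the primes dividing `N`; at every other prime the bound is `1` and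
integrality is enough. -/
theorem exists_forall_valued_sub_le (b : FinAdele K)
    (hb : ∀ v, b v ∈ v.adicCompletionIntegers K) {N : 𝓞 K} (hN : N ≠ 0) :
    ∃ x : 𝓞 K, ∀ v : HeightOneSpectrum (𝓞 K),
      Valued.v (((algebraMap (𝓞 K) K x : K) : v.adicCompletion K) - b v) ≤ v.intValuation N := by
  choose x hx using fun v => exists_valued_sub_le v (hb v) (v.intValuation_ne_zero N hN)
  have hfin := Ideal.finite_factors (R := 𝓞 K) (I := Ideal.span {N}) (by simpa using hN)
  let e : HeightOneSpectrum (𝓞 K) → ℕ := fun v =>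
    (Associates.mk v.asIdeal).count (Associates.mk (Ideal.span {N})).factors
  have he : ∀ v, v.intValuation N = WithZero.exp (-(e v : ℤ)) := fun v =>
    v.intValuation_if_neg hN
  obtain ⟨y, hy⟩ := IsDedekindDomain.exists_forall_sub_mem_ideal (s := hfin.toFinset)
    (fun v : HeightOneSpectrum (𝓞 K) => v.asIdeal) e (fun v _ => v.prime)
    (fun v _ w _ hvw h => hvw (HeightOneSpectrum.ext h)) (fun v => x v)
  refine ⟨y, fun v => ?_⟩
  by_cases hv : v.asIdeal ∣ Ideal.span {N}
  · have h1 := hy v (hfin.mem_toFinset.2 hv)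
    rw [← HeightOneSpectrum.intValuation_le_pow_iff_mem, ← he, ← valued_algebraMap, map_sub] at h1
    rw [← sub_add_sub_cancel _ ((algebraMap (𝓞 K) K (x v) : K) : v.adicCompletion K) (b v)]
    refine (Valuation.map_add _ _ _).trans (max_le ?_ (hx v))
    convert h1 using 2
    exact (map_sub (algebraMap K (v.adicCompletion K)) _ _).symm
  · have : v.intValuation N = 1 := by
      rw [HeightOneSpectrum.intValuation_eq_one_iff]
      rwa [Ideal.dvd_span_singleton] at hv
    rw [this]
    exact sub_mem (HeightOneSpectrum.coe_algebraMap_mem (𝓞 K) K v y) (hb v)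

/-- This is `𝔸_K^f = K + s 𝒪^`. Clear the denominators of `a` with `D`, approximate `D a` by a
global integer `x` modulo a sufficiently divisible `N`, and take `X = x / D`. -/
theorem exists_approx (s : (FinAdele K)ˣ) (a : FinAdele K) :
    ∃ X : K, ∃ e : FinAdele K, (∀ v, e v ∈ v.adicCompletionIntegers K) ∧
      algebraMap K (FinAdele K) X = a + s * e := by
  obtain ⟨D, hD0, hD⟩ := exists_forall_intValuation_le (K := K)
    (fun v => if a v ∈ v.adicCompletionIntegers K then 1 else (Valued.v (a v))⁻¹)
    (fun v => by
      split_ifs with h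
      · exact one_ne_zero
      · refine inv_ne_zero fun h0 => h ?_
        rw [HeightOneSpectrum.mem_adicCompletionIntegers, h0]
        exact zero_le_one)
    (by filter_upwards [a.2] with v hv; exact (if_pos hv).ge)
  -- The modulus is divisible by `D s` at every place, so that the error is still integral after
  -- division by `D` and by `s`.
  obtain ⟨N, hN0, hN⟩ := exists_forall_intValuation_le (K := K)
    (fun v => v.intValuation D * Valued.v ((s : FinAdele K) v))
    (fun v => mul_ne_zero (v.intValuation_ne_zero D hD0)
      ((Valuation.ne_zero_iff _).2 (finAdele_unit_ne_zero v s)))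
    (by
      have h1 : ∀ᶠ v : HeightOneSpectrum (𝓞 K) in Filter.cofinite, v.intValuation D = 1 := by
        have hfin := Ideal.finite_factors (R := 𝓞 K) (I := Ideal.span {D}) (by simpa using hD0)
        refine hfin.subset fun v hv => ?_
        by_contra h
        refine hv ?_
        change v.intValuation D = 1
        rw [HeightOneSpectrum.intValuation_eq_one_iff]
        rwa [Set.mem_ofPred_eq, Ideal.dvd_span_singleton] at h
      filter_upwards [h1, eventually_valued_unit_eq_one s] with v h1 h2
      rw [h1, h2, one_mul])
  set d : FinAdele K := algebraMap K (FinAdele K) (algebraMap (𝓞 K) K D) with hd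
  have hDK : algebraMap (𝓞 K) K D ≠ 0 := by simpa using hD0
  have hdv : ∀ v, d v = ((algebraMap (𝓞 K) K D : K) : v.adicCompletion K) := fun v => rfl
  have hdi : ∀ v, (d * a) v ∈ v.adicCompletionIntegers K := by
    intro v
    rw [finAdele_mul_apply, hdv, HeightOneSpectrum.mem_adicCompletionIntegers, map_mul,
      valued_algebraMap]
    have := hD v
    split_ifs at this with h
    · exact mul_le_one' this h
    · refine (mul_le_mul_left this _).trans (inv_mul_le_one₀ ?_ |>.2 le_rfl)
      refine zero_lt_iff.2 fun h0 => h ?_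
      rw [HeightOneSpectrum.mem_adicCompletionIntegers, h0]
      exact zero_le_one
  obtain ⟨x, hx⟩ := exists_forall_valued_sub_le (d * a) hdi hN0
  have hdinv : d * algebraMap K (FinAdele K) (algebraMap (𝓞 K) K D)⁻¹ = 1 := by
    rw [hd, ← map_mul, mul_inv_cancel₀ hDK, map_one]
  refine ⟨algebraMap (𝓞 K) K x * (algebraMap (𝓞 K) K D)⁻¹,
    ((s⁻¹ : (FinAdele K)ˣ) : FinAdele K) *
      (algebraMap K (FinAdele K) (algebraMap (𝓞 K) K x * (algebraMap (𝓞 K) K D)⁻¹) - a),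
    fun v => ?_, ?_⟩
  · have e1 : d v * (algebraMap K (FinAdele K)
        (algebraMap (𝓞 K) K x * (algebraMap (𝓞 K) K D)⁻¹) - a) v =
        ((algebraMap (𝓞 K) K x : K) : v.adicCompletion K) - (d * a) v := by
      rw [← finAdele_mul_apply, mul_sub, map_mul, mul_left_comm, hdinv, mul_one]
      rfl
    have h1 := (hx v).trans (hN v)
    rw [← e1, map_mul, hdv, valued_algebraMap, mul_le_mul_iff_right₀ (zero_lt_iff.2
      (v.intValuation_ne_zero D hD0))] at h1
    rw [finAdele_mul_apply, finAdele_inv_apply, HeightOneSpectrum.mem_adicCompletionIntegers,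
      map_mul, map_inv₀]
    exact (inv_mul_le_one₀ (zero_lt_iff.2
      ((Valuation.ne_zero_iff _).2 (finAdele_unit_ne_zero v s)))).2 h1
  · rw [Units.mul_inv_cancel_left, add_sub_cancel]

/-! ### Ideles modulo `K^×`, class representatives and units -/

theorem valuation_eq_exp_neg_count (v : HeightOneSpectrum (𝓞 K)) {α : K} (hα : α ≠ 0) :
    v.valuation K α =
      WithZero.exp (-(FractionalIdeal.count K v (FractionalIdeal.spanSingleton _ α))) := by
  have hint : ∀ r : 𝓞 K, r ≠ 0 → v.valuation K (algebraMap (𝓞 K) K r) =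
      WithZero.exp (-(FractionalIdeal.count K v
        (FractionalIdeal.spanSingleton (nonZeroDivisors (𝓞 K)) (algebraMap (𝓞 K) K r)))) := by
    intro r hr
    rw [HeightOneSpectrum.valuation_of_algebraMap, v.intValuation_if_neg hr,
      ← FractionalIdeal.coeIdeal_span_singleton, FractionalIdeal.count_coe]
    simpa using hr
  obtain ⟨a, b, hb, rfl⟩ := IsFractionRing.div_surjective (A := 𝓞 K) α
  have hb0 := nonZeroDivisors.ne_zero hb
  have ha0 : a ≠ 0 := by rintro rfl; simp at hα
  have hbK : algebraMap (𝓞 K) K b ≠ 0 := by simpa using hb0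
  have h := hint a ha0
  rw [← div_mul_cancel₀ (algebraMap (𝓞 K) K a) hbK, map_mul, hint b hb0,
    ← FractionalIdeal.spanSingleton_mul_spanSingleton,
    FractionalIdeal.count_mul K v (FractionalIdeal.spanSingleton_ne_zero_iff.2 hα)
      (FractionalIdeal.spanSingleton_ne_zero_iff.2 hbK), neg_add, WithZero.exp_add] at h
  exact mul_right_cancel₀ WithZero.exp_ne_zero h

/-- The prime ideal, or the unit ideal, that represents a class. -/
def classIdeal (𝔭 : {c : ClassGroup (𝓞 K) // c ≠ 1} → HeightOneSpectrum (𝓞 K))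
    (c : ClassGroup (𝓞 K)) : Ideal (𝓞 K) :=
  if h : c = 1 then ⊤ else (𝔭 ⟨c, h⟩).asIdeal

theorem classIdeal_ne_zero (𝔭 : {c : ClassGroup (𝓞 K) // c ≠ 1} → HeightOneSpectrum (𝓞 K))
    (c : ClassGroup (𝓞 K)) : classIdeal 𝔭 c ≠ 0 := by
  unfold classIdeal
  split_ifs with h
  · exact top_ne_bot
  · exact (𝔭 ⟨c, h⟩).ne_bot

theorem mk0_classIdeal {𝔫 : Ideal (𝓞 K)}
    {𝔭 : {c : ClassGroup (𝓞 K) // c ≠ 1} → HeightOneSpectrum (𝓞 K)} (h𝔭 : IsClassReps 𝔫 𝔭)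
    (c : ClassGroup (𝓞 K)) :
    ClassGroup.mk0 ⟨classIdeal 𝔭 c, mem_nonZeroDivisors_of_ne_zero (classIdeal_ne_zero 𝔭 c)⟩
      = c := by
  by_cases h : c = 1
  · subst h
    rw [ClassGroup.mk0_eq_one_iff]
    simp only [classIdeal, dif_pos]
    exact inferInstance
  · simpa only [classIdeal, dif_neg h] using (h𝔭 ⟨c, h⟩).1

theorem valued_classIdele {ϖ : ∀ v : HeightOneSpectrum (𝓞 K), (v.adicCompletion K)ˣ}
    (hϖ : IsUniformizers ϖ) (𝔭 : {c : ClassGroup (𝓞 K) // c ≠ 1} → HeightOneSpectrum (𝓞 K))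
    (c : ClassGroup (𝓞 K)) (v : HeightOneSpectrum (𝓞 K)) :
    Valued.v ((classIdele ϖ 𝔭 c : FinAdele K) v) =
      WithZero.exp (-(FractionalIdeal.count K v
        (classIdeal 𝔭 c : FractionalIdeal (nonZeroDivisors (𝓞 K)) K))) := by
  unfold classIdele classIdeal
  split_ifs with h
  · simp [FractionalIdeal.coeIdeal_top, FractionalIdeal.count_one]
  · change Valued.v (localAdele _ _ v) = _
    by_cases hv : v = 𝔭 ⟨c, h⟩
    · subst hv
      rw [localAdele_same, hϖ, FractionalIdeal.count_self]
    · rw [localAdele_of_ne hv, map_one, FractionalIdeal.count_maximal_coprime K v (Ne.symm hv)]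
      simp

/-- The valuations of `s` define a fractional ideal `I`. With `c` its class, `I` differs from the
representative of `c` by a principal ideal `(α)`, so `s / (α t_c)` has trivial valuation everywhere.
-/
theorem exists_eq_mul_classIdele {𝔫 : Ideal (𝓞 K)}
    {ϖ : ∀ v : HeightOneSpectrum (𝓞 K), (v.adicCompletion K)ˣ} (hϖ : IsUniformizers ϖ)
    {𝔭 : {c : ClassGroup (𝓞 K) // c ≠ 1} → HeightOneSpectrum (𝓞 K)} (h𝔭 : IsClassReps 𝔫 𝔭)
    (s : (FinAdele K)ˣ) :
    ∃ (c : ClassGroup (𝓞 K)) (α : Kˣ) (u : (FinAdele K)ˣ),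
      (∀ v, Valued.v ((u : FinAdele K) v) = 1) ∧
        s = FiniteAdeleRing.unitEmbedding (𝓞 K) K α * classIdele ϖ 𝔭 c * u := by
  have hs0 : ∀ v, Valued.v ((s : FinAdele K) v) ≠ 0 := fun v =>
    (Valuation.ne_zero_iff _).2 (finAdele_unit_ne_zero v s)
  let n : HeightOneSpectrum (𝓞 K) → ℤ := fun v => -WithZero.log (Valued.v ((s : FinAdele K) v))
  have hn : ∀ v, Valued.v ((s : FinAdele K) v) = WithZero.exp (-n v) := fun v => by
    simp only [n, neg_neg, WithZero.exp_log (hs0 v)]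
  have hn0 : ∀ᶠ v in Filter.cofinite, n v = 0 := by
    filter_upwards [eventually_valued_unit_eq_one s] with v hv
    simp [n, hv]
  set I : FractionalIdeal (nonZeroDivisors (𝓞 K)) K :=
    ∏ᶠ v : HeightOneSpectrum (𝓞 K), (v.asIdeal : FractionalIdeal _ K) ^ n v with hI
  have hI0 : I ≠ 0 := by
    refine finprod_induction (p := fun J : FractionalIdeal (nonZeroDivisors (𝓞 K)) K => J ≠ 0)
      one_ne_zero (fun _ _ => mul_ne_zero) fun v => zpow_ne_zero _ ?_
    exact FractionalIdeal.coeIdeal_ne_zero.2 v.ne_bot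
  set c := ClassGroup.mk K (Units.mk0 I hI0) with hc
  have hJ := (mk0_classIdeal h𝔭 c).symm
  rw [← ClassGroup.mk_mk0 K, hc, ← div_eq_one, ← map_div, ← hc, ClassGroup.mk_eq_one_iff,
    FractionalIdeal.isPrincipal_iff] at hJ
  obtain ⟨α, hα⟩ := hJ
  have hJ0 : ((classIdeal 𝔭 c : Ideal (𝓞 K)) : FractionalIdeal (nonZeroDivisors (𝓞 K)) K) ≠ 0 :=
    FractionalIdeal.coeIdeal_ne_zero.2 (classIdeal_ne_zero 𝔭 c)
  rw [Units.val_div_eq_div_val, FractionalIdeal.coe_mk0, Units.val_mk0, div_eq_iff hJ0] at hα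
  have hα0 : α ≠ 0 := by
    rintro rfl
    rw [FractionalIdeal.spanSingleton_zero, zero_mul] at hα
    exact hI0 hα
  refine ⟨c, Units.mk0 α hα0, (FiniteAdeleRing.unitEmbedding (𝓞 K) K (Units.mk0 α hα0) *
    classIdele ϖ 𝔭 c)⁻¹ * s, fun v => ?_, (mul_inv_cancel_left _ _).symm⟩
  have hcount := congrArg (FractionalIdeal.count K v) hα
  rw [FractionalIdeal.count_mul K v (FractionalIdeal.spanSingleton_ne_zero_iff.2 hα0) hJ0, hI,
    FractionalIdeal.count_finprod K v n hn0] at hcount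
  have hαv : Valued.v ((FiniteAdeleRing.unitEmbedding (𝓞 K) K (Units.mk0 α hα0) : FinAdele K) v) =
      v.valuation K α := HeightOneSpectrum.valuedAdicCompletion_eq_valuation' v α
  rw [Units.val_mul, finAdele_mul_apply, finAdele_inv_apply, map_mul, map_inv₀, hn, hcount,
    Units.val_mul, finAdele_mul_apply, map_mul, valued_classIdele hϖ, hαv,
    valuation_eq_exp_neg_count v hα0, ← WithZero.exp_add, neg_add,
    inv_mul_cancel₀ WithZero.exp_ne_zero]

end Approximation

/-! ### Unipotent, diagonal and Weyl matrices -/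

section Elementary

variable {R : Type u} [CommRing R]

/-- The unipotent matrix `(1 x; 0 1)`. -/
def unipU (x : R) : GL (Fin 2) R where
  val := !![1, x; 0, 1]
  inv := !![1, -x; 0, 1]
  val_inv := by simp [Matrix.one_fin_two]
  inv_val := by simp [Matrix.one_fin_two]

/-- The unipotent matrix `(1 0; y 1)`. -/
def unipL (y : R) : GL (Fin 2) R where
  val := !![1, 0; y, 1]
  inv := !![1, 0; -y, 1]
  val_inv := by simp [Matrix.one_fin_two]
  inv_val := by simp [Matrix.one_fin_two]

/-- The Weyl element `(0 -1; 1 0)`. -/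
def weyl : GL (Fin 2) R where
  val := !![0, -1; 1, 0]
  inv := !![0, 1; -1, 0]
  val_inv := by simp [Matrix.one_fin_two]
  inv_val := by simp [Matrix.one_fin_two]

@[simp] theorem unipU_coe (x : R) : (unipU x : Matrix (Fin 2) (Fin 2) R) = !![1, x; 0, 1] := rfl
@[simp] theorem unipL_coe (x : R) : (unipL x : Matrix (Fin 2) (Fin 2) R) = !![1, 0; x, 1] := rfl
@[simp] theorem weyl_coe : ((weyl : GL (Fin 2) R) : Matrix (Fin 2) (Fin 2) R) = !![0, -1; 1, 0] :=
  rfl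
@[simp] theorem diagGL_coe (a b : Rˣ) :
    (diagGL a b : Matrix (Fin 2) (Fin 2) R) = !![(a : R), 0; 0, (b : R)] := rfl

theorem unipU_add (x y : R) : unipU (x + y) = unipU x * unipU y := by
  apply Units.ext; simp [add_comm]

theorem unipU_inv (x : R) : (unipU x)⁻¹ = unipU (-x) := by
  apply Units.ext; rfl

theorem unipL_inv (x : R) : (unipL x)⁻¹ = unipL (-x) := by
  apply Units.ext; rfl

theorem diagGL_inv (a b : Rˣ) : (diagGL a b)⁻¹ = diagGL a⁻¹ b⁻¹ := by
  apply Units.ext; rfl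

theorem diagGL_mul (a b c d : Rˣ) : diagGL a b * diagGL c d = diagGL (a * c) (b * d) := by
  apply Units.ext; simp

theorem diagGL_one : diagGL (1 : Rˣ) 1 = 1 := by
  apply Units.ext; simp [Matrix.one_fin_two]

theorem unipU_mul_diagGL (x : R) (a d : Rˣ) :
    unipU x * diagGL a d = diagGL a d * unipU (((a⁻¹ : Rˣ) : R) * x * d) := by
  apply Units.ext
  simp [mul_assoc]

theorem unipL_mul_diagGL (x : R) (a d : Rˣ) :
    unipL x * diagGL a d = diagGL a d * unipL (((d⁻¹ : Rˣ) : R) * x * a) := by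
  apply Units.ext
  simp [mul_assoc]

theorem diagGL_mul_weyl (a d : Rˣ) : diagGL a d * weyl = weyl * diagGL d a := by
  apply Units.ext; simp

theorem unipU_mul_weyl (x : R) : unipU x * weyl = weyl * unipL (-x) := by
  apply Units.ext; simp

theorem weyl_inv : (weyl : GL (Fin 2) R)⁻¹ = diagGL (-1) (-1) * weyl := by
  apply Units.ext; simp [weyl]

theorem scalar_eq_diagGL (a : Rˣ) : Matrix.GeneralLinearGroup.scalar (Fin 2) a = diagGL a a := by
  apply Units.ext
  ext i j
  fin_cases i <;> fin_cases j <;> simp [Matrix.GeneralLinearGroup.scalar]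

theorem diagGL_self_mul_comm (a : Rˣ) (g : GL (Fin 2) R) : diagGL a a * g = g * diagGL a a := by
  apply Units.ext
  ext i j
  fin_cases i <;> fin_cases j <;> simp [Matrix.mul_apply, Fin.sum_univ_two, mul_comm]

variable {S : Type u} [CommRing S] (f : R →+* S)

theorem map_unipU (x : R) : Matrix.GeneralLinearGroup.map f (unipU x) = unipU (f x) := by
  ext i j
  fin_cases i <;> fin_cases j <;> simp

theorem map_unipL (x : R) : Matrix.GeneralLinearGroup.map f (unipL x) = unipL (f x) := by
  ext i j
  fin_cases i <;> fin_cases j <;> simp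

theorem map_weyl : Matrix.GeneralLinearGroup.map f weyl = weyl := by
  ext i j
  fin_cases i <;> fin_cases j <;> simp

theorem map_diagGL (a d : Rˣ) : Matrix.GeneralLinearGroup.map f (diagGL a d) =
    diagGL (Units.map (f : R →* S) a) (Units.map (f : R →* S) d) := by
  ext i j
  fin_cases i <;> fin_cases j <;> simp

theorem eq_unipU_mul_diagGL {F : Type u} [Field F] (g : GL (Fin 2) F) (h : g 1 0 = 0) :
    ∃ (x : F) (a d : Fˣ), g = unipU x * diagGL a d := by
  have hdet : (g : Matrix (Fin 2) (Fin 2) F).det ≠ 0 := g.det_ne_zero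
  rw [Matrix.det_fin_two, h, mul_zero, sub_zero] at hdet
  have ha := left_ne_zero_of_mul hdet
  have hd := right_ne_zero_of_mul hdet
  refine ⟨g 0 1 / g 1 1, Units.mk0 _ ha, Units.mk0 _ hd, ?_⟩
  ext i j
  fin_cases i <;> fin_cases j <;> simp [h, hd]

theorem inv_fin_two (g : GL (Fin 2) R) :
    ((g⁻¹ : GL (Fin 2) R) : Matrix (Fin 2) (Fin 2) R) =
      ((Matrix.GeneralLinearGroup.det g)⁻¹ : Rˣ).1 • !![g 1 1, -g 0 1; -g 1 0, g 0 0] := by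
  rw [Matrix.coe_units_inv, Matrix.inv_def, Matrix.adjugate_fin_two, ← Ring.inverse_unit]
  rfl

end Elementary

/-! ### Local components of `K₀(𝔫)` and the Iwasawa decomposition -/

section Local

variable (v : HeightOneSpectrum (𝓞 K))

/-- The local component at `v`, as a ring homomorphism. -/
def evalAt : FinAdele K →+* v.adicCompletion K where
  toFun a := a v
  map_one' := rfl
  map_mul' _ _ := rfl
  map_zero' := rfl
  map_add' _ _ := rfl

/-- The local component at `v` of an element of `GL₂(𝔸_K^f)`. -/
def localGL : GL (Fin 2) (FinAdele K) →* GL (Fin 2) (v.adicCompletion K) :=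
  Matrix.GeneralLinearGroup.map (evalAt v)

@[simp] theorem localGL_apply (g : GL (Fin 2) (FinAdele K)) (i j : Fin 2) :
    localGL v g i j = g i j v := rfl

/-- The local analogue of `integralMatrices`. -/
def localMatrices (𝔫 : Ideal (𝓞 K)) : Submonoid (Matrix (Fin 2) (Fin 2) (v.adicCompletion K)) where
  carrier := {u | (∀ i j, u i j ∈ v.adicCompletionIntegers K) ∧ u 1 0 ∈ localIdeal 𝔫 v}
  one_mem' := by
    refine ⟨fun i j => ?_, zero_mem_localIdeal⟩
    rw [Matrix.one_apply]
    split_ifs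
    · exact one_mem _
    · exact zero_mem _
  mul_mem' := by
    intro a b ha hb
    refine ⟨fun i j => ?_, ?_⟩
    · rw [Matrix.mul_apply]
      exact sum_mem fun k _ => mul_mem (ha.1 i k) (hb.1 k j)
    · rw [Matrix.mul_apply, Fin.sum_univ_two]
      exact localIdeal_add (localIdeal_mul_right ha.2 (hb.1 0 0))
        (localIdeal_mul_left (ha.1 1 1) hb.2)

/-- The local component of `K₀(𝔫)`. -/
def localK0 (𝔫 : Ideal (𝓞 K)) : Subgroup (GL (Fin 2) (v.adicCompletion K)) :=
  (localMatrices v 𝔫).units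

theorem mem_K0_iff {𝔫 : Ideal (𝓞 K)} {u : GL (Fin 2) (FinAdele K)} :
    u ∈ K0 𝔫 ↔ ∀ v, localGL v u ∈ localK0 v 𝔫 :=
  ⟨fun h v => ⟨h.1 v, h.2 v⟩, fun h => ⟨fun v => (h v).1, fun v => (h v).2⟩⟩

variable {v}

/-- Integrality of `g` and of `g⁻¹` bounds both determinants by `1` while their product is `1`;
conversely the adjugate formula gives the inverse. -/
theorem mem_localK0_iff {𝔫 : Ideal (𝓞 K)} {g : GL (Fin 2) (v.adicCompletion K)} :
    g ∈ localK0 v 𝔫 ↔ (∀ i j, g i j ∈ v.adicCompletionIntegers K) ∧ g 1 0 ∈ localIdeal 𝔫 v ∧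
      Valued.v (g : Matrix (Fin 2) (Fin 2) (v.adicCompletion K)).det = 1 := by
  have hdet : ∀ h : Matrix (Fin 2) (Fin 2) (v.adicCompletion K),
      (∀ i j, h i j ∈ v.adicCompletionIntegers K) → Valued.v h.det ≤ 1 := by
    intro h hh
    rw [Matrix.det_fin_two]
    exact sub_mem (mul_mem (hh 0 0) (hh 1 1)) (mul_mem (hh 0 1) (hh 1 0))
  constructor
  · rintro ⟨h1, h2⟩
    refine ⟨h1.1, h1.2, le_antisymm (hdet _ h1.1) ?_⟩
    have h3 := hdet _ h2.1
    have h4 : (g : Matrix (Fin 2) (Fin 2) (v.adicCompletion K)).det *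
        (↑g⁻¹ : Matrix (Fin 2) (Fin 2) (v.adicCompletion K)).det = 1 := by
      rw [← Matrix.det_mul, Units.mul_inv, Matrix.det_one]
    have h5 := congrArg Valued.v h4
    rw [map_mul, map_one] at h5
    rw [← h5]
    exact mul_le_of_le_one_right' h3
  · rintro ⟨h1, h2, h3⟩
    have h4 : ((Matrix.GeneralLinearGroup.det g)⁻¹ : (v.adicCompletion K)ˣ).1 ∈
        v.adicCompletionIntegers K := by
      rw [Units.val_inv_eq_inv_val]
      exact inv_mem_integers h3
    refine ⟨⟨h1, h2⟩, ?_, ?_⟩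
    · intro i j
      change (↑g⁻¹ : Matrix (Fin 2) (Fin 2) (v.adicCompletion K)) i j ∈ _
      rw [inv_fin_two, Matrix.smul_apply]
      refine mul_mem h4 ?_
      fin_cases i <;> fin_cases j
      exacts [h1 1 1, neg_mem (h1 0 1), neg_mem (h1 1 0), h1 0 0]
    · change (↑g⁻¹ : Matrix (Fin 2) (Fin 2) (v.adicCompletion K)) 1 0 ∈ _
      rw [inv_fin_two, Matrix.smul_apply]
      exact localIdeal_mul_left h4 (localIdeal_neg h2)

theorem K0_mono {𝔪 𝔫 : Ideal (𝓞 K)} (h : 𝔫 ≤ 𝔪) : K0 𝔫 ≤ K0 𝔪 := by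
  intro u hu
  rw [mem_K0_iff] at hu ⊢
  intro v
  have := mem_localK0_iff.1 (hu v)
  exact mem_localK0_iff.2 ⟨this.1, localIdeal_mono h this.2.1, this.2.2⟩

theorem localGL_unipU (x : FinAdele K) : localGL v (unipU x) = unipU (x v) := map_unipU _ _
theorem localGL_unipL (x : FinAdele K) : localGL v (unipL x) = unipL (x v) := map_unipL _ _
theorem localGL_weyl : localGL v (weyl : GL (Fin 2) (FinAdele K)) = weyl := map_weyl _
theorem localGL_diagGL (a d : (FinAdele K)ˣ) : localGL v (diagGL a d) =
    diagGL (Units.map (evalAt v : FinAdele K →* v.adicCompletion K) a)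
      (Units.map (evalAt v : FinAdele K →* v.adicCompletion K) d) := map_diagGL _ _ _

theorem unipU_mem_localK0 {𝔫 : Ideal (𝓞 K)} {x : v.adicCompletion K}
    (hx : x ∈ v.adicCompletionIntegers K) : unipU x ∈ localK0 v 𝔫 := by
  refine mem_localK0_iff.2 ⟨fun i j => ?_, ?_, ?_⟩
  · fin_cases i <;> fin_cases j
    exacts [one_mem _, hx, zero_mem _, one_mem _]
  · exact zero_mem_localIdeal
  · simp [Matrix.det_fin_two]

theorem unipL_mem_localK0 {𝔫 : Ideal (𝓞 K)} {x : v.adicCompletion K}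
    (hx : x ∈ localIdeal 𝔫 v) : unipL x ∈ localK0 v 𝔫 := by
  refine mem_localK0_iff.2 ⟨fun i j => ?_, hx, ?_⟩
  · fin_cases i <;> fin_cases j
    exacts [one_mem _, zero_mem _, mem_integers_of_mem_localIdeal hx, one_mem _]
  · simp [Matrix.det_fin_two]

theorem diagGL_mem_localK0 {𝔫 : Ideal (𝓞 K)} {a d : (v.adicCompletion K)ˣ}
    (ha : Valued.v (a : v.adicCompletion K) = 1) (hd : Valued.v (d : v.adicCompletion K) = 1) :
    diagGL a d ∈ localK0 v 𝔫 := by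
  refine mem_localK0_iff.2 ⟨fun i j => ?_, zero_mem_localIdeal, ?_⟩
  · fin_cases i <;> fin_cases j
    exacts [mem_integers_of_valued_eq_one ha, zero_mem _, zero_mem _,
      mem_integers_of_valued_eq_one hd]
  · simp [Matrix.det_fin_two, ha, hd]

theorem weyl_mem_localK0 {𝔫 : Ideal (𝓞 K)} (h : ¬ v.asIdeal ∣ 𝔫) : weyl ∈ localK0 v 𝔫 := by
  refine mem_localK0_iff.2 ⟨fun i j => ?_, mem_localIdeal_of_not_dvd h (one_mem _), ?_⟩
  · fin_cases i <;> fin_cases j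
    exacts [zero_mem _, neg_mem (one_mem _), one_mem _, zero_mem _]
  · simp [Matrix.det_fin_two]

theorem unipU_mem_K0 {𝔫 : Ideal (𝓞 K)} {x : FinAdele K}
    (hx : ∀ v, x v ∈ v.adicCompletionIntegers K) : unipU x ∈ K0 𝔫 :=
  mem_K0_iff.2 fun v => by rw [localGL_unipU]; exact unipU_mem_localK0 (hx v)

theorem unipL_mem_K0 {𝔫 : Ideal (𝓞 K)} {x : FinAdele K}
    (hx : ∀ v, x v ∈ localIdeal 𝔫 v) : unipL x ∈ K0 𝔫 :=
  mem_K0_iff.2 fun v => by rw [localGL_unipL]; exact unipL_mem_localK0 (hx v)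

theorem diagGL_mem_K0 {𝔫 : Ideal (𝓞 K)} {a d : (FinAdele K)ˣ}
    (ha : ∀ v, Valued.v ((a : FinAdele K) v) = 1) (hd : ∀ v, Valued.v ((d : FinAdele K) v) = 1) :
    diagGL a d ∈ K0 𝔫 :=
  mem_K0_iff.2 fun v => by rw [localGL_diagGL]; exact diagGL_mem_localK0 (ha v) (hd v)

/-- The Iwasawa decomposition of `GL₂(K_v)`. -/
theorem exists_iwasawa {𝔫 : Ideal (𝓞 K)} (hv : ¬ v.asIdeal ∣ 𝔫)
    (h : GL (Fin 2) (v.adicCompletion K)) :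
    ∃ (β : v.adicCompletion K) (a d : (v.adicCompletion K)ˣ),
      ∃ κ ∈ localK0 v 𝔫, h = unipU β * diagGL a d * κ := by
  -- Clear the lower left entry by a column operation with integral coefficient, after exchanging
  -- the columns when the left entry of the lower row is the larger one. Both operations lie in the
  -- local `K₀(𝔫)` because `v ∤ 𝔫`.
  by_cases hcd : Valued.v (h 1 0) ≤ Valued.v (h 1 1)
  · have hd : h 1 1 ≠ 0 := by
      intro h0
      have hc : h 1 0 = 0 := by simpa [h0] using hcd
      have hdet : (h : Matrix (Fin 2) (Fin 2) (v.adicCompletion K)).det ≠ 0 := h.det_ne_zero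
      exact hdet (by rw [Matrix.det_fin_two, h0, hc]; ring)
    have hx : h 1 0 / h 1 1 ∈ v.adicCompletionIntegers K := by
      rw [HeightOneSpectrum.mem_adicCompletionIntegers, map_div₀]
      exact div_le_one_of_le₀ hcd zero_le
    obtain ⟨β, a, d, hb⟩ := eq_unipU_mul_diagGL (h * unipL (-(h 1 0 / h 1 1))) (by
      simp [Matrix.mul_apply, Fin.sum_univ_two, mul_div_cancel₀ _ hd])
    refine ⟨β, a, d, unipL (h 1 0 / h 1 1),
      unipL_mem_localK0 (mem_localIdeal_of_not_dvd hv hx), ?_⟩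
    rw [← hb, ← unipL_inv, inv_mul_cancel_right]
  · rw [not_le] at hcd
    have hc : h 1 0 ≠ 0 := by
      intro h0
      simp [h0] at hcd
    have hx : h 1 1 / h 1 0 ∈ v.adicCompletionIntegers K := by
      rw [HeightOneSpectrum.mem_adicCompletionIntegers, map_div₀]
      exact div_le_one_of_le₀ hcd.le zero_le
    obtain ⟨β, a, d, hb⟩ := eq_unipU_mul_diagGL (h * (unipU (-(h 1 1 / h 1 0)) * weyl⁻¹)) (by
      rw [weyl_inv]
      simp [Matrix.mul_apply, Fin.sum_univ_two, mul_div_cancel₀ _ hc])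
    refine ⟨β, a, d, weyl * unipU (h 1 1 / h 1 0),
      mul_mem (weyl_mem_localK0 hv) (unipU_mem_localK0 hx), ?_⟩
    rw [← hb, ← unipU_inv]
    group

end Local

/-- The embedding `GL₂(K) → GL₂(𝔸_K^f)`. -/
def globalGL : GL (Fin 2) K →* GL (Fin 2) (FinAdele K) :=
  Matrix.GeneralLinearGroup.map (algebraMap K (FinAdele K))

/-- The union `B(𝔸_K^f) w K₀(𝔪)`. -/
def bruhatCell (𝔪 : Ideal (𝓞 K)) (w : GL (Fin 2) (FinAdele K)) : Set (GL (Fin 2) (FinAdele K)) :=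
  {y | ∃ (β : FinAdele K) (a d : (FinAdele K)ˣ), ∃ κ ∈ K0 𝔪, y = unipU β * diagGL a d * w * κ}

/-! ### Stability of the cells `B w K₀(𝔪)` -/

section Stability

variable {𝔪 : Ideal (𝓞 K)}

theorem mul_mem_bruhatCell {w y u : GL (Fin 2) (FinAdele K)} (hy : y ∈ bruhatCell 𝔪 w)
    (hu : u ∈ K0 𝔪) : y * u ∈ bruhatCell 𝔪 w := by
  obtain ⟨β, a, d, κ, hκ, rfl⟩ := hy
  exact ⟨β, a, d, κ * u, mul_mem hκ hu, mul_assoc _ _ _⟩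

theorem upper_mul_mem_bruhatCell {w y : GL (Fin 2) (FinAdele K)} (hy : y ∈ bruhatCell 𝔪 w)
    (β : FinAdele K) (a d : (FinAdele K)ˣ) : unipU β * diagGL a d * y ∈ bruhatCell 𝔪 w := by
  obtain ⟨β', a', d', κ, hκ, rfl⟩ := hy
  refine ⟨β + a * β' * ((d⁻¹ : (FinAdele K)ˣ) : FinAdele K), a * a', d * d', κ, hκ, ?_⟩
  rw [unipU_add, ← diagGL_mul]
  have h := unipU_mul_diagGL (a * β' * ((d⁻¹ : (FinAdele K)ˣ) : FinAdele K)) a d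
  have e : ((a⁻¹ : (FinAdele K)ˣ) : FinAdele K) * (a * β' * ((d⁻¹ : (FinAdele K)ˣ) : FinAdele K)) * d
      = β' := by
    rw [mul_assoc, mul_assoc, Units.inv_mul, mul_one, Units.inv_mul_cancel_left]
  rw [e] at h
  calc unipU β * diagGL a d * (unipU β' * diagGL a' d' * w * κ)
      = unipU β * (diagGL a d * unipU β') * diagGL a' d' * w * κ := by group
    _ = _ := by rw [← h]; group

/-- The finite adele with component `x` at `v` and `0` elsewhere. -/
def localAdeleAdd (v : HeightOneSpectrum (𝓞 K)) (x : v.adicCompletion K) : FinAdele K :=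
  localAdele v x - localAdele v 0

theorem localAdeleAdd_same (v : HeightOneSpectrum (𝓞 K)) (x : v.adicCompletion K) :
    localAdeleAdd v x v = x := by
  rw [localAdeleAdd, finAdele_sub_apply, localAdele_same, localAdele_same, sub_zero]

theorem localAdeleAdd_of_ne {v w : HeightOneSpectrum (𝓞 K)} (h : w ≠ v) (x : v.adicCompletion K) :
    localAdeleAdd v x w = 0 := by
  rw [localAdeleAdd, finAdele_sub_apply, localAdele_of_ne h, localAdele_of_ne h, sub_self]

theorem map_evalAt_localIdele_same (v : HeightOneSpectrum (𝓞 K)) (x : (v.adicCompletion K)ˣ) :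
    Units.map (evalAt v : FinAdele K →* v.adicCompletion K) (localIdele v x) = x :=
  Units.ext (localAdele_same v (x : v.adicCompletion K))

theorem map_evalAt_localIdele_of_ne {v w : HeightOneSpectrum (𝓞 K)} (h : w ≠ v)
    (x : (v.adicCompletion K)ˣ) :
    Units.map (evalAt w : FinAdele K →* w.adicCompletion K) (localIdele v x) = 1 :=
  Units.ext (localAdele_of_ne h (x : v.adicCompletion K))

/-- The new matrix differs from the old one only at `𝔮`, where Iwasawa decomposition supplies an
upper triangular factor and a compact one. Since `w` is itself in the local `K₀(𝔪)` at `𝔮`, it can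
be inserted between the two. -/
theorem mul_diagGL_mem_bruhatCell {𝔮 : HeightOneSpectrum (𝓞 K)} (h𝔮 : ¬ 𝔮.asIdeal ∣ 𝔪)
    {w y : GL (Fin 2) (FinAdele K)} (hw : localGL 𝔮 w ∈ localK0 𝔮 𝔪) (hy : y ∈ bruhatCell 𝔪 w)
    (ϖ : (𝔮.adicCompletion K)ˣ) : y * diagGL (localIdele 𝔮 ϖ) 1 ∈ bruhatCell 𝔪 w := by
  obtain ⟨β₀, a₀, d₀, κ₀, hκ₀, rfl⟩ := hy
  obtain ⟨x, hx⟩ : ∃ x : GL (Fin 2) (FinAdele K), x = diagGL (localIdele 𝔮 ϖ) 1 := ⟨_, rfl⟩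
  rw [← hx]
  obtain ⟨β, a, d, κ, hκ, hh⟩ := exists_iwasawa h𝔮 (localGL 𝔮 (w * κ₀ * x))
  obtain ⟨b, hb⟩ : ∃ b : GL (Fin 2) (FinAdele K),
    b = unipU (localAdeleAdd 𝔮 β) * diagGL (localIdele 𝔮 a) (localIdele 𝔮 d) := ⟨_, rfl⟩
  have hmem : w * κ₀ * x ∈ bruhatCell 𝔪 w := by
    -- With `b` the triangular factor at `𝔮` and `1` elsewhere, the compact factor is forced. Its
    -- component is `w⁻¹ κ` at `𝔮`, and that of `κ₀` at every other place.
    refine ⟨localAdeleAdd 𝔮 β, localIdele 𝔮 a, localIdele 𝔮 d, w⁻¹ * b⁻¹ * (w * κ₀ * x), ?_, ?_⟩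
    · rw [mem_K0_iff]
      intro v
      by_cases hv : v = 𝔮
      · subst hv
        have hbv : localGL v b = unipU β * diagGL a d := by
          rw [hb, map_mul, localGL_unipU, localGL_diagGL, localAdeleAdd_same,
            map_evalAt_localIdele_same, map_evalAt_localIdele_same]
        rw [map_mul, map_mul, map_inv, map_inv, hbv, hh, mul_assoc (localGL v w)⁻¹,
          inv_mul_cancel_left]
        exact mul_mem (inv_mem hw) hκ
      · have hbv : localGL v b = 1 := by
          rw [hb, map_mul, localGL_unipU, localGL_diagGL, localAdeleAdd_of_ne hv,
            map_evalAt_localIdele_of_ne hv, map_evalAt_localIdele_of_ne hv, diagGL_one, mul_one]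
          ext i j
          fin_cases i <;> fin_cases j <;> rfl
        have hxv : localGL v x = 1 := by
          rw [hx, localGL_diagGL, map_evalAt_localIdele_of_ne hv, map_one, diagGL_one]
        rw [map_mul, map_mul, map_inv, map_inv, map_mul, map_mul, hbv, hxv, mul_one, inv_one,
          mul_one, inv_mul_cancel_left]
        exact mem_K0_iff.1 hκ₀ v
    · rw [← hb]
      group
  have := upper_mul_mem_bruhatCell hmem β₀ a₀ d₀
  convert this using 1
  group

end Stability

/-! ### Approximation in `SL₂`: from level `𝔪` to level `𝔭𝔪` -/

section Approximation

/-- The expression is the lower left entry of `unipL (-y) * unipU (-x) * κ`. Away from `𝔭` nothing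
has to be done. At `v ∣ 𝔭` the first column contains a unit, as the determinant is one; `x ∈ {0, 1}`
brings a unit to the upper left corner and `y` then clears the entry below it. -/
theorem exists_local_reduction {𝔪 𝔭 : Ideal (𝓞 K)} {v : HeightOneSpectrum (𝓞 K)}
    {κ : GL (Fin 2) (v.adicCompletion K)} (hκ : κ ∈ localK0 v 𝔪) :
    ∃ x ∈ v.adicCompletionIntegers K, ∃ y ∈ v.adicCompletionIntegers K,
      κ 1 0 - y * (κ 0 0 - x * κ 1 0) ∈ localIdeal (𝔭 * 𝔪) v := by
  obtain ⟨h1, h2, h3⟩ := mem_localK0_iff.1 hκ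
  by_cases hv : v.asIdeal ∣ 𝔭
  · have key : ∀ x ∈ v.adicCompletionIntegers K, Valued.v (κ 0 0 - x * κ 1 0) = 1 →
        ∃ x ∈ v.adicCompletionIntegers K, ∃ y ∈ v.adicCompletionIntegers K,
          κ 1 0 - y * (κ 0 0 - x * κ 1 0) ∈ localIdeal (𝔭 * 𝔪) v := by
      intro x hx h
      refine ⟨x, hx, κ 1 0 * (κ 0 0 - x * κ 1 0)⁻¹, mul_mem (h1 1 0) (inv_mem_integers h), ?_⟩
      have h0 : κ 0 0 - x * κ 1 0 ≠ 0 := fun h0 => by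
        rw [h0, map_zero] at h
        exact zero_ne_one h
      rw [inv_mul_cancel_right₀ h0, sub_self]
      exact zero_mem_localIdeal
    by_cases ha : Valued.v (κ 0 0) = 1
    · exact key 0 (zero_mem _) (by rwa [zero_mul, sub_zero])
    · have ha' : Valued.v (κ 0 0) < 1 := lt_of_le_of_ne (h1 0 0) ha
      have hc : Valued.v (κ 1 0) = 1 := by
        by_contra hc
        have hc' : Valued.v (κ 1 0) < 1 := lt_of_le_of_ne (h1 1 0) hc
        have : Valued.v (κ : Matrix (Fin 2) (Fin 2) (v.adicCompletion K)).det < 1 := by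
          rw [Matrix.det_fin_two]
          refine (Valuation.map_sub _ _ _).trans_lt (max_lt ?_ ?_)
          · rw [map_mul]
            exact mul_lt_one_of_lt_of_le ha' (h1 1 1)
          · rw [map_mul, mul_comm]
            exact mul_lt_one_of_lt_of_le hc' (h1 0 1)
        exact this.ne h3
      refine key 1 (one_mem _) ?_
      rw [one_mul, Valuation.map_sub_eq_of_lt_right _ (by rwa [hc]), hc]
  · refine ⟨0, zero_mem _, 0, zero_mem _, ?_⟩
    rw [zero_mul, sub_zero]
    exact mem_localIdeal_of_mem_mul hv h2

theorem not_asIdeal_dvd_top (v : HeightOneSpectrum (𝓞 K)) : ¬ v.asIdeal ∣ ⊤ := fun h =>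
  v.isPrime.ne_top (top_le_iff.1 (Ideal.dvd_iff_le.1 h))

/-- For `κ ∈ K₀(𝔪)`, `g κ ∈ SL₂(K) g K₀(𝔭𝔪)`, where `g = diag(1, t)`. -/
theorem exists_special_approx {𝔪 𝔭 : Ideal (𝓞 K)} (h0 : 𝔭 * 𝔪 ≠ 0)
    (t : (FinAdele K)ˣ) {κ : GL (Fin 2) (FinAdele K)} (hκ : κ ∈ K0 𝔪) :
    ∃ γ : SL(2, K), (diagGL 1 t)⁻¹ * (globalGL (γ : GL (Fin 2) K))⁻¹ * diagGL 1 t * κ ∈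
      K0 (𝔭 * 𝔪) := by
  obtain ⟨r, hr, hr0⟩ : ∃ r ∈ 𝔭 * 𝔪, r ≠ 0 := Submodule.exists_mem_ne_zero_of_ne_bot h0
  have hrK : algebraMap (𝓞 K) K r ≠ 0 := by simpa using hr0
  set ν : (FinAdele K)ˣ := FiniteAdeleRing.unitEmbedding (𝓞 K) K (Units.mk0 _ hrK)
  have hν : ∀ v, (ν : FinAdele K) v ∈ localIdeal (𝔭 * 𝔪) v := fun v =>
    algebraMap_mem_localIdeal hr
  choose x hx y hy hxy using fun v => exists_local_reduction (𝔭 := 𝔭) (mem_K0_iff.1 hκ v)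
  set x' : FinAdele K := mkAdele x (.of_forall hx)
  set y' : FinAdele K := mkAdele y (.of_forall hy)
  -- Conjugation by `diag(1, t)` multiplies the upper right entry by `t` and the lower left one by
  -- `t⁻¹`. The targets and moduli are scaled so that it yields `x' + ν e₁` and `y' + ν e₂`, with
  -- errors divisible by `ν ∈ 𝔭𝔪`.
  obtain ⟨X, e₁, he₁, hX⟩ := exists_approx (t⁻¹ * ν) (((t⁻¹ : (FinAdele K)ˣ) : FinAdele K) * x')
  obtain ⟨Y, e₂, he₂, hY⟩ := exists_approx (t * ν) (t * y')
  -- This is `unipU X * unipL Y`; two additive approximations thus replace strong approximation for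
  -- `SL₂`.
  let γ : SL(2, K) := ⟨!![1 + X * Y, X; Y, 1], by rw [Matrix.det_fin_two_of]; ring⟩
  refine ⟨γ, ?_⟩
  have hγ : globalGL (γ : GL (Fin 2) K) = unipU (algebraMap K _ X) * unipL (algebraMap K _ Y) := by
    rw [← map_unipU, ← map_unipL, ← map_mul]
    refine congrArg _ ?_
    apply Units.ext
    have hcoe : ((γ : GL (Fin 2) K) : Matrix (Fin 2) (Fin 2) K) = !![1 + X * Y, X; Y, 1] := rfl
    rw [hcoe]
    simp
  rw [hγ, mul_inv_rev, unipU_inv, unipL_inv]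
  have h1 : (diagGL 1 t)⁻¹ * (unipL (-(algebraMap K (FinAdele K) Y)) *
      unipU (-(algebraMap K (FinAdele K) X))) * diagGL 1 t * κ =
      unipL (-(y' + ν * e₂)) * unipU (-(x' + ν * e₁)) * κ := by
    rw [mul_assoc (diagGL 1 t)⁻¹, mul_assoc (unipL _), unipU_mul_diagGL, ← mul_assoc (unipL _),
      unipL_mul_diagGL, mul_assoc (diagGL 1 t), inv_mul_cancel_left, hX, hY]
    congr 3
    · rw [Units.val_one, mul_one, Units.val_mul, mul_neg, mul_assoc, ← mul_add,
        Units.inv_mul_cancel_left]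
    · rw [inv_one, Units.val_one, one_mul, Units.val_mul, neg_mul, mul_comm, mul_assoc, ← mul_add,
        Units.mul_inv_cancel_left]
  rw [h1, mem_K0_iff]
  intro v
  obtain ⟨hi, -, hd⟩ := mem_localK0_iff.1 (mem_K0_iff.1 hκ v)
  have hνi := mem_integers_of_mem_localIdeal (hν v)
  have hxi : (-(x' + ν * e₁)) v ∈ v.adicCompletionIntegers K :=
    neg_mem (add_mem (hx v) (mul_mem hνi (he₁ v)))
  have hyi : (-(y' + ν * e₂)) v ∈ v.adicCompletionIntegers K :=
    neg_mem (add_mem (hy v) (mul_mem hνi (he₂ v)))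
  -- Level `⊤` records integrality and unit determinant alone; the congruence on the lower left
  -- entry is treated separately.
  have hmem : unipL ((-(y' + ν * e₂)) v) * unipU ((-(x' + ν * e₁)) v) * localGL v κ ∈
      localK0 v ⊤ := by
    refine mul_mem (mul_mem (unipL_mem_localK0 ?_) (unipU_mem_localK0 hxi))
      (mem_localK0_iff.2 ⟨hi, ?_, hd⟩)
    · exact mem_localIdeal_of_not_dvd (not_asIdeal_dvd_top v) hyi
    · exact mem_localIdeal_of_not_dvd (not_asIdeal_dvd_top v) (hi 1 0)
  obtain ⟨hi', -, hd'⟩ := mem_localK0_iff.1 hmem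
  rw [map_mul, map_mul, localGL_unipL, localGL_unipU]
  refine mem_localK0_iff.2 ⟨hi', ?_, hd'⟩
  have e : (unipL ((-(y' + ν * e₂)) v) * unipU ((-(x' + ν * e₁)) v) * localGL v κ) 1 0 =
      (localGL v κ 1 0 - y v * (localGL v κ 0 0 - x v * localGL v κ 1 0)) +
      (ν : FinAdele K) v * (y v * e₁ v * localGL v κ 1 0 - e₂ v * (localGL v κ 0 0 -
        (x v + (ν : FinAdele K) v * e₁ v) * localGL v κ 1 0)) := by
    simp [Matrix.mul_apply, Fin.sum_univ_two, x', y']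
    ring
  rw [e]
  refine localIdeal_add (hxy v) (localIdeal_mul_right (hν v) (sub_mem (mul_mem (mul_mem (hy v)
    (he₁ v)) (hi 1 0)) (mul_mem (he₂ v) (sub_mem (hi 0 0) (mul_mem (add_mem (hx v)
      (mul_mem hνi (he₁ v))) (hi 1 0))))))

end Approximation

/-! ### Cusps in `C_c` and the two cells -/

section Cusps

variable {ϖ : ∀ v : HeightOneSpectrum (𝓞 K), (v.adicCompletion K)ˣ}
  {𝔭 : {c : ClassGroup (𝓞 K) // c ≠ 1} → HeightOneSpectrum (𝓞 K)} {𝔪 𝔫 : Ideal (𝓞 K)}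

theorem mem_Gam_iff {c : ClassGroup (𝓞 K)} {γ : SL(2, K)} : γ ∈ Gam ϖ 𝔭 𝔪 c ↔
    (classMatrix ϖ 𝔭 c)⁻¹ * globalGL (γ : GL (Fin 2) K) * classMatrix ϖ 𝔭 c ∈ K0 𝔪 := Iff.rfl

theorem inv_mem_Gam {c : ClassGroup (𝓞 K)} {γ : SL(2, K)} (hγ : γ ∈ Gam ϖ 𝔭 𝔪 c) :
    γ⁻¹ ∈ Gam ϖ 𝔭 𝔪 c := by
  have h := inv_mem (mem_Gam_iff.1 hγ)
  rw [mul_inv_rev, mul_inv_rev, inv_inv, ← map_inv, ← mul_assoc] at h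
  rwa [mem_Gam_iff, map_inv]

theorem weyl_smul_infty : (weyl : GL (Fin 2) K) • (OnePoint.infty : OnePoint K) = ((0 : K) : OnePoint K) := by
  rw [OnePoint.smul_infty_eq_ite]
  simp

theorem upper_smul_infty (x : K) (a d : Kˣ) :
    (unipU x * diagGL a d) • (OnePoint.infty : OnePoint K) = OnePoint.infty := by
  rw [OnePoint.smul_infty_eq_self_iff]
  simp

theorem globalGL_upper (x : K) (a d : Kˣ) : globalGL (unipU x * diagGL a d) =
    unipU (algebraMap K (FinAdele K) x) * diagGL (FiniteAdeleRing.unitEmbedding (𝓞 K) K a)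
      (FiniteAdeleRing.unitEmbedding (𝓞 K) K d) := by
  rw [map_mul, globalGL, map_unipU, map_diagGL]
  rfl

/-- The element `γ` comes from `exists_special_approx`. It equals `g_c κ k⁻¹ g_c⁻¹` with `κ` and `k`
both in `K₀(𝔪)`, hence lies in `Γ_c(𝔪)` and moves cusps only inside `C_c`. -/
theorem exists_gam_mul {𝔞 : Ideal (𝓞 K)} (h0 : 𝔞 * 𝔪 ≠ 0) (c : ClassGroup (𝓞 K))
    {κ : GL (Fin 2) (FinAdele K)} (hκ : κ ∈ K0 𝔪) :
    ∃ γ ∈ Gam ϖ 𝔭 𝔪 c, ∃ k ∈ K0 (𝔞 * 𝔪),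
      classMatrix ϖ 𝔭 c * κ = globalGL (γ : GL (Fin 2) K) * classMatrix ϖ 𝔭 c * k := by
  obtain ⟨γ, hγ⟩ := exists_special_approx h0 (classIdele ϖ 𝔭 c) hκ
  change (classMatrix ϖ 𝔭 c)⁻¹ * (globalGL (γ : GL (Fin 2) K))⁻¹ * classMatrix ϖ 𝔭 c * κ ∈ _ at hγ
  have hle : 𝔞 * 𝔪 ≤ 𝔪 := Ideal.mul_le_right
  refine ⟨γ, ?_, _, hγ, ?_⟩
  · have h1 := mul_mem hκ (inv_mem (K0_mono hle hγ))
    rw [mem_Gam_iff]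
    convert h1 using 1
    group
  · group

/-- Pull `a` out as a central factor and write `d / a = α t_c u`. The triangular part is then
rational up to units and integral unipotents, which are absorbed in `κ`. Trading level `𝔪` for `𝔞𝔪`
gives `σ⁻¹ = b γ` with `b` triangular over `K`, so `σ∞ = γ⁻¹∞`. -/
theorem exists_cusp_of_mem_bruhatCell_one {𝔞 : Ideal (𝓞 K)} (h0 : 𝔞 * 𝔪 ≠ 0)
    (hϖ : IsUniformizers ϖ) (h𝔭 : IsClassReps 𝔫 𝔭) {y : GL (Fin 2) (FinAdele K)}
    (hy : y ∈ bruhatCell 𝔪 1) :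
    ∃ (c : ClassGroup (𝓞 K)) (z : (FinAdele K)ˣ) (σ : GL (Fin 2) K), ∃ k ∈ K0 (𝔞 * 𝔪),
      σ • (OnePoint.infty : OnePoint K) ∈ cuspSet ϖ 𝔭 𝔪 c ∧
        y = diagGL z z * (globalGL σ⁻¹ * classMatrix ϖ 𝔭 c * k) := by
  obtain ⟨β, a, d, κ, hκ, rfl⟩ := hy
  obtain ⟨c, α, u, hu, hs⟩ := exists_eq_mul_classIdele hϖ h𝔭 (a⁻¹ * d)
  set t := classIdele ϖ 𝔭 c with ht
  set A := FiniteAdeleRing.unitEmbedding (𝓞 K) K α with hA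
  -- Moving a unipotent to the right past `diag(1, A t)` multiplies its entry by `A t`; this modulus
  -- leaves the integral error `e`.
  obtain ⟨B, e, he, hB⟩ := exists_approx (A * t)⁻¹ β
  have hκ₁ : unipU (-e) * diagGL 1 u * κ ∈ K0 𝔪 :=
    mul_mem (mul_mem (unipU_mem_K0 fun v => neg_mem (he v))
      (diagGL_mem_K0 (fun v => by simp) hu)) hκ
  obtain ⟨γ, hγ, k, hk, hγk⟩ := exists_gam_mul h0 (ϖ := ϖ) (𝔭 := 𝔭) c hκ₁
  refine ⟨c, a, (unipU B * diagGL 1 α * (γ : GL (Fin 2) K))⁻¹, k, hk, ?_, ?_⟩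
  · refine ⟨γ⁻¹, inv_mem_Gam hγ, Or.inl ?_⟩
    rw [mul_inv_rev, mul_smul, inv_smul_eq_iff.2 (upper_smul_infty B 1 α).symm, map_inv]
  · rw [inv_inv, map_mul, mul_assoc (globalGL _) (globalGL _), mul_assoc (globalGL _) _ k, ← hγk,
      globalGL_upper, map_one, ← hA, hB]
    have hd : d = a * (A * t * u) := by rw [← hs, mul_inv_cancel_left]
    have h1 : unipU (((A * t)⁻¹ : (FinAdele K)ˣ) * e) * diagGL 1 (A * t) =
        diagGL 1 (A * t) * unipU e := by
      rw [unipU_mul_diagGL, inv_one, Units.val_one, one_mul, mul_right_comm, Units.inv_mul, one_mul]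
    have h2 : diagGL a d = diagGL a a * (diagGL 1 (A * t) * diagGL 1 u) := by
      rw [diagGL_mul, diagGL_mul, mul_one, mul_one, hd]
    have h3 : diagGL 1 A * classMatrix ϖ 𝔭 c = diagGL 1 (A * t) := by
      rw [classMatrix, diagGL_mul, one_mul]
    rw [unipU_add, h2]
    calc unipU β * (diagGL a a * (diagGL 1 (A * t) * diagGL 1 u)) * 1 * κ
        = unipU β * diagGL a a * (diagGL 1 (A * t) * unipU e) * unipU (-e) * diagGL 1 u * κ := by
          rw [← unipU_inv]; group
      _ = diagGL a a * (unipU β * unipU (((A * t)⁻¹ : (FinAdele K)ˣ) * e) * diagGL 1 (A * t)) *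
          unipU (-e) * diagGL 1 u * κ := by rw [← h1, ← diagGL_self_mul_comm]; group
      _ = _ := by rw [← h3]; group

/-- As for the cell of `∞`, with `d` as central factor and `a / d = α t_c u`, because `w` exchanges
the diagonal entries. Now `σ⁻¹ = b w γ`, so `σ∞ = γ⁻¹ 0`. -/
theorem exists_cusp_of_mem_bruhatCell_weyl {𝔞 : Ideal (𝓞 K)} (h0 : 𝔞 * 𝔪 ≠ 0)
    (hϖ : IsUniformizers ϖ) (h𝔭 : IsClassReps 𝔫 𝔭) {y : GL (Fin 2) (FinAdele K)}
    (hy : y ∈ bruhatCell 𝔪 weyl) :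
    ∃ (c : ClassGroup (𝓞 K)) (z : (FinAdele K)ˣ) (σ : GL (Fin 2) K), ∃ k ∈ K0 (𝔞 * 𝔪),
      σ • (OnePoint.infty : OnePoint K) ∈ cuspSet ϖ 𝔭 𝔪 c ∧
        y = diagGL z z * (globalGL σ⁻¹ * classMatrix ϖ 𝔭 c * k) := by
  obtain ⟨β, a, d, κ, hκ, rfl⟩ := hy
  obtain ⟨r, hr, hr0⟩ : ∃ r ∈ 𝔞 * 𝔪, r ≠ 0 := Submodule.exists_mem_ne_zero_of_ne_bot h0
  have hrK : algebraMap (𝓞 K) K r ≠ 0 := by simpa using hr0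
  set ν : (FinAdele K)ˣ := FiniteAdeleRing.unitEmbedding (𝓞 K) K (Units.mk0 _ hrK)
  have hν : ∀ v, (ν : FinAdele K) v ∈ localIdeal 𝔪 v := fun v =>
    algebraMap_mem_localIdeal (Ideal.mul_le_right hr)
  obtain ⟨c, α, u, hu, hs⟩ := exists_eq_mul_classIdele hϖ h𝔭 (d⁻¹ * a)
  set t := classIdele ϖ 𝔭 c with ht
  set A := FiniteAdeleRing.unitEmbedding (𝓞 K) K α with hA
  -- Past `w` the error becomes a lower unipotent, which must be congruent to `1` modulo `𝔪`; hence
  -- the additional factor `ν`.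
  obtain ⟨B, e, he, hB⟩ := exists_approx (A * t * ν) β
  have hκ₁ : unipL (ν * e) * diagGL 1 u * κ ∈ K0 𝔪 :=
    mul_mem (mul_mem (unipL_mem_K0 fun v => localIdeal_mul_right (hν v) (he v))
      (diagGL_mem_K0 (fun v => by simp) hu)) hκ
  obtain ⟨γ, hγ, k, hk, hγk⟩ := exists_gam_mul h0 (ϖ := ϖ) (𝔭 := 𝔭) c hκ₁
  refine ⟨c, d, (unipU B * diagGL α 1 * weyl * (γ : GL (Fin 2) K))⁻¹, k, hk, ?_, ?_⟩
  · refine ⟨γ⁻¹, inv_mem_Gam hγ, Or.inr ?_⟩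
    rw [mul_inv_rev, mul_inv_rev, mul_smul, mul_smul,
      inv_smul_eq_iff.2 (upper_smul_infty B α 1).symm, map_inv, weyl_inv, mul_smul,
      weyl_smul_infty]
    congr 1
    rw [OnePoint.smul_some_eq_ite]
    simp
  · rw [inv_inv, map_mul, mul_assoc (globalGL _) (globalGL _), mul_assoc (globalGL _) _ k, ← hγk,
      map_mul, globalGL_upper, map_one, ← hA, hB]
    have hw : globalGL (weyl : GL (Fin 2) K) = weyl := map_weyl _
    have hd : a = d * (A * t * u) := by rw [← hs, mul_inv_cancel_left]
    have h1 : unipU (((A * t * ν : (FinAdele K)ˣ) : FinAdele K) * e) * diagGL (A * t) 1 =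
        diagGL (A * t) 1 * unipU (ν * e) := by
      rw [unipU_mul_diagGL, Units.val_one, mul_one, Units.val_mul _ ν, mul_assoc,
        Units.inv_mul_cancel_left]
    have h2 : diagGL a d = diagGL d d * (diagGL (A * t) 1 * diagGL u 1) := by
      rw [diagGL_mul, diagGL_mul, mul_one, mul_one, hd]
    have h3 : diagGL A 1 * weyl * classMatrix ϖ 𝔭 c = diagGL (A * t) 1 * weyl := by
      rw [classMatrix, mul_assoc, ← diagGL_mul_weyl, ← mul_assoc, diagGL_mul, mul_one]
    have h4 : unipU (ν * e) * weyl = weyl * unipL (-(ν * e)) := unipU_mul_weyl _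
    rw [unipU_add, h2, hw]
    calc unipU β * (diagGL d d * (diagGL (A * t) 1 * diagGL u 1)) * weyl * κ
        = unipU β * diagGL d d * diagGL (A * t) 1 * (diagGL u 1 * weyl) * κ := by group
      _ = unipU β * diagGL d d * diagGL (A * t) 1 * (weyl * unipL (-(ν * e))) * unipL (ν * e) *
            diagGL 1 u * κ := by
          rw [diagGL_mul_weyl, ← unipL_inv]; group
      _ = unipU β * diagGL d d * (diagGL (A * t) 1 * unipU (ν * e)) * weyl * unipL (ν * e) *
            diagGL 1 u * κ := by rw [← h4]; group
      _ = diagGL d d * (unipU β * unipU (((A * t * ν : (FinAdele K)ˣ) : FinAdele K) * e) *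
            (diagGL (A * t) 1 * weyl)) * unipL (ν * e) * diagGL 1 u * κ := by
          rw [← h1, ← diagGL_self_mul_comm]; group
      _ = _ := by rw [← h3]; group

/-- If `σ∞ = γ∞`, then `b = σ⁻¹ γ` fixes `∞`, so it is triangular, and `σ⁻¹ g_c = b g_c (g_c⁻¹ γ⁻¹
g_c)` with last factor in `K₀(𝔪)`. If `σ∞ = γ0`, use `b = σ⁻¹ γ w` instead. -/
theorem mem_bruhatCell_of_cusp {c : ClassGroup (𝓞 K)} {σ : GL (Fin 2) K}
    (hσ : σ • (OnePoint.infty : OnePoint K) ∈ cuspSet ϖ 𝔭 𝔪 c) :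
    globalGL σ⁻¹ * classMatrix ϖ 𝔭 c ∈ bruhatCell 𝔪 1 ∨
      globalGL σ⁻¹ * classMatrix ϖ 𝔭 c ∈ bruhatCell 𝔪 weyl := by
  obtain ⟨γ, hγ, h | h⟩ := hσ
  · left
    obtain ⟨x, a, d, hb⟩ := eq_unipU_mul_diagGL (σ⁻¹ * (γ : GL (Fin 2) K)) (by
      rw [← OnePoint.smul_infty_eq_self_iff, mul_smul, ← h, inv_smul_smul])
    refine ⟨algebraMap K _ x, FiniteAdeleRing.unitEmbedding (𝓞 K) K a * 1,
      FiniteAdeleRing.unitEmbedding (𝓞 K) K d * classIdele ϖ 𝔭 c, _, inv_mem_Gam hγ, ?_⟩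
    have hb' := congrArg globalGL hb
    rw [globalGL_upper, map_mul] at hb'
    change _ = _ * _ * 1 * ((classMatrix ϖ 𝔭 c)⁻¹ *
      globalGL ((γ⁻¹ : SL(2, K)) : GL (Fin 2) K) * classMatrix ϖ 𝔭 c)
    have hc : diagGL 1 (classIdele ϖ 𝔭 c) = classMatrix ϖ 𝔭 c := rfl
    rw [← diagGL_mul, ← mul_assoc (unipU _), ← hb', map_inv Matrix.SpecialLinearGroup.toGL,
      map_inv globalGL (γ : GL (Fin 2) K), hc]
    group
  · right
    obtain ⟨x, a, d, hb⟩ := eq_unipU_mul_diagGL (σ⁻¹ * (γ : GL (Fin 2) K) * weyl) (by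
      rw [← OnePoint.smul_infty_eq_self_iff, mul_smul, weyl_smul_infty, mul_smul, ← h,
        inv_smul_smul])
    -- The signs come from `w⁻¹ = -w`, and `t_c` moves to the upper left entry because `w⁻¹ diag(1,
    -- t_c) = diag(-t_c, -1) w`.
    refine ⟨algebraMap K _ x, FiniteAdeleRing.unitEmbedding (𝓞 K) K a * (-classIdele ϖ 𝔭 c),
      FiniteAdeleRing.unitEmbedding (𝓞 K) K d * (-1), _, inv_mem_Gam hγ, ?_⟩
    have hb' := congrArg globalGL hb
    have hw : globalGL (weyl : GL (Fin 2) K) = weyl := map_weyl _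
    rw [globalGL_upper, map_mul, map_mul, hw] at hb'
    change _ = _ * _ * weyl * ((classMatrix ϖ 𝔭 c)⁻¹ *
      globalGL ((γ⁻¹ : SL(2, K)) : GL (Fin 2) K) * classMatrix ϖ 𝔭 c)
    have h5 : diagGL (-classIdele ϖ 𝔭 c) (-1) * weyl = weyl⁻¹ * classMatrix ϖ 𝔭 c := by
      rw [weyl_inv, classMatrix, diagGL_mul_weyl, diagGL_mul_weyl, mul_assoc, diagGL_mul]
      simp
    rw [← diagGL_mul, ← mul_assoc (unipU _), ← hb', map_inv Matrix.SpecialLinearGroup.toGL,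
      map_inv globalGL (γ : GL (Fin 2) K), mul_assoc _ (diagGL _ _) weyl, h5]
    group

end Cusps

/-! ### The representation `V_N` -/

section Rho

variable {N : ℕ}

theorem rho_coe (u : Matrix (Fin 2) (Fin 2) ℂ) (P : V N) :
    (rho N u P : MvPolynomial (Fin 2) ℂ) = MvPolynomial.aeval (R := ℂ) (fun i : Fin 2 =>
      ∑ j : Fin 2, MvPolynomial.C (u i j) * (MvPolynomial.X j : MvPolynomial (Fin 2) ℂ))
        (P : MvPolynomial (Fin 2) ℂ) := rfl

theorem rho_rho (A B : Matrix (Fin 2) (Fin 2) ℂ) (P : V N) :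
    rho N A (rho N B P) = rho N (B * A) P := by
  apply Subtype.ext
  rw [rho_coe, rho_coe, rho_coe, ← AlgHom.comp_apply]
  refine DFunLike.congr_fun (MvPolynomial.algHom_ext fun i => ?_) _
  simp only [AlgHom.comp_apply, MvPolynomial.aeval_X, Matrix.mul_apply, Fin.sum_univ_two, map_add,
    map_mul, MvPolynomial.aeval_C, MvPolynomial.algebraMap_eq]
  ring

theorem rho_smul_one (c : ℂ) (P : V N) : rho N (c • 1) P = c ^ N • P := by
  apply Subtype.ext
  have hP : (P : MvPolynomial (Fin 2) ℂ).IsHomogeneous N := P.2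
  rw [rho_coe]
  have hX : (fun i : Fin 2 => ∑ j : Fin 2, MvPolynomial.C ((c • (1 : Matrix (Fin 2) (Fin 2) ℂ)) i j) *
      (MvPolynomial.X j : MvPolynomial (Fin 2) ℂ)) =
      fun i => c • (MvPolynomial.X i : MvPolynomial (Fin 2) ℂ) := by
    funext i
    fin_cases i <;> simp [MvPolynomial.smul_eq_C_mul]
  rw [hX, Submodule.coe_smul]
  conv_lhs => rw [MvPolynomial.as_sum (P : MvPolynomial (Fin 2) ℂ)]
  conv_rhs => rw [MvPolynomial.as_sum (P : MvPolynomial (Fin 2) ℂ)]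
  rw [map_sum, Finset.smul_sum]
  refine Finset.sum_congr rfl fun d hd => ?_
  have hdeg : d 0 + d 1 = N := by
    have := hP (MvPolynomial.mem_support_iff.1 hd)
    rw [Finsupp.weight_apply, Finsupp.sum_fintype _ _ (by simp), Fin.sum_univ_two] at this
    simpa using this
  rw [MvPolynomial.aeval_monomial, MvPolynomial.monomial_eq, Finsupp.prod_fintype _ _ (by simp),
    Finsupp.prod_fintype _ _ (by simp), Fin.prod_univ_two, Fin.prod_univ_two, smul_pow, smul_pow,
    show c ^ N = c ^ d 0 * c ^ d 1 by rw [← hdeg, pow_add], MvPolynomial.algebraMap_eq]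
  simp only [MvPolynomial.smul_eq_C_mul, map_mul, map_pow]
  ring

theorem rho_one (P : V N) : rho N 1 P = P := by
  have := rho_smul_one (N := N) 1 P
  rwa [one_smul, one_pow, one_smul] at this

theorem coeffV_add (n : ℕ) (P Q : V N) : coeffV n (P + Q) = coeffV n P + coeffV n Q := by
  simp [coeffV]

theorem coeffV_smul (n : ℕ) (c : ℂ) (P : V N) : coeffV n (c • P) = c * coeffV n P := by
  simp [coeffV]

end Rho

/-! ### The action on hyperbolic space and the automorphy factor -/

section Hyperbolic

theorem sqrtDet_mul_self (g : GL (Fin 2) ℂ) :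
    sqrtDet g * sqrtDet g = (g : Matrix (Fin 2) (Fin 2) ℂ).det := by
  have h : (g : Matrix (Fin 2) (Fin 2) ℂ).det ≠ 0 := g.det_ne_zero
  rw [sqrtDet, ← Complex.cpow_add _ _ h]
  norm_num

theorem sqrtDet_ne_zero (g : GL (Fin 2) ℂ) : sqrtDet g ≠ 0 := fun h =>
  g.det_ne_zero (by
    have := sqrtDet_mul_self g
    rw [h, zero_mul] at this
    exact this.symm)

/-- The unitary factor of the Iwasawa decomposition of `g (t z; 0 1)`, together with the inverse
of the automorphy factor. -/
theorem exists_hyperbolic_decomposition (g : GL (Fin 2) ℂ) (x : H3) :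
    ∃ (r : ℝ) (u : Matrix (Fin 2) (Fin 2) ℂ), 0 < r ∧
      u ∈ Matrix.specialUnitaryGroup (Fin 2) ℂ ∧
      (g : Matrix (Fin 2) (Fin 2) ℂ) * (H3.toGL x : Matrix (Fin 2) (Fin 2) ℂ) =
        (sqrtDet g * r) • ((H3.toGL (actH3 g x) : Matrix (Fin 2) (Fin 2) ℂ) * u) ∧
      (autJ ((sqrtDet g)⁻¹ • (g : Matrix (Fin 2) (Fin 2) ℂ)) x)⁻¹ = (r : ℂ)⁻¹ • u ∧
      (((actH3 g x).2 : ℝ)) = x.2 / r ^ 2 := by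
  obtain ⟨z, t, ht⟩ := x
  set s := sqrtDet g with hs
  have hs0 : s ≠ 0 := sqrtDet_ne_zero g
  have hss : s * s = g 0 0 * g 1 1 - g 0 1 * g 1 0 := by
    rw [hs, sqrtDet_mul_self, Matrix.det_fin_two]
  set a := s⁻¹ * g 0 0 with ha
  set b := s⁻¹ * g 0 1 with hb
  set c := s⁻¹ * g 1 0 with hc
  set d := s⁻¹ * g 1 1 with hd
  have ha' : g 0 0 = s * a := by rw [ha, mul_inv_cancel_left₀ hs0]
  have hb' : g 0 1 = s * b := by rw [hb, mul_inv_cancel_left₀ hs0]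
  have hc' : g 1 0 = s * c := by rw [hc, mul_inv_cancel_left₀ hs0]
  have hd' : g 1 1 = s * d := by rw [hd, mul_inv_cancel_left₀ hs0]
  clear_value a b c d
  have hdet : a * d - b * c = 1 := by
    rw [ha', hb', hc', hd'] at hss
    have h0 : s * s ≠ 0 := mul_ne_zero hs0 hs0
    apply mul_left_cancel₀ h0
    linear_combination -hss
  set p := c * z + d with hp
  set q := c * (t : ℂ) with hq
  set n : ℝ := ‖p‖ ^ 2 + ‖q‖ ^ 2 with hn
  have hden : denomH3 g (z, ⟨t, ht⟩) = ‖s‖ ^ 2 * n := by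
    simp only [denomH3, hc', hd']
    rw [show s * c * z + s * d = s * p by rw [hp]; ring,
      show s * c * ((t : ℝ) : ℂ) = s * q by rw [hq]; ring, norm_mul, norm_mul, hn]
    ring
  have hns : 0 < ‖s‖ ^ 2 := by positivity
  have hn0 : 0 < n := by
    have := denomH3_pos g (z, ⟨t, ht⟩)
    rw [hden] at this
    exact pos_of_mul_pos_right this hns.le
  have hnC : (n : ℂ) = p * starRingEnd ℂ p + q * starRingEnd ℂ q := by
    rw [Complex.mul_conj, Complex.mul_conj, Complex.normSq_eq_norm_sq, Complex.normSq_eq_norm_sq,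
      hn]
    push_cast
    ring
  have hnC0 : (n : ℂ) ≠ 0 := by exact_mod_cast hn0.ne'
  -- The determinant of `J` is `n = |cz + d|² + |ct|²` for the normalised entries, so `J` is `r`
  -- times a special unitary matrix.
  set r := Real.sqrt n with hr
  have hr0 : 0 < r := Real.sqrt_pos.2 hn0
  have hrr : (r : ℂ) * r = n := by exact_mod_cast Real.mul_self_sqrt hn0.le
  have hrC0 : (r : ℂ) ≠ 0 := by exact_mod_cast hr0.ne'
  have hinv : (r : ℂ)⁻¹ * (r : ℂ)⁻¹ * n = 1 := by
    rw [← hrr]; field_simp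
  have hqc : starRingEnd ℂ q = starRingEnd ℂ c * t := by
    rw [hq, map_mul, Complex.conj_ofReal]
  have hact1 : (actH3 g (z, ⟨t, ht⟩)).1 =
      ((a * z + b) * starRingEnd ℂ p + a * starRingEnd ℂ c * t ^ 2) / n := by
    simp only [actH3, hden, ha', hb', hc', hd']
    have hsc : starRingEnd ℂ s ≠ 0 := by simpa using hs0
    have hcast : ((‖s‖ ^ 2 * n : ℝ) : ℂ) = s * starRingEnd ℂ s * n := by
      rw [Complex.mul_conj, Complex.normSq_eq_norm_sq]
      push_cast
      ring
    rw [hcast, show s * c * z + s * d = s * p by rw [hp]; ring, map_mul, map_mul]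
    field_simp
  have hact2 : ((actH3 g (z, ⟨t, ht⟩)).2 : ℝ) = t / n := by
    have hdn : ‖(g : Matrix (Fin 2) (Fin 2) ℂ).det‖ = ‖s‖ ^ 2 := by
      rw [← sqrtDet_mul_self, ← hs, norm_mul, sq]
    simp only [actH3, hden, hdn]
    rw [mul_div_mul_left _ _ hns.ne']
  -- The unitary factor is `r J⁻¹`.
  refine ⟨r, (r : ℂ)⁻¹ • !![starRingEnd ℂ p, -starRingEnd ℂ q; q, p], hr0, ?_, ?_, ?_, ?_⟩
  · rw [Matrix.mem_specialUnitaryGroup_iff, Matrix.mem_unitaryGroup_iff]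
    have hdiag : (r : ℂ)⁻¹ * (r : ℂ)⁻¹ * (p * starRingEnd ℂ p + q * starRingEnd ℂ q) = 1 := by
      rw [← hnC, hinv]
    constructor
    · ext i j
      fin_cases i <;> fin_cases j <;>
        simp [Matrix.mul_apply, Fin.sum_univ_two, Matrix.star_eq_conjTranspose]
      · linear_combination hdiag
      · ring
      · ring
      · linear_combination hdiag
    · rw [Matrix.det_smul, Matrix.det_fin_two_of, Fintype.card_fin]
      linear_combination hinv - (r : ℂ)⁻¹ * (r : ℂ)⁻¹ * hnC
  · have hg : (g : Matrix (Fin 2) (Fin 2) ℂ) = !![s * a, s * b; s * c, s * d] := by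
      ext i j
      fin_cases i <;> fin_cases j <;> simp [ha', hb', hc', hd']
    have hT : (H3.toGL (actH3 g (z, ⟨t, ht⟩)) : Matrix (Fin 2) (Fin 2) ℂ) =
        !![((t / n : ℝ) : ℂ), ((a * z + b) * starRingEnd ℂ p + a * starRingEnd ℂ c * t ^ 2) / n;
          0, 1] := by
      rw [← hact1, ← hact2]
      rfl
    have hT' : (H3.toGL (z, ⟨t, ht⟩) : Matrix (Fin 2) (Fin 2) ℂ) = !![(t : ℂ), z; 0, 1] := rfl
    rw [hT, hT', Matrix.mul_smul, smul_smul, mul_assoc, mul_inv_cancel₀ hrC0, mul_one, hg]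
    clear_value s r
    have h1 : a * t = ((t / n : ℝ) : ℂ) * starRingEnd ℂ p +
        ((a * z + b) * starRingEnd ℂ p + a * starRingEnd ℂ c * t ^ 2) / n * q := by
      push_cast
      field_simp
      rw [hnC, hqc, hp, hq]
      linear_combination (t : ℂ) * starRingEnd ℂ (c * z + d) * hdet
    have h2 : a * z + b = -(((t / n : ℝ) : ℂ) * starRingEnd ℂ q) +
        ((a * z + b) * starRingEnd ℂ p + a * starRingEnd ℂ c * t ^ 2) / n * p := by
      push_cast
      field_simp
      rw [hnC, hqc, hp, hq]
      linear_combination -(t : ℂ) ^ 2 * starRingEnd ℂ c * hdet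
    ext i j
    fin_cases i <;> fin_cases j <;> simp [Matrix.mul_apply, Fin.sum_univ_two, -Complex.ofReal_div]
    · linear_combination s * h1
    · linear_combination s * h2
    · rw [hq]; ring
    · rw [hp]; ring
  · apply Matrix.inv_eq_right_inv
    have hJ : autJ (s⁻¹ • (g : Matrix (Fin 2) (Fin 2) ℂ)) (z, ⟨t, ht⟩) =
        !![p, starRingEnd ℂ q; -q, starRingEnd ℂ p] := by
      simp only [autJ, Matrix.smul_apply, smul_eq_mul, hc', hd', inv_mul_cancel_left₀ hs0, hp, hq]
    rw [hJ, Matrix.mul_smul, Matrix.mul_smul, smul_smul]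
    have hdiag : (r : ℂ)⁻¹ * (r : ℂ)⁻¹ * (p * starRingEnd ℂ p + q * starRingEnd ℂ q) = 1 := by
      rw [← hnC, hinv]
    clear_value p q r
    ext i j
    fin_cases i <;> fin_cases j <;> simp
    · linear_combination hdiag
    · exact Or.inr (by ring)
    · exact Or.inr (by ring)
    · linear_combination hdiag
  · rw [hact2, hr, Real.sq_sqrt hn0.le]

end Hyperbolic

/-! ### From quasi-vanishing at cusps to an adelic condition -/

section Descent

variable {ι : K →+* ℂ} {𝔪 𝔫 : Ideal (𝓞 K)} {k ℓ : ℕ} {φ : Idele K →* ℂˣ} {F : AdelicFun K k ℓ}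
  {ϖ : ∀ v : HeightOneSpectrum (𝓞 K), (v.adicCompletion K)ˣ}
  {𝔭 : {c : ClassGroup (𝓞 K) // c ≠ 1} → HeightOneSpectrum (𝓞 K)}

theorem localChar_one (φ : Idele K →* ℂˣ) (v : HeightOneSpectrum (𝓞 K)) :
    localChar φ v 1 = 1 := by
  rw [localChar, dif_neg one_ne_zero]
  have : localIdele v (Units.mk0 (1 : v.adicCompletion K) one_ne_zero) = 1 :=
    Units.ext (localAdele_one v)
  rw [this]
  exact map_one φ

theorem nebentypus_one (𝔫 : Ideal (𝓞 K)) (φ : Idele K →* ℂˣ) : nebentypus 𝔫 φ 1 = 1 := by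
  have h : ∀ v : HeightOneSpectrum (𝓞 K), localChar φ v
      (((1 : GL (Fin 2) (FinAdele K)) : Matrix (Fin 2) (Fin 2) (FinAdele K)) 1 1 v) = 1 :=
    localChar_one φ
  simp only [nebentypus, h, finprod_one]

/-- Decompose `σ (t z; 0 1) = s r (t' z'; 0 1) u` with `s² = det σ` and `u ∈ SU₂`. The scalar acts
through `φ_∞`, whose `s`-part is the normalising factor of the slash action. The powers of `r`
agree: `φ_∞` gives `r^(-k-ℓ)`, while `ρ(J⁻¹)` gives `r^(-k-ℓ-2)` and `t'⁻¹ = r² / t` compensates the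
difference. -/
theorem slash_descent (hφ : IsHeckeCharacter ι 𝔫 k ℓ φ) (hF : IsBianchiModularForm ι 𝔫 k ℓ φ F)
    (c : ClassGroup (𝓞 K)) (σ : GL (Fin 2) K) (x : H3) :
    slash (descent ϖ 𝔭 F c) (Matrix.GeneralLinearGroup.map ι σ) x =
      (((x.2 : ℝ) : ℂ)⁻¹) • F (H3.toGL x, globalGL σ⁻¹ * classMatrix ϖ 𝔭 c) := by
  set g := Matrix.GeneralLinearGroup.map ι σ with hg
  obtain ⟨r, u, hr, hu, hgx, hJ, ht⟩ := exists_hyperbolic_decomposition g x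
  set s := sqrtDet g
  have hs : s ≠ 0 := sqrtDet_ne_zero g
  have hrC : (r : ℂ) ≠ 0 := by exact_mod_cast hr.ne'
  have hsr : s * r ≠ 0 := mul_ne_zero hs hrC
  have hudet : u.det ≠ 0 := by
    rw [(Matrix.mem_specialUnitaryGroup_iff.1 hu).2]
    exact one_ne_zero
  set U : GL (Fin 2) ℂ := Matrix.GeneralLinearGroup.mkOfDetNeZero u hudet
  have hU : (U : Matrix (Fin 2) (Fin 2) ℂ) = u := rfl
  set z : Idele K := (Units.mk0 _ hsr, 1)
  have e1 : (g * H3.toGL x, classMatrix ϖ 𝔭 c) =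
      central z * (H3.toGL (actH3 g x), classMatrix ϖ 𝔭 c) * (U, 1) := by
    refine Prod.ext ?_ ?_
    · apply Units.ext
      change (g : Matrix (Fin 2) (Fin 2) ℂ) * (H3.toGL x : Matrix (Fin 2) (Fin 2) ℂ) =
        ((Matrix.GeneralLinearGroup.scalar (Fin 2) (Units.mk0 _ hsr) : GL (Fin 2) ℂ) :
          Matrix (Fin 2) (Fin 2) ℂ) * _ * u
      rw [hgx, scalar_eq_diagGL, mul_assoc]
      have : ((diagGL (Units.mk0 _ hsr) (Units.mk0 _ hsr) : GL (Fin 2) ℂ) :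
          Matrix (Fin 2) (Fin 2) ℂ) = (s * r) • 1 := by
        ext i j
        fin_cases i <;> fin_cases j <;> simp
      rw [this, Matrix.smul_mul, one_mul]
    · change _ = Matrix.GeneralLinearGroup.scalar (Fin 2) (1 : (FinAdele K)ˣ) * _ * 1
      rw [map_one, one_mul, mul_one]
  have e2 : F (g * H3.toGL x, classMatrix ϖ 𝔭 c) =
      F (H3.toGL x, globalGL σ⁻¹ * classMatrix ϖ 𝔭 c) := by
    rw [← hF.left_invariant σ (H3.toGL x, globalGL σ⁻¹ * classMatrix ϖ 𝔭 c)]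
    congr 1
    refine Prod.ext rfl ?_
    change _ = globalGL σ * (globalGL σ⁻¹ * _)
    rw [← mul_assoc, ← map_mul, mul_inv_cancel, map_one, one_mul]
  have e3 : F (H3.toGL x, globalGL σ⁻¹ * classMatrix ϖ 𝔭 c) =
      (φ z : ℂ) • rho (k + ℓ + 2) u (F (H3.toGL (actH3 g x), classMatrix ϖ 𝔭 c)) := by
    rw [← e2, e1, hF.right_equivariant _ _ (one_mem _) (by rw [hU]; exact hu), nebentypus_one,
      Units.val_one, one_smul, hF.central_action, map_smul]
    rfl
  have hφz : (φ z : ℂ) = (s * r) ^ (-(k : ℤ)) * (starRingEnd ℂ (s * r)) ^ (-(ℓ : ℤ)) :=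
    hφ.infinityType _
  have hρ : rho (k + ℓ + 2) ((r : ℂ)⁻¹ • u) (F (H3.toGL (actH3 g x), classMatrix ϖ 𝔭 c)) =
      ((r : ℂ)⁻¹) ^ (k + ℓ + 2) •
        rho (k + ℓ + 2) u (F (H3.toGL (actH3 g x), classMatrix ϖ 𝔭 c)) := by
    rw [← rho_smul_one, rho_rho, Matrix.mul_smul, mul_one]
  have hscs : starRingEnd ℂ s ≠ 0 := by simpa using hs
  have htC : ((x.2 : ℝ) : ℂ) ≠ 0 := by exact_mod_cast x.2.2.ne'
  rw [e3]
  unfold slash descent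
  change ((s ^ (-(k : ℤ)) * (starRingEnd ℂ s) ^ (-(ℓ : ℤ))) • _ : V (k + ℓ + 2)) = _
  rw [hJ, map_smul, hρ, smul_smul, smul_smul, smul_smul, hφz, ht, map_mul, Complex.conj_ofReal,
    zpow_neg, zpow_neg, zpow_neg, zpow_neg, zpow_natCast, zpow_natCast, zpow_natCast, zpow_natCast]
  congr 1
  clear_value s
  rw [inv_pow, pow_add, pow_add, mul_pow, mul_pow]
  push_cast
  field_simp

/-- The constant terms of the middle components of `(z, t) ↦ t⁻¹ F((t z; 0 1), y)` vanish. -/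
def MiddleTermsVanish (ι : K →+* ℂ) (F : AdelicFun K k ℓ) (y : GL (Fin 2) (FinAdele K)) : Prop :=
  ∀ n : ℕ, 1 ≤ n → n ≤ k + ℓ + 1 →
    TrivialConstantTerm ι (fun x : H3 => (((x.2 : ℝ) : ℂ)⁻¹) * coeffV n (F (H3.toGL x, y)))

theorem quasiVanishesAt_iff (hφ : IsHeckeCharacter ι 𝔫 k ℓ φ)
    (hF : IsBianchiModularForm ι 𝔫 k ℓ φ F) (c : ClassGroup (𝓞 K)) (s : OnePoint K) :
    QuasiVanishesAt ι (descent ϖ 𝔭 F c) s ↔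
      ∀ σ : GL (Fin 2) K, σ • (OnePoint.infty : OnePoint K) = s →
        MiddleTermsVanish ι F (globalGL σ⁻¹ * classMatrix ϖ 𝔭 c) := by
  unfold QuasiVanishesAt MiddleTermsVanish
  simp only [slash_descent hφ hF, coeffV_smul]

theorem TrivialConstantTerm.const_mul {f : H3 → ℂ} (hf : TrivialConstantTerm ι f) (c : ℂ) :
    TrivialConstantTerm ι (fun x => c * f x) := by
  obtain ⟨w, hw, h⟩ := hf
  refine ⟨w, fun i z t => congrArg (c * ·) (hw i z t), fun t => ?_⟩
  simp only [intervalIntegral.integral_const_mul, h t, mul_zero]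

theorem MiddleTermsVanish.const_smul {F : AdelicFun K k ℓ} {y : GL (Fin 2) (FinAdele K)}
    (h : MiddleTermsVanish ι F y) (c : ℂ) : MiddleTermsVanish ι (c • F) y := by
  intro n h1 h2
  convert (h n h1 h2).const_mul c using 2 with x
  rw [Pi.smul_apply, coeffV_smul]
  ring

theorem IsBianchiModularForm.apply_central_mul_mul (hF : IsBianchiModularForm ι 𝔫 k ℓ φ F)
    (g : GL (Fin 2) ℂ) (y : GL (Fin 2) (FinAdele K)) (z : (FinAdele K)ˣ)
    {κ : GL (Fin 2) (FinAdele K)} (hκ : κ ∈ K0 𝔫) :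
    F (g, diagGL z z * (y * κ)) = ((φ (1, z) : ℂ) * (nebentypus 𝔫 φ κ : ℂ)) • F (g, y) := by
  have e : ((g, diagGL z z * (y * κ)) : GL2Adele K) =
      central (1, z) * ((g, y) * (1, κ)) := by
    refine Prod.ext ?_ ?_
    · change g = Matrix.GeneralLinearGroup.scalar (Fin 2) (1 : ℂˣ) * (g * 1)
      rw [map_one, one_mul, mul_one]
    · rw [← scalar_eq_diagGL]
      rfl
  have h1 : (((1 : GL (Fin 2) ℂ), κ) : GL2Adele K).1.val ∈
      Matrix.specialUnitaryGroup (Fin 2) ℂ := by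
    rw [Units.val_one]
    exact one_mem _
  rw [e, hF.central_action, hF.right_equivariant (g, y) (1, κ) hκ h1, mul_smul, Units.val_one,
    rho_one]

theorem MiddleTermsVanish.central_mul_mul (hF : IsBianchiModularForm ι 𝔫 k ℓ φ F)
    {y : GL (Fin 2) (FinAdele K)} (h : MiddleTermsVanish ι F y) (z : (FinAdele K)ˣ)
    {κ : GL (Fin 2) (FinAdele K)} (hκ : κ ∈ K0 𝔫) :
    MiddleTermsVanish ι F (diagGL z z * (y * κ)) := by
  intro n h1 h2
  convert (h n h1 h2).const_mul ((φ (1, z) : ℂ) * (nebentypus 𝔫 φ κ : ℂ)) using 2 with x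
  rw [hF.apply_central_mul_mul _ _ _ hκ, coeffV_smul]
  ring

/-- One direction of the adelic criterion; `IsCCuspidal.of_middleTermsVanish` is the other. The
compact factor has to be in `K₀(𝔫)`, not merely in `K₀(𝔪)`, for `F` to transform by a scalar under
it. -/
theorem IsCCuspidal.middleTermsVanish {𝔞 : Ideal (𝓞 K)} (h𝔫 : 𝔫 = 𝔞 * 𝔪) (h0 : 𝔫 ≠ 0)
    (hϖ : IsUniformizers ϖ) (h𝔭 : IsClassReps 𝔫 𝔭) (hφ : IsHeckeCharacter ι 𝔫 k ℓ φ)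
    (hF : IsCCuspidal ι 𝔪 𝔫 k ℓ φ ϖ 𝔭 F) {y : GL (Fin 2) (FinAdele K)}
    (hy : y ∈ bruhatCell 𝔪 1 ∨ y ∈ bruhatCell 𝔪 weyl) : MiddleTermsVanish ι F y := by
  subst h𝔫
  obtain ⟨c, z, σ, κ, hκ, hσ, rfl⟩ := hy.elim (exists_cusp_of_mem_bruhatCell_one h0 hϖ h𝔭)
    (exists_cusp_of_mem_bruhatCell_weyl h0 hϖ h𝔭)
  refine MiddleTermsVanish.central_mul_mul hF.1 ?_ z hκ
  exact (quasiVanishesAt_iff hφ hF.1 c _).1 (hF.2 c _ hσ) σ rfl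

theorem IsCCuspidal.of_middleTermsVanish (hφ : IsHeckeCharacter ι 𝔫 k ℓ φ)
    (hF : IsBianchiModularForm ι 𝔫 k ℓ φ F)
    (h : ∀ y, y ∈ bruhatCell 𝔪 1 ∨ y ∈ bruhatCell 𝔪 weyl → MiddleTermsVanish ι F y) :
    IsCCuspidal ι 𝔪 𝔫 k ℓ φ ϖ 𝔭 F := by
  refine ⟨hF, fun c s hs => (quasiVanishesAt_iff hφ hF c s).2 fun σ hσ => h _ ?_⟩
  subst hσ
  exact mem_bruhatCell_of_cusp hs

end Descent

/-! ### Means over period parallelograms -/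

section Mean

open MeasureTheory

/-- The mean of `g` over the parallelogram spanned by `a` and `b`. -/
def latticeMean (g : ℂ → ℂ) (a b : ℂ) : ℂ :=
  ∫ x in (0 : ℝ)..1, ∫ y in (0 : ℝ)..1, g ((x : ℂ) * a + (y : ℂ) * b)

theorem latticeMean_translate {g : ℂ → ℂ} {a b : ℂ} (ha : Function.Periodic g a)
    (hb : Function.Periodic g b) (α β : ℝ) :
    latticeMean (fun z => g (z + ((α : ℂ) * a + (β : ℂ) * b))) a b = latticeMean g a b := by
  unfold latticeMean
  have h1 : ∀ x : ℝ, ∫ y in (0 : ℝ)..1, g ((x : ℂ) * a + (y : ℂ) * b + ((α : ℂ) * a + (β : ℂ) * b))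
      = ∫ y in (0 : ℝ)..1, g (((x + α : ℝ) : ℂ) * a + (y : ℂ) * b) := by
    intro x
    have hp : Function.Periodic (fun y : ℝ => g (((x + α : ℝ) : ℂ) * a + (y : ℂ) * b)) 1 := by
      intro y
      change g (((x + α : ℝ) : ℂ) * a + ((y + 1 : ℝ) : ℂ) * b) = g _
      rw [← hb (((x + α : ℝ) : ℂ) * a + (y : ℂ) * b)]
      congr 1
      push_cast
      ring
    have h2 := hp.intervalIntegral_add_eq β 0
    rw [zero_add] at h2
    rw [← h2, add_comm β 1]
    have h3 := intervalIntegral.integral_comp_add_right (a := 0) (b := 1)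
      (fun y : ℝ => g (((x + α : ℝ) : ℂ) * a + (y : ℂ) * b)) β
    rw [zero_add] at h3
    rw [← h3]
    congr 1
    funext y
    congr 1
    push_cast
    ring
  simp only [h1]
  have hp : Function.Periodic
      (fun x : ℝ => ∫ y in (0 : ℝ)..1, g ((x : ℂ) * a + (y : ℂ) * b)) 1 := by
    intro x
    change ∫ y in (0 : ℝ)..1, g (((x + 1 : ℝ) : ℂ) * a + (y : ℂ) * b) = _
    congr 1
    funext y
    have := ha ((x : ℂ) * a + (y : ℂ) * b)
    rw [← this]
    congr 1
    push_cast
    ring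
  have h2 := hp.intervalIntegral_add_eq α 0
  rw [zero_add] at h2
  have h3 := intervalIntegral.integral_comp_add_right (a := 0) (b := 1)
    (fun x : ℝ => ∫ y in (0 : ℝ)..1, g ((x : ℂ) * a + (y : ℂ) * b)) α
  rw [h3, zero_add, add_comm 1 α, h2]

theorem latticeMean_eq_setIntegral {g : ℂ → ℂ} (hg : Continuous g) (a b : ℂ) :
    latticeMean g a b =
      ∫ p in (Set.Icc (0 : ℝ) 1) ×ˢ (Set.Icc (0 : ℝ) 1), g ((p.1 : ℂ) * a + (p.2 : ℂ) * b) := by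
  have hc : Continuous fun p : ℝ × ℝ => g ((p.1 : ℂ) * a + (p.2 : ℂ) * b) := by fun_prop
  rw [Measure.volume_eq_prod, setIntegral_prod _
    (hc.continuousOn.integrableOn_compact (isCompact_Icc.prod isCompact_Icc)), latticeMean]
  simp only [intervalIntegral.integral_of_le zero_le_one, integral_Icc_eq_integral_Ioc]

/-- Average `g(q + p)` over `q` in one parallelogram and `p` in the other. Means are translation
invariant, so either order of integration leaves one of the two means, and Fubini identifies them;
no lattice index is needed. -/
theorem latticeMean_eq_of_span_le {g : ℂ → ℂ} (hg : Continuous g) {a b a' b' : ℂ}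
    (ha : Function.Periodic g a) (hb : Function.Periodic g b)
    (ha' : Function.Periodic g a') (hb' : Function.Periodic g b')
    (h : ∀ x y : ℝ, ∃ α β : ℝ, (x : ℂ) * a' + (y : ℂ) * b' = (α : ℂ) * a + (β : ℂ) * b)
    (h' : ∀ x y : ℝ, ∃ α β : ℝ, (x : ℂ) * a + (y : ℂ) * b = (α : ℂ) * a' + (β : ℂ) * b') :
    latticeMean g a b = latticeMean g a' b' := by
  set Q : Set (ℝ × ℝ) := (Set.Icc (0 : ℝ) 1) ×ˢ (Set.Icc (0 : ℝ) 1)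
  have hQ : IsCompact Q := isCompact_Icc.prod isCompact_Icc
  have hvol : (volume : Measure (ℝ × ℝ)).real Q = 1 := by
    rw [Measure.volume_eq_prod, measureReal_def, Measure.prod_prod]
    simp
  -- Stated for arbitrary pairs so that it applies with the two parallelograms in either role.
  have key : ∀ {a b a' b' : ℂ}, Function.Periodic g a → Function.Periodic g b →
      (∀ x y : ℝ, ∃ α β : ℝ, (x : ℂ) * a' + (y : ℂ) * b' = (α : ℂ) * a + (β : ℂ) * b) →
      ∫ p in Q, ∫ q in Q, g ((q.1 : ℂ) * a + (q.2 : ℂ) * b +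
        ((p.1 : ℂ) * a' + (p.2 : ℂ) * b')) = latticeMean g a b := by
    intro a b a' b' ha hb h
    have h1 : ∀ p : ℝ × ℝ, ∫ q in Q, g ((q.1 : ℂ) * a + (q.2 : ℂ) * b +
        ((p.1 : ℂ) * a' + (p.2 : ℂ) * b')) = latticeMean g a b := by
      intro p
      obtain ⟨α, β, hαβ⟩ := h p.1 p.2
      rw [hαβ, ← latticeMean_translate ha hb α β, latticeMean_eq_setIntegral (by fun_prop)]
    simp only [h1, setIntegral_const, hvol, one_smul]
  rw [← key ha hb h, ← key ha' hb' h']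
  rw [integral_integral_swap]
  · congr 1
    funext p
    congr 1
    funext q
    rw [add_comm]
  · rw [Measure.prod_restrict]
    refine ContinuousOn.integrableOn_compact (hQ.prod hQ) (Continuous.continuousOn ?_)
    simp only [Function.uncurry_def]
    fun_prop

theorem latticeMean_add {f g : ℂ → ℂ} (hf : Continuous f) (hg : Continuous g) (a b : ℂ) :
    latticeMean (fun z => f z + g z) a b = latticeMean f a b + latticeMean g a b := by
  rw [latticeMean_eq_setIntegral (by fun_prop), latticeMean_eq_setIntegral hf,
    latticeMean_eq_setIntegral hg]
  refine integral_add ?_ ?_ <;>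
  exact ContinuousOn.integrableOn_compact (isCompact_Icc.prod isCompact_Icc)
    (Continuous.continuousOn (by fun_prop))

end Mean

/-! ### Additivity of trivial constant terms -/

section TrivialConstantTerm

variable {ι : K →+* ℂ}

theorem exists_real_combination (ι : K →+* ℂ) (w w' : Module.Basis (Fin 2) ℚ K) (x y : ℝ) :
    ∃ α β : ℝ, (x : ℂ) * ι (w' 0) + (y : ℂ) * ι (w' 1) =
      (α : ℂ) * ι (w 0) + (β : ℂ) * ι (w 1) := by
  have h : ∀ i, ι (w' i) = ((w.repr (w' i) 0 : ℚ) : ℂ) * ι (w 0) +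
      ((w.repr (w' i) 1 : ℚ) : ℂ) * ι (w 1) := by
    intro i
    conv_lhs => rw [← w.sum_repr (w' i)]
    rw [Fin.sum_univ_two, map_add, Rat.smul_def, Rat.smul_def, map_mul, map_mul, map_ratCast,
      map_ratCast]
  refine ⟨x * (w.repr (w' 0) 0 : ℚ) + y * (w.repr (w' 1) 0 : ℚ),
    x * (w.repr (w' 0) 1 : ℚ) + y * (w.repr (w' 1) 1 : ℚ), ?_⟩
  rw [h 0, h 1]
  push_cast
  ring

theorem latticeMean_basis {g : ℂ → ℂ} (hg : Continuous g) {w w' : Module.Basis (Fin 2) ℚ K}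
    (hw : ∀ i, Function.Periodic g (ι (w i))) (hw' : ∀ i, Function.Periodic g (ι (w' i))) :
    latticeMean g (ι (w 0)) (ι (w 1)) = latticeMean g (ι (w' 0)) (ι (w' 1)) :=
  latticeMean_eq_of_span_le hg (hw 0) (hw 1) (hw' 0) (hw' 1) (exists_real_combination ι w w')
    (exists_real_combination ι w' w)

/-- Two lattices of full rank in `K` have a common sublattice of full rank. -/
theorem exists_common_sublattice (w w' : Module.Basis (Fin 2) ℚ K) :
    ∃ w'' : Module.Basis (Fin 2) ℚ K, (∀ i, ∃ a : ℤ, w'' i = a • w i) ∧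
      ∀ i, ∃ a b : ℤ, w'' i = a • w' 0 + b • w' 1 := by
  -- A common denominator of the change of basis: `N w` spans a lattice inside both.
  let N : ℕ := ∏ i : Fin 2, ∏ j : Fin 2, (w'.repr (w i) j).den
  have hN : N ≠ 0 := Finset.prod_ne_zero_iff.2 fun i _ =>
    Finset.prod_ne_zero_iff.2 fun j _ => Rat.den_nz _
  have hNQ : (N : ℚ) ≠ 0 := by exact_mod_cast hN
  have hint : ∀ i j, ∃ a : ℤ, (N : ℚ) * w'.repr (w i) j = a := by
    intro i j
    have hd : (w'.repr (w i) j).den ∣ N :=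
      (Finset.dvd_prod_of_mem (fun j => (w'.repr (w i) j).den) (Finset.mem_univ j)).trans
        (Finset.dvd_prod_of_mem (fun i => ∏ j : Fin 2, (w'.repr (w i) j).den) (Finset.mem_univ i))
    obtain ⟨m, hm⟩ := hd
    refine ⟨m * (w'.repr (w i) j).num, ?_⟩
    rw [hm]
    push_cast
    rw [mul_comm ((w'.repr (w i) j).den : ℚ), mul_assoc, Rat.den_mul_eq_num]
  refine ⟨w.isUnitSMul (w := fun _ => (N : ℚ)) fun _ => isUnit_iff_ne_zero.2 hNQ,
    fun i => ⟨N, ?_⟩, fun i => ?_⟩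
  · rw [Module.Basis.isUnitSMul_apply, ← Int.cast_smul_eq_zsmul ℚ]
    simp
  · obtain ⟨a, ha⟩ := hint i 0
    obtain ⟨b, hb⟩ := hint i 1
    refine ⟨a, b, ?_⟩
    rw [Module.Basis.isUnitSMul_apply, ← Int.cast_smul_eq_zsmul ℚ, ← Int.cast_smul_eq_zsmul ℚ, ← ha,
      ← hb]
    conv_lhs => rw [← w'.sum_repr (w i)]
    rw [Fin.sum_univ_two, smul_add, smul_smul, smul_smul]

theorem trivialConstantTerm_iff {f : H3 → ℂ} : TrivialConstantTerm ι f ↔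
    ∃ w : Module.Basis (Fin 2) ℚ K,
      ∀ t : {t : ℝ // 0 < t}, (∀ i, Function.Periodic (fun z => f (z, t)) (ι (w i))) ∧
        latticeMean (fun z => f (z, t)) (ι (w 0)) (ι (w 1)) = 0 :=
  exists_congr fun _ => ⟨fun h t => ⟨fun i z => h.1 i z t, h.2 t⟩,
    fun h => ⟨fun i z t => (h t).1 i z, fun t => (h t).2⟩⟩

/-- The summands may be periodic for different lattices. On a common sublattice both are periodic,
and by continuity their means there are still zero. -/
theorem TrivialConstantTerm.add {f g : H3 → ℂ} (hf : TrivialConstantTerm ι f)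
    (hg : TrivialConstantTerm ι g) (cf : ∀ t, Continuous fun z => f (z, t))
    (cg : ∀ t, Continuous fun z => g (z, t)) : TrivialConstantTerm ι (fun x => f x + g x) := by
  rw [trivialConstantTerm_iff] at hf hg ⊢
  obtain ⟨w, hw⟩ := hf
  obtain ⟨w', hw'⟩ := hg
  obtain ⟨w'', h1, h2⟩ := exists_common_sublattice w w'
  refine ⟨w'', fun t => ?_⟩
  have hpf : ∀ i, Function.Periodic (fun z => f (z, t)) (ι (w'' i)) := by
    intro i
    obtain ⟨a, ha⟩ := h1 i
    rw [ha, map_zsmul]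
    exact ((hw t).1 i).zsmul a
  have hpg : ∀ i, Function.Periodic (fun z => g (z, t)) (ι (w'' i)) := by
    intro i
    obtain ⟨a, b, hab⟩ := h2 i
    rw [hab, map_add, map_zsmul, map_zsmul]
    exact (((hw' t).1 0).zsmul a).add_period (((hw' t).1 1).zsmul b)
  refine ⟨fun i z => congrArg₂ (· + ·) (hpf i z) (hpg i z), ?_⟩
  rw [latticeMean_add (cf t) (cg t), latticeMean_basis (cf t) hpf (hw t).1,
    latticeMean_basis (cg t) hpg (hw' t).1, (hw t).2, (hw' t).2, add_zero]

end TrivialConstantTerm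

/-! ### Smooth functions on `GL₂(ℂ)` and linearity of the Casimir operators -/

section Smooth

/-- The open subset `GL₂(ℂ)` of `ℂ⁴`. -/
def glSet : Set (Fin 2 → Fin 2 → ℂ) := {A | (Matrix.of A).det ≠ 0}

theorem isOpen_glSet : IsOpen glSet := by
  have h : Continuous fun A : Fin 2 → Fin 2 → ℂ => (Matrix.of A).det := by
    simp only [Matrix.det_fin_two, Matrix.of_apply]
    fun_prop
  exact isOpen_ne.preimage h

/-- The extension by `0` to `ℂ⁴` of a function on `GL₂(ℂ)`. -/
def extendGL (f : GL (Fin 2) ℂ → ℂ) (A : Fin 2 → Fin 2 → ℂ) : ℂ :=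
  if h : (Matrix.of A).det ≠ 0 then
    f (Matrix.GeneralLinearGroup.mkOfDetNeZero (Matrix.of A) h) else 0

theorem smoothGL_iff {f : GL (Fin 2) ℂ → ℂ} : SmoothGL f ↔ ContDiffOn ℝ ∞ (extendGL f) glSet :=
  Iff.rfl

/-- The entries of an element of `GL₂(ℂ)`. -/
def entriesGL (g : GL (Fin 2) ℂ) : Fin 2 → Fin 2 → ℂ := fun i j => g i j

theorem entriesGL_mem (g : GL (Fin 2) ℂ) : entriesGL g ∈ glSet := g.det_ne_zero

theorem extendGL_entriesGL (f : GL (Fin 2) ℂ → ℂ) (g : GL (Fin 2) ℂ) :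
    extendGL f (entriesGL g) = f g := by
  rw [extendGL, dif_pos (show (Matrix.of (entriesGL g)).det ≠ 0 from entriesGL_mem g)]
  congr 1
  apply Units.ext
  rfl

theorem exists_entriesGL {A : Fin 2 → Fin 2 → ℂ} (hA : A ∈ glSet) : ∃ g, entriesGL g = A :=
  ⟨Matrix.GeneralLinearGroup.mkOfDetNeZero (Matrix.of A) hA, rfl⟩

open scoped Matrix.Norms.Operator in
theorem hasDerivAt_exp_smul_entry (X : Matrix (Fin 2) (Fin 2) ℂ) (i j : Fin 2) :
    HasDerivAt (fun s : ℝ => NormedSpace.exp (s • X) i j) (X i j) 0 := by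
  have h := hasDerivAt_exp_smul_const (𝕂 := ℝ) X (0 : ℝ)
  rw [zero_smul, NormedSpace.exp_zero, one_mul] at h
  exact hasDerivAt_pi.1 (hasDerivAt_pi.1 h i) j

theorem hasDerivAt_entriesGL_mul_exp (X : Matrix (Fin 2) (Fin 2) ℂ) (g : GL (Fin 2) ℂ) :
    HasDerivAt (fun s : ℝ => entriesGL (g * expGL (s • X)))
      (fun i j => ((g : Matrix (Fin 2) (Fin 2) ℂ) * X) i j) 0 := by
  refine hasDerivAt_pi.2 fun i => hasDerivAt_pi.2 fun j => ?_
  have h : (fun s : ℝ => entriesGL (g * expGL (s • X)) i j) =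
      fun s : ℝ => ∑ l, g i l * NormedSpace.exp (s • X) l j := by
    funext s
    exact Matrix.mul_apply
  rw [h, Matrix.mul_apply]
  exact HasDerivAt.fun_sum fun l _ => (hasDerivAt_exp_smul_entry X l j).const_mul _

variable {f f₁ f₂ : GL (Fin 2) ℂ → ℂ}

/-- Chain rule along `s ↦ g exp(sX)`, which has velocity `gX` at `0`. It turns `lieDeriv` into a
directional derivative, hence makes it additive and smoothness preserving on smooth functions. -/
theorem SmoothGL.hasDerivAt (hf : SmoothGL f) (X : Matrix (Fin 2) (Fin 2) ℂ) (g : GL (Fin 2) ℂ) :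
    HasDerivAt (fun s : ℝ => f (g * expGL (s • X)))
      (fderiv ℝ (extendGL f) (entriesGL g) fun i j => ((g : Matrix (Fin 2) (Fin 2) ℂ) * X) i j)
      0 := by
  have h1 : DifferentiableAt ℝ (extendGL f) (entriesGL g) :=
    ((smoothGL_iff.1 hf).contDiffAt (isOpen_glSet.mem_nhds (entriesGL_mem g))).differentiableAt
      (by simp)
  have h0 : entriesGL (g * expGL ((0 : ℝ) • X)) = entriesGL g := by
    congr 1
    apply Units.ext
    rw [Units.val_mul]
    change _ * NormedSpace.exp ((0 : ℝ) • X) = _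
    rw [zero_smul, NormedSpace.exp_zero, mul_one]
  have h' : HasFDerivAt (extendGL f) (fderiv ℝ (extendGL f) (entriesGL g))
      (entriesGL (g * expGL ((0 : ℝ) • X))) := by
    rw [h0]
    exact h1.hasFDerivAt
  have e : (extendGL f ∘ fun s : ℝ => entriesGL (g * expGL (s • X))) =
      fun s : ℝ => f (g * expGL (s • X)) := funext fun s => extendGL_entriesGL f _
  rw [← e]
  exact h'.comp_hasDerivAt (0 : ℝ) (hasDerivAt_entriesGL_mul_exp X g)

theorem SmoothGL.lieDeriv_eq (hf : SmoothGL f) (X : Matrix (Fin 2) (Fin 2) ℂ) (g : GL (Fin 2) ℂ) :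
    lieDeriv X f g =
      fderiv ℝ (extendGL f) (entriesGL g) fun i j => ((g : Matrix (Fin 2) (Fin 2) ℂ) * X) i j :=
  (hf.hasDerivAt X g).deriv

theorem SmoothGL.lieDeriv (hf : SmoothGL f) (X : Matrix (Fin 2) (Fin 2) ℂ) :
    SmoothGL (lieDeriv X f) := by
  rw [smoothGL_iff] at hf ⊢
  have h1 : ContDiffOn ℝ ∞ (fderiv ℝ (extendGL f)) glSet :=
    hf.fderiv_of_isOpen isOpen_glSet (by simp)
  have h2 : ContDiffOn ℝ ∞ (fun A : Fin 2 → Fin 2 → ℂ => fun i j => (Matrix.of A * X) i j)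
      glSet := by
    simp only [Matrix.mul_apply, Matrix.of_apply]
    fun_prop
  refine (h1.clm_apply h2).congr fun A hA => ?_
  obtain ⟨g, rfl⟩ := exists_entriesGL hA
  rw [extendGL_entriesGL, SmoothGL.lieDeriv_eq hf]
  rfl

theorem SmoothGL.add (h₁ : SmoothGL f₁) (h₂ : SmoothGL f₂) : SmoothGL (f₁ + f₂) := by
  rw [smoothGL_iff] at *
  refine (h₁.add h₂).congr fun A hA => ?_
  obtain ⟨g, rfl⟩ := exists_entriesGL hA
  simp only [Pi.add_apply, extendGL_entriesGL]

theorem SmoothGL.const_smul (h : SmoothGL f) (c : ℂ) : SmoothGL (c • f) := by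
  rw [smoothGL_iff] at *
  refine (contDiffOn_const (c := c) |>.mul h).congr fun A hA => ?_
  obtain ⟨g, rfl⟩ := exists_entriesGL hA
  simp only [Pi.smul_apply, extendGL_entriesGL, smul_eq_mul]

theorem lieDeriv_add (h₁ : SmoothGL f₁) (h₂ : SmoothGL f₂) (X : Matrix (Fin 2) (Fin 2) ℂ) :
    lieDeriv X (f₁ + f₂) = lieDeriv X f₁ + lieDeriv X f₂ := by
  funext g
  exact ((h₁.hasDerivAt X g).add (h₂.hasDerivAt X g)).deriv.trans
    (congrArg₂ (· + ·) (h₁.lieDeriv_eq X g).symm (h₂.lieDeriv_eq X g).symm)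

/-- Scalars commute with `deriv` even where the derivative does not exist, so smoothness plays no
role here, in contrast to `lieDeriv_add`. -/
theorem lieDeriv_smul (c : ℂ) (f : GL (Fin 2) ℂ → ℂ) (X : Matrix (Fin 2) (Fin 2) ℂ) :
    lieDeriv X (c • f) = c • lieDeriv X f := by
  funext g
  exact deriv_const_mul_field c

theorem compDeriv_eq (ε : ℂ) (X : Matrix (Fin 2) (Fin 2) ℂ) (f : GL (Fin 2) ℂ → ℂ) :
    compDeriv ε X f = (2 : ℂ)⁻¹ • (lieDeriv X f + (-(ε * Complex.I)) • lieDeriv (Complex.I • X) f) := by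
  funext g
  simp only [compDeriv, Pi.smul_apply, Pi.add_apply, smul_eq_mul]
  ring

theorem SmoothGL.compDeriv (hf : SmoothGL f) (ε : ℂ) (X : Matrix (Fin 2) (Fin 2) ℂ) :
    SmoothGL (compDeriv ε X f) := by
  rw [compDeriv_eq]
  exact ((hf.lieDeriv X).add ((hf.lieDeriv _).const_smul _)).const_smul _

theorem compDeriv_add (h₁ : SmoothGL f₁) (h₂ : SmoothGL f₂) (ε : ℂ)
    (X : Matrix (Fin 2) (Fin 2) ℂ) :
    compDeriv ε X (f₁ + f₂) = compDeriv ε X f₁ + compDeriv ε X f₂ := by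
  simp only [compDeriv_eq, lieDeriv_add h₁ h₂, smul_add]
  abel

theorem compDeriv_smul (ε c : ℂ) (f : GL (Fin 2) ℂ → ℂ) (X : Matrix (Fin 2) (Fin 2) ℂ) :
    compDeriv ε X (c • f) = c • compDeriv ε X f := by
  simp only [compDeriv_eq, lieDeriv_smul, smul_add, smul_comm c]

theorem casimirD_add (h₁ : SmoothGL f₁) (h₂ : SmoothGL f₂) (ε : ℂ) :
    casimirD ε (f₁ + f₂) = casimirD ε f₁ + casimirD ε f₂ := by
  funext g
  have h : ∀ X Y : Matrix (Fin 2) (Fin 2) ℂ, compDeriv ε X (compDeriv ε Y (f₁ + f₂)) g =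
      compDeriv ε X (compDeriv ε Y f₁) g + compDeriv ε X (compDeriv ε Y f₂) g := by
    intro X Y
    rw [compDeriv_add h₁ h₂, compDeriv_add (h₁.compDeriv _ _) (h₂.compDeriv _ _), Pi.add_apply]
  simp only [casimirD, h, Pi.add_apply]
  ring

theorem casimirD_smul (c ε : ℂ) (f : GL (Fin 2) ℂ → ℂ) :
    casimirD ε (c • f) = c • casimirD ε f := by
  funext g
  simp only [casimirD, compDeriv_smul, Pi.smul_apply, smul_eq_mul]
  ring

/-- The smooth functions on `GL₂(ℂ)` that are eigenfunctions of the two Casimir operators with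
given eigenvalues. -/
def casimirEigenspace (a b : ℂ) : Submodule ℂ (GL (Fin 2) ℂ → ℂ) where
  carrier := {f | SmoothGL f ∧ casimirD 1 f = a • f ∧ casimirD (-1) f = b • f}
  zero_mem' := by
    have h0 : SmoothGL 0 := by
      rw [smoothGL_iff]
      refine (contDiffOn_const (c := (0 : ℂ))).congr fun A hA => ?_
      obtain ⟨g, rfl⟩ := exists_entriesGL hA
      rw [extendGL_entriesGL, Pi.zero_apply]
    have h : ∀ ε, casimirD ε 0 = 0 := fun ε => by
      have := casimirD_smul 0 ε 0
      rwa [zero_smul, zero_smul] at this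
    exact ⟨h0, by rw [h, smul_zero], by rw [h, smul_zero]⟩
  add_mem' := by
    rintro f g ⟨hf, hf1, hf2⟩ ⟨hg, hg1, hg2⟩
    exact ⟨hf.add hg, by rw [casimirD_add hf hg, hf1, hg1, smul_add],
      by rw [casimirD_add hf hg, hf2, hg2, smul_add]⟩
  smul_mem' := by
    rintro c f ⟨hf, hf1, hf2⟩
    exact ⟨hf.const_smul c, by rw [casimirD_smul, hf1, smul_comm],
      by rw [casimirD_smul, hf2, smul_comm]⟩

theorem SmoothGL.continuous_toGL (hf : SmoothGL f) (t : {t : ℝ // 0 < t}) :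
    Continuous fun z : ℂ => f (H3.toGL (z, t)) := by
  have h := (smoothGL_iff.1 hf).continuousOn
  have hc : Continuous fun z : ℂ => entriesGL (H3.toGL (z, t)) := by
    refine continuous_pi fun i => continuous_pi fun j => ?_
    change Continuous fun z : ℂ => (!![((t : ℝ) : ℂ), z; 0, 1] : Matrix (Fin 2) (Fin 2) ℂ) i j
    fin_cases i <;> fin_cases j <;> simp <;> fun_prop
  have := h.comp_continuous hc fun z => entriesGL_mem _
  have e : (extendGL f ∘ fun z : ℂ => entriesGL (H3.toGL (z, t))) =
      fun z : ℂ => f (H3.toGL (z, t)) := funext fun z => extendGL_entriesGL f _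
  rwa [e] at this

end Smooth

/-! ### Multiplicativity of the nebentypus on `K₀(𝔫)` -/

section Nebentypus

variable {ι : K →+* ℂ} {𝔫 : Ideal (𝓞 K)} {k ℓ : ℕ} {φ : Idele K →* ℂˣ}

theorem localChar_mul (φ : Idele K →* ℂˣ) {v : HeightOneSpectrum (𝓞 K)}
    {x y : v.adicCompletion K} (hx : x ≠ 0) (hy : y ≠ 0) :
    localChar φ v (x * y) = localChar φ v x * localChar φ v y := by
  rw [localChar, localChar, localChar, dif_neg hx, dif_neg hy, dif_neg (mul_ne_zero hx hy),
    ← map_mul]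
  congr 1
  refine Prod.ext (one_mul _).symm (Units.ext ?_)
  exact localAdele_mul v x y

theorem localChar_eq_one (hφ : IsHeckeCharacter ι 𝔫 k ℓ φ) {v : HeightOneSpectrum (𝓞 K)}
    {x : v.adicCompletion K} (hx : Valued.v x = 1) (hx1 : x - 1 ∈ localIdeal 𝔫 v) :
    localChar φ v x = 1 := by
  have h0 : x ≠ 0 := fun h => by
    rw [h, map_zero] at hx
    exact zero_ne_one hx
  rw [localChar, dif_neg h0]
  refine hφ.conductor _ fun w => ?_
  change Valued.v (localAdele v x w) = 1 ∧ localAdele v x w - 1 ∈ localIdeal 𝔫 w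
  by_cases hw : w = v
  · subst hw
    rw [localAdele_same]
    exact ⟨hx, hx1⟩
  · rw [localAdele_of_ne hw, map_one, sub_self]
    exact ⟨rfl, zero_mem_localIdeal⟩

/-- The lower left entry is a nonunit at `v ∣ 𝔫`; if the lower right one were too, so would be the
determinant. -/
theorem valued_lower_right {v : HeightOneSpectrum (𝓞 K)} (hv : v.asIdeal ∣ 𝔫)
    {g : GL (Fin 2) (v.adicCompletion K)} (hg : g ∈ localK0 v 𝔫) : Valued.v (g 1 1) = 1 := by
  obtain ⟨h1, h2, h3⟩ := mem_localK0_iff.1 hg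
  have hc := valued_lt_one_of_mem_localIdeal hv h2
  refine le_antisymm (h1 1 1) ?_
  by_contra hd
  rw [not_le] at hd
  have : Valued.v (g : Matrix (Fin 2) (Fin 2) (v.adicCompletion K)).det < 1 := by
    rw [Matrix.det_fin_two]
    refine (Valuation.map_sub _ _ _).trans_lt (max_lt ?_ ?_)
    · rw [map_mul, mul_comm]
      exact mul_lt_one_of_lt_of_le hd (h1 0 0)
    · rw [map_mul, mul_comm]
      exact mul_lt_one_of_lt_of_le hc (h1 0 1)
  exact this.ne h3

/-- The lower right entry of `g h` is congruent to the product of those of `g` and `h` modulo `𝔫`,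
all of them units; the ratio is `1` modulo `𝔫` and is killed because the conductor divides `𝔫`. -/
theorem localChar_lower_right_mul (hφ : IsHeckeCharacter ι 𝔫 k ℓ φ)
    {v : HeightOneSpectrum (𝓞 K)} (hv : v.asIdeal ∣ 𝔫)
    {g h : GL (Fin 2) (v.adicCompletion K)} (hg : g ∈ localK0 v 𝔫) (hh : h ∈ localK0 v 𝔫) :
    localChar φ v ((g * h) 1 1) = localChar φ v (g 1 1) * localChar φ v (h 1 1) := by
  have h1 := valued_lower_right hv hg
  have h2 := valued_lower_right hv hh
  have h3 := valued_lower_right hv (mul_mem hg hh)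
  have hne : ∀ {x : v.adicCompletion K}, Valued.v x = 1 → x ≠ 0 := fun hx h => by
    rw [h, map_zero] at hx
    exact zero_ne_one hx
  have hgh : (g * h) 1 1 = g 1 0 * h 0 1 + g 1 1 * h 1 1 := by
    rw [Units.val_mul, Matrix.mul_apply, Fin.sum_univ_two]
  have h4 : Valued.v (g 1 1 * h 1 1) = 1 := by rw [map_mul, h1, h2, one_mul]
  have h5 : localChar φ v ((g * h) 1 1 * (g 1 1 * h 1 1)⁻¹) = 1 := by
    refine localChar_eq_one hφ (by rw [map_mul, map_inv₀, h3, h4, inv_one, one_mul]) ?_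
    have : (g * h) 1 1 * (g 1 1 * h 1 1)⁻¹ - 1 = g 1 0 * (h 0 1 * (g 1 1 * h 1 1)⁻¹) := by
      rw [hgh, add_mul, mul_inv_cancel₀ (hne h4), add_sub_cancel_right, mul_assoc]
    rw [this]
    exact localIdeal_mul_right (mem_localK0_iff.1 hg).2.1
      (mul_mem ((mem_localK0_iff.1 hh).1 0 1) (inv_mem_integers h4))
  rw [← localChar_mul φ (hne h1) (hne h2), ← one_mul (localChar φ v (g 1 1 * h 1 1)), ← h5,
    ← localChar_mul φ (mul_ne_zero (hne h3) (inv_ne_zero (hne h4))) (hne h4),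
    inv_mul_cancel_right₀ (hne h4)]

theorem nebentypus_mul (hφ : IsHeckeCharacter ι 𝔫 k ℓ φ) (h0 : 𝔫 ≠ 0)
    {u u' : GL (Fin 2) (FinAdele K)} (hu : u ∈ K0 𝔫) (hu' : u' ∈ K0 𝔫) :
    nebentypus 𝔫 φ (u * u') = nebentypus 𝔫 φ u * nebentypus 𝔫 φ u' := by
  have hfin : {v : HeightOneSpectrum (𝓞 K) | v.asIdeal ∣ 𝔫}.Finite := Ideal.finite_factors h0
  refine Eq.trans ?_ (finprod_mem_mul_distrib hfin)
  refine finprod_mem_congr rfl fun v hv => ?_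
  have := localChar_lower_right_mul hφ hv (mem_K0_iff.1 hu v) (mem_K0_iff.1 hu' v)
  rwa [← map_mul] at this

theorem coe_diagGL_conj {R : Type u} [CommRing R] (a : Rˣ) (s : GL (Fin 2) R) :
    (((diagGL a 1)⁻¹ * s * diagGL a 1 : GL (Fin 2) R) : Matrix (Fin 2) (Fin 2) R) =
      !![s 0 0, ((a⁻¹ : Rˣ) : R) * s 0 1; s 1 0 * a, s 1 1] := by
  rw [diagGL_inv, Units.val_mul, Units.val_mul]
  have e : (s : Matrix (Fin 2) (Fin 2) R) = !![s 0 0, s 0 1; s 1 0, s 1 1] := Matrix.eta_fin_two _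
  have e1 : ((diagGL a⁻¹ 1⁻¹ : GL (Fin 2) R) : Matrix (Fin 2) (Fin 2) R) =
      !![((a⁻¹ : Rˣ) : R), 0; 0, 1] := by
    rw [inv_one]
    rfl
  have e2 : ((diagGL a 1 : GL (Fin 2) R) : Matrix (Fin 2) (Fin 2) R) = !![(a : R), 0; 0, 1] := rfl
  have e3 : ((a⁻¹ : Rˣ) : R) * s 0 0 * a = s 0 0 := by
    rw [mul_right_comm, Units.inv_mul, one_mul]
  rw [e1, e2]
  conv_lhs => rw [e]
  rw [Matrix.mul_fin_two, Matrix.mul_fin_two]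
  simp only [zero_mul, mul_zero, add_zero, zero_add, mul_one, one_mul, e3]

theorem diagGL_conj_lower_right {R : Type u} [CommRing R] (a : Rˣ) (s : GL (Fin 2) R) :
    ((diagGL a 1)⁻¹ * s * diagGL a 1) 1 1 = s 1 1 := by
  rw [coe_diagGL_conj]
  rfl

theorem nebentypus_diagGL_conj (𝔫 : Ideal (𝓞 K)) (φ : Idele K →* ℂˣ) (a : (FinAdele K)ˣ)
    (s : GL (Fin 2) (FinAdele K)) :
    nebentypus 𝔫 φ ((diagGL a 1)⁻¹ * s * diagGL a 1) = nebentypus 𝔫 φ s := by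
  unfold nebentypus
  rw [diagGL_conj_lower_right]

end Nebentypus

/-! ### Finiteness of the coset space of a Hecke operator -/

section Cosets

variable {𝔫 : Ideal (𝓞 K)}

theorem mem_conjStab_iff {x : GL (Fin 2) (FinAdele K)} {s : K0 𝔫} :
    s ∈ conjStab 𝔫 x ↔ x⁻¹ * (s : GL (Fin 2) (FinAdele K)) * x ∈ K0 𝔫 := by
  rw [conjStab, Subgroup.mem_subgroupOf, Subgroup.mem_map]
  constructor
  · rintro ⟨k, hk, hks⟩
    rw [← hks]
    change x⁻¹ * (x * k * x⁻¹) * x ∈ _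
    convert hk using 1
    group
  · intro h
    refine ⟨_, h, ?_⟩
    change x * (x⁻¹ * (s : GL (Fin 2) (FinAdele K)) * x) * x⁻¹ = _
    group

/-- The conjugation divides only the upper right entry by `π`; it multiplies the lower left one by
`π`, which does no harm. -/
theorem diagGL_conj_mem_localK0 {v : HeightOneSpectrum (𝓞 K)} {π : (v.adicCompletion K)ˣ}
    (hπ : Valued.v (π : v.adicCompletion K) ≤ 1) {g : GL (Fin 2) (v.adicCompletion K)}
    (hg : g ∈ localK0 v 𝔫) (h : Valued.v (g 0 1) ≤ Valued.v (π : v.adicCompletion K)) :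
    (diagGL π 1)⁻¹ * g * diagGL π 1 ∈ localK0 v 𝔫 := by
  obtain ⟨h1, h2, h3⟩ := mem_localK0_iff.1 hg
  have hπ0 : (π : v.adicCompletion K) ≠ 0 := π.ne_zero
  refine mem_localK0_iff.2 ⟨?_, ?_, ?_⟩
  · rw [coe_diagGL_conj]
    have h01 : Valued.v (((π⁻¹ : (v.adicCompletion K)ˣ) : v.adicCompletion K) * g 0 1) ≤ 1 := by
      rw [map_mul, Units.val_inv_eq_inv_val, map_inv₀]
      exact (inv_mul_le_one₀ (zero_lt_iff.2 ((Valuation.ne_zero_iff _).2 hπ0))).2 h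
    intro i j
    fin_cases i <;> fin_cases j
    · exact h1 0 0
    · exact h01
    · exact mul_mem (h1 1 0) hπ
    · exact h1 1 1
  · rw [coe_diagGL_conj]
    exact localIdeal_mul_right h2 hπ
  · rw [Units.val_mul, Units.val_mul, Matrix.det_mul, Matrix.det_mul, mul_right_comm,
      ← Matrix.det_mul, ← Units.val_mul, inv_mul_cancel, Units.val_one, Matrix.det_one, one_mul]
    exact h3

theorem mem_conjStab_of_valued_le {𝔮 : HeightOneSpectrum (𝓞 K)} {π : (𝔮.adicCompletion K)ˣ}
    (hπ : Valued.v (π : 𝔮.adicCompletion K) ≤ 1) {s : K0 𝔫}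
    (hs : Valued.v (localGL 𝔮 (s : GL (Fin 2) (FinAdele K)) 0 1) ≤
      Valued.v (π : 𝔮.adicCompletion K)) :
    s ∈ conjStab 𝔫 (diagGL (localIdele 𝔮 π) 1) := by
  rw [mem_conjStab_iff, mem_K0_iff]
  intro v
  have hsv := mem_K0_iff.1 s.2 v
  by_cases hv : v = 𝔮
  · subst hv
    rw [map_mul, map_mul, map_inv, localGL_diagGL, map_evalAt_localIdele_same, map_one]
    exact diagGL_conj_mem_localK0 hπ hsv hs
  · rw [map_mul, map_mul, map_inv, localGL_diagGL, map_evalAt_localIdele_of_ne hv, map_one,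
      diagGL_one, inv_one, one_mul, mul_one]
    exact hsv

/-- A substitute for the residue map, used only to count: it takes values in a finite set and its
fibres in `𝒪_v` have small diameter. -/
theorem exists_residue (v : HeightOneSpectrum (𝓞 K)) :
    ∃ f : v.adicCompletion K → 𝓞 K ⧸ v.asIdeal, ∀ b b' : v.adicCompletion K,
      Valued.v b ≤ 1 → Valued.v b' ≤ 1 → f b = f b' →
        Valued.v (b' - b) ≤ WithZero.exp (-1 : ℤ) := by
  have hr : ∀ b : v.adicCompletion K, ∃ r : 𝓞 K, Valued.v b ≤ 1 →
      Valued.v (((algebraMap (𝓞 K) K r : K) : v.adicCompletion K) - b) ≤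
        WithZero.exp (-1 : ℤ) := by
    intro b
    by_cases hb : Valued.v b ≤ 1
    · obtain ⟨r, hr⟩ := exists_valued_sub_le v hb (WithZero.exp_ne_zero (a := (-1 : ℤ)))
      exact ⟨r, fun _ => hr⟩
    -- Arbitrary value outside `𝒪_v`.
    · exact ⟨0, fun h => absurd h hb⟩
  choose r hr using hr
  refine ⟨fun b => Ideal.Quotient.mk v.asIdeal (r b), fun b b' hb hb' h => ?_⟩
  have h1 := Ideal.Quotient.eq.1 h
  rw [← pow_one v.asIdeal, ← HeightOneSpectrum.intValuation_le_pow_iff_mem, ← valued_algebraMap,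
    map_sub] at h1
  have e : (((algebraMap (𝓞 K) K (r b) - algebraMap (𝓞 K) K (r b') : K)) : v.adicCompletion K) =
      ((algebraMap (𝓞 K) K (r b) : K) : v.adicCompletion K) -
        ((algebraMap (𝓞 K) K (r b') : K) : v.adicCompletion K) :=
    map_sub (algebraMap K (v.adicCompletion K)) _ _
  rw [e] at h1
  have e2 : ∀ x y : v.adicCompletion K, b' - b = x - b - (y - b') - (x - y) := fun x y => by ring
  rw [e2 ((algebraMap (𝓞 K) K (r b) : K) : v.adicCompletion K)
    ((algebraMap (𝓞 K) K (r b') : K) : v.adicCompletion K)]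
  refine (Valuation.map_sub _ _ _).trans (max_le ((Valuation.map_sub _ _ _).trans
    (max_le (hr b hb) (hr b' hb'))) (h1.trans_eq ?_))
  norm_num

theorem valued_inv_mul_le {v : HeightOneSpectrum (𝓞 K)} {g g' : GL (Fin 2) (v.adicCompletion K)}
    (hg : g ∈ localK0 v 𝔫) {c : WithZero (Multiplicative ℤ)}
    (h : ∀ i j, Valued.v (g' i j - g i j) ≤ c) : Valued.v ((g⁻¹ * g') 0 1) ≤ c := by
  have hinv := (mem_localK0_iff.1 (inv_mem hg)).1
  have h1 : (g⁻¹ * g) 0 1 = 0 := by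
    rw [inv_mul_cancel]
    rfl
  have h2 : (g⁻¹ * g') 0 1 = (g⁻¹ : GL (Fin 2) _) 0 0 * (g' 0 1 - g 0 1) +
      (g⁻¹ : GL (Fin 2) _) 0 1 * (g' 1 1 - g 1 1) := by
    rw [← sub_zero ((g⁻¹ * g') 0 1), ← h1, Units.val_mul, Units.val_mul, Matrix.mul_apply,
      Matrix.mul_apply, Fin.sum_univ_two, Fin.sum_univ_two]
    ring
  rw [h2]
  refine (Valuation.map_add _ _ _).trans (max_le ?_ ?_)
  · rw [map_mul]
    exact mul_le_of_le_one_of_le (hinv 0 0) (h 0 1)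
  · rw [map_mul]
    exact mul_le_of_le_one_of_le (hinv 0 1) (h 1 1)

theorem inv_mul_mem_conjStab {𝔮 : HeightOneSpectrum (𝓞 K)} {π : (𝔮.adicCompletion K)ˣ}
    (hπ : Valued.v (π : 𝔮.adicCompletion K) ≤ 1) {s s' : K0 𝔫}
    (h : ∀ i j, Valued.v (localGL 𝔮 (s' : GL (Fin 2) (FinAdele K)) i j -
      localGL 𝔮 (s : GL (Fin 2) (FinAdele K)) i j) ≤ Valued.v (π : 𝔮.adicCompletion K)) :
    s⁻¹ * s' ∈ conjStab 𝔫 (diagGL (localIdele 𝔮 π) 1) := by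
  refine mem_conjStab_of_valued_le hπ ?_
  rw [Subgroup.coe_mul, Subgroup.coe_inv, map_mul, map_inv]
  exact valued_inv_mul_le (mem_K0_iff.1 s.2 𝔮) h

/-- A coset is determined by the residues at `𝔮` of the four entries of a representative, so the
quotient embeds in `(𝓞 K / 𝔮)⁴`. Finiteness makes the `finsum` in `doubleCosetOp` an honest sum. -/
theorem finite_quotient_conjStab (𝔮 : HeightOneSpectrum (𝓞 K)) {π : (𝔮.adicCompletion K)ˣ}
    (hπ : Valued.v (π : 𝔮.adicCompletion K) = WithZero.exp (-1 : ℤ)) :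
    Finite (K0 𝔫 ⧸ conjStab 𝔫 (diagGL (localIdele 𝔮 π) 1)) := by
  have hπ1 : Valued.v (π : 𝔮.adicCompletion K) ≤ 1 := by
    rw [hπ, ← WithZero.exp_zero, WithZero.exp_le_exp]
    norm_num
  obtain ⟨f, hf⟩ := exists_residue 𝔮
  have hent : ∀ (u : K0 𝔫) (i j : Fin 2),
      Valued.v (localGL 𝔮 (u : GL (Fin 2) (FinAdele K)) i j) ≤ 1 :=
    fun u => (mem_localK0_iff.1 (mem_K0_iff.1 u.2 𝔮)).1
  have : Finite (𝓞 K ⧸ 𝔮.asIdeal) := Ideal.finiteQuotientOfFreeOfNeBot _ 𝔮.ne_bot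
  let G : K0 𝔫 ⧸ conjStab 𝔫 (diagGL (localIdele 𝔮 π) 1) → Fin 2 → Fin 2 → 𝓞 K ⧸ 𝔮.asIdeal :=
    fun c i j => f (localGL 𝔮 (c.out : GL (Fin 2) (FinAdele K)) i j)
  refine Finite.of_injective G fun c c' h => ?_
  rw [← QuotientGroup.out_eq' c, ← QuotientGroup.out_eq' c', QuotientGroup.eq]
  refine inv_mul_mem_conjStab hπ1 fun i j => ?_
  rw [hπ]
  exact hf _ _ (hent _ i j) (hent _ i j) (congrFun (congrFun h i) j)

end Cosets

/-! ### Sums and scalar multiples of C-cuspidal forms -/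

section LinearStructure

variable {ι : K →+* ℂ} {𝔪 𝔫 : Ideal (𝓞 K)} {k ℓ : ℕ} {φ : Idele K →* ℂˣ}
  {F F₁ F₂ : AdelicFun K k ℓ}

theorem IsBianchiModularForm.mem_casimirEigenspace (hF : IsBianchiModularForm ι 𝔫 k ℓ φ F)
    (y : GL (Fin 2) (FinAdele K)) {n : ℕ} (hn : n ≤ k + ℓ + 2) :
    (fun g => coeffV n (F (g, y))) ∈
      casimirEigenspace ((k : ℂ) ^ 2 / 2 + k) ((ℓ : ℂ) ^ 2 / 2 + ℓ) :=
  ⟨hF.smooth y n hn, funext (hF.casimir_id y n hn), funext (hF.casimir_conj y n hn)⟩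

theorem IsBianchiModularForm.continuous_coeffV (hF : IsBianchiModularForm ι 𝔫 k ℓ φ F)
    (y : GL (Fin 2) (FinAdele K)) {n : ℕ} (hn : n ≤ k + ℓ + 2) (t : {t : ℝ // 0 < t}) :
    Continuous fun z : ℂ => (((t : ℝ) : ℂ)⁻¹) * coeffV n (F (H3.toGL (z, t), y)) :=
  continuous_const.mul ((hF.smooth y n hn).continuous_toGL t)

theorem IsBianchiModularForm.add (h₁ : IsBianchiModularForm ι 𝔫 k ℓ φ F₁)
    (h₂ : IsBianchiModularForm ι 𝔫 k ℓ φ F₂) : IsBianchiModularForm ι 𝔫 k ℓ φ (F₁ + F₂) := by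
  have hc : ∀ (y : GL (Fin 2) (FinAdele K)) (n : ℕ), n ≤ k + ℓ + 2 →
      (fun g => coeffV n ((F₁ + F₂) (g, y))) ∈
        casimirEigenspace ((k : ℂ) ^ 2 / 2 + k) ((ℓ : ℂ) ^ 2 / 2 + ℓ) := by
    intro y n hn
    have := add_mem (h₁.mem_casimirEigenspace y hn) (h₂.mem_casimirEigenspace y hn)
    convert this using 1
    funext g
    exact coeffV_add _ _ _
  refine ⟨fun γ g => ?_, fun z g => ?_, fun g u hu hu' => ?_, fun y n hn => (hc y n hn).1,
    fun y n hn => congrFun (hc y n hn).2.1, fun y n hn => congrFun (hc y n hn).2.2⟩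
  · rw [Pi.add_apply, h₁.left_invariant, h₂.left_invariant, Pi.add_apply]
  · rw [Pi.add_apply, h₁.central_action, h₂.central_action, Pi.add_apply, smul_add]
  · rw [Pi.add_apply, h₁.right_equivariant g u hu hu', h₂.right_equivariant g u hu hu',
      Pi.add_apply, map_add, smul_add]

theorem IsBianchiModularForm.const_smul (hF : IsBianchiModularForm ι 𝔫 k ℓ φ F) (c : ℂ) :
    IsBianchiModularForm ι 𝔫 k ℓ φ (c • F) := by
  have hc : ∀ (y : GL (Fin 2) (FinAdele K)) (n : ℕ), n ≤ k + ℓ + 2 →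
      (fun g => coeffV n ((c • F) (g, y))) ∈
        casimirEigenspace ((k : ℂ) ^ 2 / 2 + k) ((ℓ : ℂ) ^ 2 / 2 + ℓ) := by
    intro y n hn
    have := Submodule.smul_mem _ c (hF.mem_casimirEigenspace y hn)
    convert this using 1
    funext g
    exact coeffV_smul _ _ _
  refine ⟨fun γ g => ?_, fun z g => ?_, fun g u hu hu' => ?_, fun y n hn => (hc y n hn).1,
    fun y n hn => congrFun (hc y n hn).2.1, fun y n hn => congrFun (hc y n hn).2.2⟩
  · rw [Pi.smul_apply, hF.left_invariant, Pi.smul_apply]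
  · rw [Pi.smul_apply, hF.central_action, Pi.smul_apply, smul_comm]
  · rw [Pi.smul_apply, hF.right_equivariant g u hu hu', Pi.smul_apply, map_smul, smul_comm]

theorem MiddleTermsVanish.add {y : GL (Fin 2) (FinAdele K)}
    (h₁ : MiddleTermsVanish ι F₁ y) (h₂ : MiddleTermsVanish ι F₂ y)
    (hF₁ : IsBianchiModularForm ι 𝔫 k ℓ φ F₁) (hF₂ : IsBianchiModularForm ι 𝔫 k ℓ φ F₂) :
    MiddleTermsVanish ι (F₁ + F₂) y := by
  intro n hn hn'
  convert (h₁ n hn hn').add (h₂ n hn hn') (hF₁.continuous_coeffV y (by lia))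
    (hF₂.continuous_coeffV y (by lia)) using 2 with x
  rw [Pi.add_apply, coeffV_add, mul_add]

variable {ϖ : ∀ v : HeightOneSpectrum (𝓞 K), (v.adicCompletion K)ˣ}
  {𝔭 : {c : ClassGroup (𝓞 K) // c ≠ 1} → HeightOneSpectrum (𝓞 K)} {𝔞 : Ideal (𝓞 K)}

theorem IsCCuspidal.add (h𝔫 : 𝔫 = 𝔞 * 𝔪) (h0 : 𝔫 ≠ 0) (hϖ : IsUniformizers ϖ)
    (h𝔭 : IsClassReps 𝔫 𝔭) (hφ : IsHeckeCharacter ι 𝔫 k ℓ φ)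
    (h₁ : IsCCuspidal ι 𝔪 𝔫 k ℓ φ ϖ 𝔭 F₁) (h₂ : IsCCuspidal ι 𝔪 𝔫 k ℓ φ ϖ 𝔭 F₂) :
    IsCCuspidal ι 𝔪 𝔫 k ℓ φ ϖ 𝔭 (F₁ + F₂) :=
  .of_middleTermsVanish hφ (h₁.1.add h₂.1) fun _ hy =>
    (h₁.middleTermsVanish h𝔫 h0 hϖ h𝔭 hφ hy).add (h₂.middleTermsVanish h𝔫 h0 hϖ h𝔭 hφ hy) h₁.1 h₂.1

theorem IsCCuspidal.const_smul (h𝔫 : 𝔫 = 𝔞 * 𝔪) (h0 : 𝔫 ≠ 0) (hϖ : IsUniformizers ϖ)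
    (h𝔭 : IsClassReps 𝔫 𝔭) (hφ : IsHeckeCharacter ι 𝔫 k ℓ φ)
    (hF : IsCCuspidal ι 𝔪 𝔫 k ℓ φ ϖ 𝔭 F) (c : ℂ) :
    IsCCuspidal ι 𝔪 𝔫 k ℓ φ ϖ 𝔭 (c • F) :=
  .of_middleTermsVanish hφ (hF.1.const_smul c) fun _ hy =>
    (hF.middleTermsVanish h𝔫 h0 hϖ h𝔭 hφ hy).const_smul c

end LinearStructure

/-! ### Hecke operators on Bianchi forms and on C-cuspidal forms -/

section HeckeOperators

variable {ι : K →+* ℂ} {𝔪 𝔫 : Ideal (𝓞 K)} {k ℓ : ℕ} {φ : Idele K →* ℂˣ}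
  {F : AdelicFun K k ℓ}

/-- The summand `φ_𝔫(u)⁻¹ F(g u x)` of the operator of `K₀(𝔫) x K₀(𝔫)`. -/
def heckeTerm (𝔫 : Ideal (𝓞 K)) (φ : Idele K →* ℂˣ) (x : GL (Fin 2) (FinAdele K))
    (F : AdelicFun K k ℓ) (u : GL (Fin 2) (FinAdele K)) : AdelicFun K k ℓ :=
  fun g => (((nebentypus 𝔫 φ u)⁻¹ : ℂˣ) : ℂ) • F (g.1, g.2 * (u * x))

theorem doubleCosetOp_apply (𝔫 : Ideal (𝓞 K)) (φ : Idele K →* ℂˣ) (x : GL (Fin 2) (FinAdele K))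
    [Fintype (K0 𝔫 ⧸ conjStab 𝔫 x)] (F : AdelicFun K k ℓ) (g : GL2Adele K) :
    doubleCosetOp 𝔫 k ℓ φ x F g =
      ∑ q : K0 𝔫 ⧸ conjStab 𝔫 x, heckeTerm 𝔫 φ x F (q.out : GL (Fin 2) (FinAdele K)) g := by
  rw [doubleCosetOp, finsum_eq_sum_of_fintype, LinearMap.sum_apply, Finset.sum_apply]
  rfl

theorem IsBianchiModularForm.apply_mul (hF : IsBianchiModularForm ι 𝔫 k ℓ φ F)
    (g : GL (Fin 2) ℂ) (y : GL (Fin 2) (FinAdele K)) {κ : GL (Fin 2) (FinAdele K)}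
    (hκ : κ ∈ K0 𝔫) : F (g, y * κ) = (nebentypus 𝔫 φ κ : ℂ) • F (g, y) := by
  have h1 : (((1 : GL (Fin 2) ℂ), κ) : GL2Adele K).1.val ∈
      Matrix.specialUnitaryGroup (Fin 2) ℂ := by
    rw [Units.val_one]
    exact one_mem _
  have e : ((g, y * κ) : GL2Adele K) = (g, y) * (1, κ) := Prod.ext (mul_one _).symm rfl
  rw [e, hF.right_equivariant (g, y) (1, κ) hκ h1, Units.val_one, rho_one]

/-- Write `u s x = u x (x⁻¹ s x)`. The last factor lies in `K₀(𝔫)` and has the same lower right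
entry as `s`, so the scalar it produces cancels the contribution of `s` to `φ_𝔫(u s)⁻¹`. -/
theorem heckeTerm_mul_conjStab (hφ : IsHeckeCharacter ι 𝔫 k ℓ φ) (h0 : 𝔫 ≠ 0)
    (hF : IsBianchiModularForm ι 𝔫 k ℓ φ F) {a : (FinAdele K)ˣ} (u : K0 𝔫)
    {s : K0 𝔫} (hs : s ∈ conjStab 𝔫 (diagGL a 1)) :
    heckeTerm 𝔫 φ (diagGL a 1) F ((u * s : K0 𝔫) : GL (Fin 2) (FinAdele K)) =
      heckeTerm 𝔫 φ (diagGL a 1) F (u : GL (Fin 2) (FinAdele K)) := by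
  have hs' := mem_conjStab_iff.1 hs
  have hneb := nebentypus_diagGL_conj 𝔫 φ a (s : GL (Fin 2) (FinAdele K))
  generalize (diagGL a 1 : GL (Fin 2) (FinAdele K)) = x at hs' hneb ⊢
  rw [Subgroup.coe_mul]
  have hmul := nebentypus_mul hφ h0 u.2 s.2
  generalize (u : GL (Fin 2) (FinAdele K)) = u at hmul ⊢
  generalize (s : GL (Fin 2) (FinAdele K)) = s at hmul hs' hneb ⊢
  funext g
  unfold heckeTerm
  have e : g.2 * (u * s * x) = g.2 * (u * x) * (x⁻¹ * s * x) := by group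
  rw [e, hF.apply_mul _ _ hs', hneb, hmul, smul_smul, ← Units.val_mul, mul_inv,
    inv_mul_cancel_right]

theorem heckeTerm_out (hφ : IsHeckeCharacter ι 𝔫 k ℓ φ) (h0 : 𝔫 ≠ 0)
    (hF : IsBianchiModularForm ι 𝔫 k ℓ φ F) {a : (FinAdele K)ˣ} (u : K0 𝔫) :
    heckeTerm 𝔫 φ (diagGL a 1) F
        ((u : K0 𝔫 ⧸ conjStab 𝔫 (diagGL a 1)).out : GL (Fin 2) (FinAdele K)) =
      heckeTerm 𝔫 φ (diagGL a 1) F (u : GL (Fin 2) (FinAdele K)) := by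
  obtain ⟨s, hs⟩ := QuotientGroup.mk_out_eq_mul (conjStab 𝔫 (diagGL a 1)) u
  rw [hs]
  exact heckeTerm_mul_conjStab hφ h0 hF u s.2

theorem heckeTerm_right_mul (hφ : IsHeckeCharacter ι 𝔫 k ℓ φ) (h0 : 𝔫 ≠ 0)
    (hF : IsBianchiModularForm ι 𝔫 k ℓ φ F) (x : GL (Fin 2) (FinAdele K)) (g κ : GL2Adele K)
    (hκ : κ.2 ∈ K0 𝔫)
    (hκ' : (κ.1 : Matrix (Fin 2) (Fin 2) ℂ) ∈ Matrix.specialUnitaryGroup (Fin 2) ℂ) (u : K0 𝔫) :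
    heckeTerm 𝔫 φ x F (u : GL (Fin 2) (FinAdele K)) (g * κ) =
      (nebentypus 𝔫 φ κ.2 : ℂ) • rho (k + ℓ + 2) (κ.1 : Matrix (Fin 2) (Fin 2) ℂ)
        (heckeTerm 𝔫 φ x F (κ.2 * u) g) := by
  unfold heckeTerm
  have e : (((g * κ).1, (g * κ).2 * ((u : GL (Fin 2) (FinAdele K)) * x)) : GL2Adele K) =
      (g.1, g.2 * (κ.2 * u * x)) * (κ.1, 1) := by
    refine Prod.ext rfl ?_
    change g.2 * κ.2 * ((u : GL (Fin 2) (FinAdele K)) * x) = g.2 * (κ.2 * u * x) * 1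
    group
  rw [e, hF.right_equivariant _ (κ.1, 1) (one_mem _) hκ', nebentypus_one, Units.val_one, one_smul,
    map_smul, smul_smul, ← Units.val_mul, nebentypus_mul hφ h0 hκ u.2, mul_inv,
    mul_inv_cancel_left]

theorem doubleCosetOp_right_equivariant (hφ : IsHeckeCharacter ι 𝔫 k ℓ φ) (h0 : 𝔫 ≠ 0)
    (hF : IsBianchiModularForm ι 𝔫 k ℓ φ F) {a : (FinAdele K)ˣ}
    [Fintype (K0 𝔫 ⧸ conjStab 𝔫 (diagGL a 1))] (g κ : GL2Adele K) (hκ : κ.2 ∈ K0 𝔫)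
    (hκ' : (κ.1 : Matrix (Fin 2) (Fin 2) ℂ) ∈ Matrix.specialUnitaryGroup (Fin 2) ℂ) :
    doubleCosetOp 𝔫 k ℓ φ (diagGL a 1) F (g * κ) =
      (nebentypus 𝔫 φ κ.2 : ℂ) • rho (k + ℓ + 2) (κ.1 : Matrix (Fin 2) (Fin 2) ℂ)
        (doubleCosetOp 𝔫 k ℓ φ (diagGL a 1) F g) := by
  rw [doubleCosetOp_apply, doubleCosetOp_apply, map_sum, Finset.smul_sum]
  -- Left multiplication by the finite part of `κ` permutes the cosets; the chosen representatives
  -- are not respected, which `heckeTerm_out` makes harmless.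
  refine Fintype.sum_equiv (MulAction.toPerm (⟨κ.2, hκ⟩ : K0 𝔫)) _ _ fun q => ?_
  rw [heckeTerm_right_mul hφ h0 hF _ g κ hκ hκ']
  congr 2
  have e : MulAction.toPerm (⟨κ.2, hκ⟩ : K0 𝔫) q =
      (((⟨κ.2, hκ⟩ * q.out : K0 𝔫)) : K0 𝔫 ⧸ conjStab 𝔫 (diagGL a 1)) := by
    conv_lhs => rw [← QuotientGroup.out_eq' q]
    rfl
  rw [e, heckeTerm_out hφ h0 hF]
  rfl

theorem IsBianchiModularForm.doubleCosetOp (hφ : IsHeckeCharacter ι 𝔫 k ℓ φ) (h0 : 𝔫 ≠ 0)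
    (hF : IsBianchiModularForm ι 𝔫 k ℓ φ F) {a : (FinAdele K)ˣ}
    [Fintype (K0 𝔫 ⧸ conjStab 𝔫 (diagGL a 1))] :
    IsBianchiModularForm ι 𝔫 k ℓ φ (doubleCosetOp 𝔫 k ℓ φ (diagGL a 1) F) := by
  have hc : ∀ (y : GL (Fin 2) (FinAdele K)) (n : ℕ), n ≤ k + ℓ + 2 →
      (fun g => coeffV n (Bianchi.doubleCosetOp 𝔫 k ℓ φ (diagGL a 1) F (g, y))) ∈
        casimirEigenspace ((k : ℂ) ^ 2 / 2 + k) ((ℓ : ℂ) ^ 2 / 2 + ℓ) := by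
    intro y n hn
    have := Submodule.sum_smul_mem
      (casimirEigenspace ((k : ℂ) ^ 2 / 2 + k) ((ℓ : ℂ) ^ 2 / 2 + ℓ))
      (fun q : K0 𝔫 ⧸ conjStab 𝔫 (diagGL a 1) =>
        (((nebentypus 𝔫 φ (q.out : GL (Fin 2) (FinAdele K)))⁻¹ : ℂˣ) : ℂ))
      (t := Finset.univ) (fun q _ => hF.mem_casimirEigenspace
        (y * ((q.out : GL (Fin 2) (FinAdele K)) * diagGL a 1)) hn)
    convert this using 1
    funext g
    rw [doubleCosetOp_apply, Finset.sum_apply]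
    have hsum : ∀ (s : Finset (K0 𝔫 ⧸ conjStab 𝔫 (diagGL a 1)))
        (P : (K0 𝔫 ⧸ conjStab 𝔫 (diagGL a 1)) → V (k + ℓ + 2)),
        coeffV n (∑ q ∈ s, P q) = ∑ q ∈ s, coeffV n (P q) := fun s P => by
      induction s using Finset.induction_on with
      | empty => simp [coeffV]
      | insert q s hq ih => rw [Finset.sum_insert hq, Finset.sum_insert hq, coeffV_add, ih]
    rw [hsum]
    exact Finset.sum_congr rfl fun q _ => coeffV_smul _ _ _
  refine ⟨fun γ g => ?_, fun z g => ?_,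
    fun g u hu hu' => doubleCosetOp_right_equivariant hφ h0 hF g u hu hu',
    fun y n hn => (hc y n hn).1,
    fun y n hn => congrFun (hc y n hn).2.1, fun y n hn => congrFun (hc y n hn).2.2⟩
  · rw [doubleCosetOp_apply, doubleCosetOp_apply]
    refine Finset.sum_congr rfl fun q _ => ?_
    unfold heckeTerm
    rw [← hF.left_invariant γ (g.1, _)]
    congr 2
    exact Prod.ext rfl (mul_assoc _ _ _)
  · rw [doubleCosetOp_apply, doubleCosetOp_apply, Finset.smul_sum]
    refine Finset.sum_congr rfl fun q _ => ?_
    unfold heckeTerm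
    rw [smul_comm, ← hF.central_action z (g.1, _)]
    congr 2
    exact Prod.ext rfl (mul_assoc _ _ _)

/-- Even the zero function needs a lattice of periods, that is, a `ℚ`-basis of `K` indexed by `Fin
2`; this is where the degree of `K` enters. -/
theorem TrivialConstantTerm.zero (hK : Module.finrank ℚ K = 2) (ι : K →+* ℂ) :
    TrivialConstantTerm ι (fun _ => 0) :=
  ⟨Module.finBasisOfFinrankEq ℚ K hK, fun _ _ _ => rfl, fun _ => by simp⟩

theorem MiddleTermsVanish.doubleCosetOp (hK : Module.finrank ℚ K = 2)
    (hF : IsBianchiModularForm ι 𝔫 k ℓ φ F) {x y : GL (Fin 2) (FinAdele K)}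
    [Fintype (K0 𝔫 ⧸ conjStab 𝔫 x)] (h : ∀ u ∈ K0 𝔫, MiddleTermsVanish ι F (y * (u * x))) :
    MiddleTermsVanish ι (doubleCosetOp 𝔫 k ℓ φ x F) y := by
  intro n hn hn'
  -- Continuity in `z` is carried through the induction because `TrivialConstantTerm.add` requires
  -- it of both summands.
  have hsum : ∀ s : Finset (K0 𝔫 ⧸ conjStab 𝔫 x),
      TrivialConstantTerm ι (fun z : H3 => (((z.2 : ℝ) : ℂ)⁻¹) * coeffV n
        (∑ q ∈ s, heckeTerm 𝔫 φ x F (q.out : GL (Fin 2) (FinAdele K)) (H3.toGL z, y))) ∧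
      ∀ t : {t : ℝ // 0 < t}, Continuous fun z : ℂ => (((t : ℝ) : ℂ)⁻¹) * coeffV n
        (∑ q ∈ s, heckeTerm 𝔫 φ x F (q.out : GL (Fin 2) (FinAdele K)) (H3.toGL (z, t), y)) := by
    intro s
    induction s using Finset.induction_on with
    | empty =>
      have e : coeffV n (0 : V (k + ℓ + 2)) = 0 := by simp [coeffV]
      simp only [Finset.sum_empty, e, mul_zero]
      exact ⟨.zero hK ι, fun _ => continuous_const⟩
    | insert q s hq ih =>
      simp only [Finset.sum_insert hq, coeffV_add, mul_add]
      set c : ℂ := (((nebentypus 𝔫 φ (q.out : GL (Fin 2) (FinAdele K)))⁻¹ : ℂˣ) : ℂ) with hc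
      have e : ∀ z : H3, (((z.2 : ℝ) : ℂ)⁻¹) * coeffV n
          (heckeTerm 𝔫 φ x F (q.out : GL (Fin 2) (FinAdele K)) (H3.toGL z, y)) =
          c * ((((z.2 : ℝ) : ℂ)⁻¹) * coeffV n
            (F (H3.toGL z, y * ((q.out : GL (Fin 2) (FinAdele K)) * x)))) := by
        intro z
        unfold heckeTerm
        rw [coeffV_smul, mul_left_comm]
      have h1 : TrivialConstantTerm ι fun z : H3 => (((z.2 : ℝ) : ℂ)⁻¹) * coeffV n
          (heckeTerm 𝔫 φ x F (q.out : GL (Fin 2) (FinAdele K)) (H3.toGL z, y)) := by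
        simp only [e]
        exact (h _ q.out.2 n hn hn').const_mul c
      have h2 : ∀ t : {t : ℝ // 0 < t}, Continuous fun z : ℂ => (((t : ℝ) : ℂ)⁻¹) * coeffV n
          (heckeTerm 𝔫 φ x F (q.out : GL (Fin 2) (FinAdele K)) (H3.toGL (z, t), y)) := by
        intro t
        have := continuous_const (y := c) |>.mul (hF.continuous_coeffV
          (y * ((q.out : GL (Fin 2) (FinAdele K)) * x)) (n := n) (by lia) t)
        convert this using 2 with z
        exact e (z, t)
      exact ⟨h1.add ih.1 h2 ih.2, fun t => (h2 t).add (ih.2 t)⟩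
  convert (hsum Finset.univ).1 using 4 with z
  exact doubleCosetOp_apply _ _ _ _ _

variable {ϖ : ∀ v : HeightOneSpectrum (𝓞 K), (v.adicCompletion K)ˣ}
  {𝔭 : {c : ClassGroup (𝓞 K) // c ≠ 1} → HeightOneSpectrum (𝓞 K)} {𝔞 : Ideal (𝓞 K)}

/-- By the adelic criterion it suffices that `y u x` stays in the cell of `y`. This holds for both
cells as soon as `𝔮 ∤ 𝔪`, whether or not `𝔮` divides `𝔫`. -/
theorem IsCCuspidal.heckeOp (hK : Module.finrank ℚ K = 2) (h𝔫 : 𝔫 = 𝔞 * 𝔪) (h0 : 𝔫 ≠ 0)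
    (hϖ : IsUniformizers ϖ) (h𝔭 : IsClassReps 𝔫 𝔭) (hφ : IsHeckeCharacter ι 𝔫 k ℓ φ)
    (hF : IsCCuspidal ι 𝔪 𝔫 k ℓ φ ϖ 𝔭 F) {𝔮 : HeightOneSpectrum (𝓞 K)}
    (h𝔮 : ¬ 𝔮.asIdeal ∣ 𝔪) : IsCCuspidal ι 𝔪 𝔫 k ℓ φ ϖ 𝔭 (heckeOp 𝔫 k ℓ φ ϖ 𝔮 F) := by
  have : Finite (K0 𝔫 ⧸ conjStab 𝔫 (diagGL (localIdele 𝔮 (ϖ 𝔮)) 1)) :=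
    finite_quotient_conjStab 𝔮 (hϖ 𝔮)
  have := Fintype.ofFinite (K0 𝔫 ⧸ conjStab 𝔫 (diagGL (localIdele 𝔮 (ϖ 𝔮)) 1))
  have hle : 𝔫 ≤ 𝔪 := h𝔫 ▸ Ideal.mul_le_right
  refine .of_middleTermsVanish hφ (hF.1.doubleCosetOp hφ h0) fun y hy => ?_
  refine .doubleCosetOp hK hF.1 fun u hu => ?_
  refine hF.middleTermsVanish h𝔫 h0 hϖ h𝔭 hφ ?_
  rw [← mul_assoc]
  have h1 : localGL 𝔮 (1 : GL (Fin 2) (FinAdele K)) ∈ localK0 𝔮 𝔪 := by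
    rw [map_one]
    exact one_mem _
  have hw : localGL 𝔮 (weyl : GL (Fin 2) (FinAdele K)) ∈ localK0 𝔮 𝔪 := by
    rw [localGL_weyl]
    exact weyl_mem_localK0 h𝔮
  exact hy.imp
    (fun hy => mul_diagGL_mem_bruhatCell h𝔮 h1 (mul_mem_bruhatCell hy (K0_mono hle hu)) _)
    (fun hy => mul_diagGL_mem_bruhatCell h𝔮 hw (mul_mem_bruhatCell hy (K0_mono hle hu)) _)

end HeckeOperators

theorem not_asIdeal_dvd_of_isCoprime {𝔮 : HeightOneSpectrum (𝓞 K)} {𝔪 𝔞 : Ideal (𝓞 K)}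
    (h : IsCoprime 𝔪 𝔞) (h𝔮 : 𝔮.asIdeal ∣ 𝔞) : ¬ 𝔮.asIdeal ∣ 𝔪 := fun h' =>
  𝔮.isPrime.ne_top (Ideal.isUnit_iff.1 (h.isUnit_of_dvd' h' h𝔮))

end Bianchi

end

theorem mainTheorem7 (K : Type*) [Field K] [NumberField K] [NumberField.IsTotallyComplex K]
    (hK : Module.finrank ℚ K = 2) (ι : K →+* ℂ)
    (p : ℕ) (hp : p.Prime)
    (𝔪 𝔫 : Ideal (𝓞 K)) (hpm : IsCoprime 𝔪 (Ideal.span {(p : 𝓞 K)}))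
    (h𝔫 : 𝔫 = Ideal.span {(p : 𝓞 K)} * 𝔪)
    (k ℓ : ℕ) (φ : Bianchi.Idele K →* ℂˣ) (hφ : Bianchi.IsHeckeCharacter ι 𝔫 k ℓ φ)
    (ϖ : ∀ v : HeightOneSpectrum (𝓞 K), (v.adicCompletion K)ˣ) (hϖ : Bianchi.IsUniformizers ϖ)
    (𝔭 : {c : ClassGroup (𝓞 K) // c ≠ 1} → HeightOneSpectrum (𝓞 K))
    (h𝔭 : Bianchi.IsClassReps 𝔫 𝔭) :
    ∀ A ∈ Bianchi.heckeAlgebra 𝔫 p k ℓ φ ϖ, ∀ F : Bianchi.AdelicFun K k ℓ,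
      Bianchi.IsCCuspidal ι 𝔪 𝔫 k ℓ φ ϖ 𝔭 F →
        Bianchi.IsCCuspidal ι 𝔪 𝔫 k ℓ φ ϖ 𝔭 (A F) := by
  have hp0 : Ideal.span {(p : 𝓞 K)} ≠ 0 := by
    rw [Ideal.zero_eq_bot, Ne, Ideal.span_singleton_eq_bot]
    exact_mod_cast hp.ne_zero
  have hm0 : 𝔪 ≠ 0 := by
    rintro rfl
    -- If `𝔪 = 0`, coprimality makes `(p)` the unit ideal, whereas its norm is `p ^ [K : ℚ] ≠ 1`.
    have h1 := Ideal.absNorm_span_natCast (S := 𝓞 K) p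
    rw [Ideal.isUnit_iff.1 (isCoprime_zero_left.1 hpm), Ideal.absNorm_top] at h1
    exact hp.ne_one ((pow_eq_one_iff.1 h1.symm).resolve_right Module.finrank_pos.ne')
  have h0 : 𝔫 ≠ 0 := h𝔫 ▸ mul_ne_zero hp0 hm0
  intro A hA
  induction hA using Algebra.adjoin_induction with
  | mem A hA =>
    intro F hF
    obtain ⟨𝔮, h𝔮, rfl⟩ | ⟨𝔮, h𝔮, rfl⟩ := hA
    -- A prime dividing `𝔪` divides `𝔫`, so it would not be coprime to `𝔫`.
    · exact hF.heckeOp hK h𝔫 h0 hϖ h𝔭 hφ fun h =>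
        Bianchi.not_asIdeal_dvd_of_isCoprime h𝔮 (h.trans (h𝔫 ▸ dvd_mul_left _ _)) dvd_rfl
    · exact hF.heckeOp hK h𝔫 h0 hϖ h𝔭 hφ (Bianchi.not_asIdeal_dvd_of_isCoprime hpm h𝔮)
  | algebraMap r =>
    intro F hF
    have e : algebraMap ℚ (Module.End ℂ (Bianchi.AdelicFun K k ℓ)) r F = (r : ℂ) • F := by
      rw [Algebra.algebraMap_eq_smul_one, LinearMap.smul_apply, Module.End.one_apply,
        Rat.cast_smul_eq_qsmul]
    rw [e]
    exact hF.const_smul h𝔫 h0 hϖ h𝔭 hφ _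
  | add A B _ _ hA hB => exact fun F hF => (hA F hF).add h𝔫 h0 hϖ h𝔭 hφ (hB F hF)
  | mul A B _ _ hA hB => exact fun F hF => hA _ (hB F hF)
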